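/- **Theorem 17 (SLP to LZ77).** A straight line program (SLP) of size $n\ge 1$ is a sequence of assignments $X_i\to expr_i$ ($1\le i\le n$), where each $expr_i$ is a letter of a finite alphabet $\Sigma$ or a pair $X_\ell X_r$ with $\ell,r<i$; it represents the string $S$ derived from $X_n$. Let $N=|S|$. The LZ77 factorization of $S$ without (respectively with) self-references is the factorization $S=f_1\cdots f_m$ into nonempty strings in which each $f_i$ is the longest prefix $g$ of $f_i\cdots f_m$ such that $g$ is a single letter or a substring of $f_1\cdots f_{i-1}$ (respectively of $f_1\cdots f_{i-1}g'$, where $g'$ is $g$ without its last symbol). Its size is $m$, and it is output as a sequence of $m$ items, the $i$-th being either the letter $f_i$ (if $|f_i|=1$) or the starting position and length of an occurrence of $f_i$ in $f_1\cdots f_{i-1}$ (respectively in $f_1\cdots f_{i-1}f_i'$). For each of the two variants there is an algorithm on a word RAM (unit-cost arithmetic, comparison and memory access on words, with a word size of at least $c\log_2(n+N)$ bits for a suitable constant $c$, and letters of $\Sigma$ fitting into one word) which, given any SLP of size $n$ representing a string $S$ of length $N$, computes the LZ77 factorization of $S$, of size $m$, in $O(m\,n^3(1+\log N))$ time. The algorithm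 and the constants depend neither on the SLP nor on $\Sigma$ nor on the word size. -/

import Mathlib

/-! ## Straight line programs -/

/-- Right-hand side of the `i`-th assignment: a letter, or a pair of strictly earlier variables. -/
inductive SLPExpr (α : Type) (i : ℕ) : Type
  | letter (a : α)
  | pair (l r : Fin i)

/-- A straight line program over `α`: assignments `X_0, …, X_{size-1}`, at least one. -/
structure SLP (α : Type) where
  size : ℕ
  size_pos : 0 < size
  rule : (i : Fin size) → SLPExpr α i

namespace SLP

variable {α : Type}

/-- The string derived from the variable `X_i`. -/
def val (G : SLP α) (i : Fin G.size) : List α :=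
  match G.rule i with
  | .letter a => [a]
  | .pair l r => G.val ⟨l, l.isLt.trans i.isLt⟩ ++ G.val ⟨r, r.isLt.trans i.isLt⟩
termination_by i.val
decreasing_by
  · exact l.isLt
  · exact r.isLt

/-- The string represented by an SLP is that of its last variable. -/
def str (G : SLP α) : List α :=
  G.val ⟨G.size - 1, Nat.sub_lt G.size_pos Nat.one_pos⟩

/-- Three words for one assignment. -/
def encodeExpr {σ i : ℕ} : SLPExpr (Fin σ) i → List ℕ
  | .letter a => [0, a.val, 0]
  | .pair l r => [1, l.val, r.val]

/-- The input words: the size, followed by the assignments in order. -/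
def encode {σ : ℕ} (G : SLP (Fin σ)) : List ℕ :=
  G.size :: (List.ofFn fun i => encodeExpr (G.rule i)).flatten

end SLP

/-! ## The LZ77 factorization -/

namespace LZ77

variable {α : Type}

/-- The text in which an earlier occurrence of a candidate factor `g` is sought, when `p` is the
concatenation of the previous factors: `p` itself without self-references, and `p` followed by
`g` minus its last symbol with self-references. -/
def window (selfRef : Bool) (p g : List α) : List α :=
  if selfRef then p ++ g.dropLast else p

/-- `g` is a single letter or a substring of its window. -/
def Admissible (selfRef : Bool) (p g : List α) : Prop :=
  (∃ a, g = [a]) ∨ g <:+: window selfRef p g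

/-- `fs` is the LZ77 factorization of `S`: a factorization into nonempty strings, each of which is
the longest admissible prefix of what remains of `S`. -/
def IsFactorization (selfRef : Bool) (S : List α) (fs : List (List α)) : Prop :=
  fs.flatten = S ∧
  ∀ (i : ℕ) (hi : i < fs.length),
    fs[i] ≠ [] ∧
    Admissible selfRef (fs.take i).flatten fs[i] ∧
    ∀ g : List α, g <+: (fs.drop i).flatten → Admissible selfRef (fs.take i).flatten g →
      g.length ≤ fs[i].length

/-- Description of one factor: a letter, or a pointer to an earlier occurrence
(starting position, counted from `0`, and length). -/
inductive Token (α : Type) : Type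
  | letter (a : α)
  | ref (pos len : ℕ)

/-- The token describes the factor `f`, when `p` is the concatenation of the previous factors. -/
def Token.Describes (selfRef : Bool) (p f : List α) : Token α → Prop
  | .letter a => f = [a]
  | .ref pos len =>
      f.length = len ∧ pos + len ≤ (window selfRef p f).length ∧
        ((window selfRef p f).drop pos).take len = f

/-- `ts` is an LZ77 encoding of the factorization `fs`: one token for each factor. -/
def IsEncoding (selfRef : Bool) (fs : List (List α)) (ts : List (Token α)) : Prop :=
  ts.length = fs.length ∧
  ∀ (i : ℕ) (hf : i < fs.length) (ht : i < ts.length),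
    ts[i].Describes selfRef (fs.take i).flatten fs[i]

/-- The output words for one token. -/
def Token.encode {σ : ℕ} : Token (Fin σ) → List ℕ
  | .letter a => [0, a.val]
  | .ref pos len => [1, pos, len]

end LZ77

/-! ## A word RAM

Programs are finite and independent of the word size `w`. Every register and every memory cell
holds a natural number below `2 ^ w`; memory is addressed by words; each arithmetic instruction,
comparison, memory access, output of a word and test costs one step. -/

namespace WordRAM

inductive Op : Type
  | add | sub | mul | div | mod | lt | eq

/-- Arithmetic on words: addition and multiplication modulo `2 ^ w`, truncated subtraction,
integer quotient and remainder, and comparisons with value `0` or `1`. -/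
def Op.eval (w : ℕ) : Op → ℕ → ℕ → ℕ
  | .add, a, b => (a + b) % 2 ^ w
  | .sub, a, b => a - b
  | .mul, a, b => (a * b) % 2 ^ w
  | .div, a, b => a / b
  | .mod, a, b => a % b
  | .lt, a, b => (if a < b then 1 else 0) % 2 ^ w
  | .eq, a, b => (if a = b then 1 else 0) % 2 ^ w

/-- Programs; the numbers `d`, `a`, `b` name registers. -/
inductive Program : Type
  | skip
  /-- `R[d] := k` -/
  | const (d k : ℕ)
  /-- `R[d] := R[a] o R[b]` -/
  | arith (o : Op) (d a b : ℕ)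
  /-- `R[d] := M[R[a]]` -/
  | load (d a : ℕ)
  /-- `M[R[a]] := R[b]` -/
  | store (a b : ℕ)
  /-- append `R[a]` to the output -/
  | out (a : ℕ)
  | seq (p q : Program)
  /-- if `R[a] ≠ 0` then `p` else `q` -/
  | cond (a : ℕ) (p q : Program)
  /-- while `R[a] ≠ 0` do `p` -/
  | loop (a : ℕ) (p : Program)

structure State where
  reg : ℕ → ℕ
  mem : ℕ → ℕ
  output : List ℕ

/-- The input occupies the memory cells from `0` on; everything else is zero. -/
def State.init (input : List ℕ) : State where
  reg := fun _ => 0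
  mem := fun i => input.getD i 0
  output := []

/-- `Exec w p s s' t`: with word size `w`, the program `p` started in state `s` halts in state `s'`
after `t` steps. -/
inductive Exec (w : ℕ) : Program → State → State → ℕ → Prop
  | skip (s : State) : Exec w .skip s s 1
  | const (s : State) (d k : ℕ) :
      Exec w (.const d k) s { s with reg := Function.update s.reg d (k % 2 ^ w) } 1
  | arith (s : State) (o : Op) (d a b : ℕ) :
      Exec w (.arith o d a b) s
        { s with reg := Function.update s.reg d (o.eval w (s.reg a) (s.reg b)) } 1
  | load (s : State) (d a : ℕ) :
      Exec w (.load d a) s { s with reg := Function.update s.reg d (s.mem (s.reg a)) } 1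
  | store (s : State) (a b : ℕ) :
      Exec w (.store a b) s { s with mem := Function.update s.mem (s.reg a) (s.reg b) } 1
  | out (s : State) (a : ℕ) :
      Exec w (.out a) s { s with output := s.output ++ [s.reg a] } 1
  | seq {p q : Program} {s s' s'' : State} {t t' : ℕ} :
      Exec w p s s' t → Exec w q s' s'' t' → Exec w (.seq p q) s s'' (t + t')
  | cond_true {a : ℕ} {p q : Program} {s s' : State} {t : ℕ} :
      s.reg a ≠ 0 → Exec w p s s' t → Exec w (.cond a p q) s s' (t + 1)
  | cond_false {a : ℕ} {p q : Program} {s s' : State} {t : ℕ} :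
      s.reg a = 0 → Exec w q s s' t → Exec w (.cond a p q) s s' (t + 1)
  | loop_true {a : ℕ} {p : Program} {s s' s'' : State} {t t' : ℕ} :
      s.reg a ≠ 0 → Exec w p s s' t → Exec w (.loop a p) s' s'' t' →
        Exec w (.loop a p) s s'' (t + t' + 1)
  | loop_false {a : ℕ} {p : Program} {s : State} :
      s.reg a = 0 → Exec w (.loop a p) s s 1

end WordRAM

/-! ## Structured programs with expressions

Programs are written with expressions, which are compiled into instructions that use the registers
from `100` on as scratch space. -/

namespace WordRAM

/-! The algorithm keeps a table that describes, for a pattern and a variable, the occurrences of the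
pattern in the string of the variable. There is one row for the string of each variable, and two
work rows serve the prefixes of the factor that is being determined.

Table entries. An occurrence in a pair `X_j → X_l X_r` is crossing if it has letters on both sides
of the cut. The starts of two crossing occurrences differ by less than the length of the pattern,
and occurrences that close to each other form an arithmetic progression (`Occ.At.sub_gap`). Hence
three words describe all crossing occurrences, and a fourth one holds the first occurrence in `X_j`.
With such a row the next occurrence from a given position on is found in O(n) steps by one descent
through the grammar (`runs_nextOcc`): at each pair the progression contributes its next term, and a
step to the left also collects the first occurrence in the right part.

Concatenation. Given the rows of `u` and `v`, the row of `uv` is built entry by entry. Say that `u`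
is the longer half. The starts of crossing occurrences of `uv` lie in a window covered by two chunks
no wider than `|u|`, and within a chunk the occurrences of `u` form a progression `x₀ + s d`. The
first position where both halves match is `x₀`, or the last term, or the first occurrence of `u`
from the first match of `v` past `x₀ + d` on. Indeed, suppose that `v` matches at an inner term `t`
but not at the term `t - 1`. A match of `v` between `x₀ + d` and the term `t - 1` would spread the
period `d` from the run of copies of `u` over `v`, and would so force the match at `t - 1`
(`Occ.not_at_after`, `Occ.not_at_before`, `first_common`). The last term comes from a binary search.
An entry costs O(n(1 + log N)), a row n times as much.

Factors. A prefix of a substring with an earlier occurrence has one too (`Gram.Earlier.mono`), and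
whether there is an earlier occurrence can be seen from the first occurrence in the whole text,
which is a word of the table (`Gram.near_next_iff`). So the longest factor can be grown greedily.
The text from `p` on is the leaf at `p` followed by at most n variables to the right of its path.
The next variable is appended as a whole if possible; otherwise the factor ends inside it, and only
its two parts remain to be tried. At most 3n trials are made (`runs_extend`), each of which computes
one row, which gives O(n³(1 + log N)) per factor. The rows of all variables together cost no more
than that bound for one factor.

Overflow. Variables that the last one does not use may be far longer than the text; `prune` turns
them into letters, and afterwards all lengths are at most N. Behind the input, memory holds the rows
`0` to `n - 1` of the variables, the work rows `n` and `n + 1`, and a row `n + 2` for lengths, marks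
and the stack of variables. -/

inductive Exp : Type
  | lit (k : ℕ)
  | var (r : ℕ)
  | bin (o : Op) (a b : Exp)
  | ld (a : Exp)

namespace Exp

instance (k : ℕ) : OfNat Exp k := ⟨.lit k⟩
instance : Add Exp := ⟨.bin .add⟩
instance : Sub Exp := ⟨.bin .sub⟩
instance : Mul Exp := ⟨.bin .mul⟩
instance : Div Exp := ⟨.bin .div⟩
def lt (a b : Exp) : Exp := .bin .lt a b
def eq (a b : Exp) : Exp := .bin .eq a b

end Exp

/-- The operations on natural numbers, without overflow. -/
def Op.nat : Op → ℕ → ℕ → ℕ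
  | .add, a, b => a + b
  | .sub, a, b => a - b
  | .mul, a, b => a * b
  | .div, a, b => a / b
  | .mod, a, b => a % b
  | .lt, a, b => if a < b then 1 else 0
  | .eq, a, b => if a = b then 1 else 0

/-- A sufficient condition for an operation not to overflow. -/
def Op.Safe (W : ℕ) : Op → ℕ → ℕ → Prop
  | .add, a, b => a + b < W
  | .mul, a, b => a * b < W
  | .lt, _, _ => 1 < W
  | .eq, _, _ => 1 < W
  | _, _, _ => True

theorem Op.eval_of_safe {w : ℕ} (o : Op) (a b : ℕ) (h : o.Safe (2 ^ w) a b) :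
    o.eval w a b = o.nat a b := by
  cases o <;> simp only [Op.eval, Op.nat, Op.Safe] at * <;> try exact Nat.mod_eq_of_lt h
  all_goals split_ifs <;> first | exact Nat.mod_eq_of_lt h | exact Nat.zero_mod _

/-- The number of words. -/
def cap (w : ℕ) : ℕ := 2 ^ w

namespace Exp

def eval (H : State) : Exp → ℕ
  | lit k => k
  | var r => H.reg r
  | bin o a b => o.nat (a.eval H) (b.eval H)
  | ld a => H.mem (a.eval H)

/-- Nothing overflows and no scratch register is read. -/
def Ok (w : ℕ) (H : State) : Exp → Prop
  | lit k => k < cap w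
  | var r => r < 100
  | bin o a b => a.Ok w H ∧ b.Ok w H ∧ o.Safe (cap w) (a.eval H) (b.eval H)
  | ld a => a.Ok w H

def cost : Exp → ℕ
  | lit _ => 1
  | var _ => 2
  | bin _ a b => a.cost + b.cost + 1
  | ld a => a.cost + 1

/-- Code that computes an expression into the register `d`, using the registers from `d` on. -/
def code (d : ℕ) : Exp → Program
  | lit k => .const d k
  | var r => .seq (.const d 0) (.arith .sub d r d)
  | bin o a b => .seq (.seq (a.code d) (b.code (d + 1))) (.arith o d d (d + 1))
  | ld a => .seq (a.code d) (.load d d)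

section simps
variable (H : State) (w : ℕ) (a b : Exp) (k : ℕ)

@[simp] theorem eval_ofNat : (no_index (OfNat.ofNat k) : Exp).eval H = (OfNat.ofNat k : ℕ) := rfl
@[simp] theorem eval_var : (var k).eval H = H.reg k := rfl
@[simp] theorem eval_lit : (lit k).eval H = k := rfl
@[simp] theorem eval_ld : (ld a).eval H = H.mem (a.eval H) := rfl
@[simp] theorem eval_add : (a + b).eval H = a.eval H + b.eval H := rfl
@[simp] theorem eval_sub : (a - b).eval H = a.eval H - b.eval H := rfl
@[simp] theorem eval_mul : (a * b).eval H = a.eval H * b.eval H := rfl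
@[simp] theorem eval_div : (a / b).eval H = a.eval H / b.eval H := rfl
@[simp] theorem eval_lt : (lt a b).eval H = if a.eval H < b.eval H then 1 else 0 := rfl
@[simp] theorem eval_eq : (eq a b).eval H = if a.eval H = b.eval H then 1 else 0 := rfl

@[simp] theorem ok_ofNat :
    (no_index (OfNat.ofNat k) : Exp).Ok w H ↔ (OfNat.ofNat k : ℕ) < cap w := Iff.rfl
@[simp] theorem ok_var : (var k).Ok w H ↔ k < 100 := Iff.rfl
@[simp] theorem ok_lit : (lit k).Ok w H ↔ k < cap w := Iff.rfl
@[simp] theorem ok_ld : (ld a).Ok w H ↔ a.Ok w H := Iff.rfl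
@[simp] theorem ok_add :
    (a + b).Ok w H ↔ a.Ok w H ∧ b.Ok w H ∧ a.eval H + b.eval H < cap w := Iff.rfl
@[simp] theorem ok_sub : (a - b).Ok w H ↔ a.Ok w H ∧ b.Ok w H := by
  change _ ∧ _ ∧ True ↔ _; simp
@[simp] theorem ok_mul :
    (a * b).Ok w H ↔ a.Ok w H ∧ b.Ok w H ∧ a.eval H * b.eval H < cap w := Iff.rfl
@[simp] theorem ok_div : (a / b).Ok w H ↔ a.Ok w H ∧ b.Ok w H := by
  change _ ∧ _ ∧ True ↔ _; simp
@[simp] theorem ok_lt : (lt a b).Ok w H ↔ a.Ok w H ∧ b.Ok w H ∧ 1 < cap w := Iff.rfl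
@[simp] theorem ok_eq : (eq a b).Ok w H ↔ a.Ok w H ∧ b.Ok w H ∧ 1 < cap w := Iff.rfl

@[simp] theorem cost_ofNat : (no_index (OfNat.ofNat k) : Exp).cost = 1 := rfl
@[simp] theorem cost_var : (var k).cost = 2 := rfl
@[simp] theorem cost_lit : (lit k).cost = 1 := rfl
@[simp] theorem cost_ld : (ld a).cost = a.cost + 1 := rfl
@[simp] theorem cost_add : (a + b).cost = a.cost + b.cost + 1 := rfl
@[simp] theorem cost_sub : (a - b).cost = a.cost + b.cost + 1 := rfl
@[simp] theorem cost_mul : (a * b).cost = a.cost + b.cost + 1 := rfl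
@[simp] theorem cost_div : (a / b).cost = a.cost + b.cost + 1 := rfl
@[simp] theorem cost_lt : (lt a b).cost = a.cost + b.cost + 1 := rfl
@[simp] theorem cost_eq : (eq a b).cost = a.cost + b.cost + 1 := rfl

end simps

/-- The right operand is computed from register `d + 1` on, so the left one survives in `d`. Only
registers below `100` are read, and there `s` agrees with `H`. The number of steps depends on the
expression alone. -/
theorem exec_code {w : ℕ} {H : State} (e : Exp) (h : e.Ok w H) (d : ℕ) (hd : 100 ≤ d) (s : State)
    (hr : ∀ r < 100, s.reg r = H.reg r) (hm : s.mem = H.mem) :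
    ∃ s', Exec w (e.code d) s s' e.cost ∧ s'.reg d = e.eval H ∧ (∀ r < d, s'.reg r = s.reg r) ∧
      s'.mem = s.mem ∧ s'.output = s.output := by
  induction e generalizing d s with
  | lit k =>
    refine ⟨_, .const s d k, ?_, ?_, rfl, rfl⟩
    · simpa using Nat.mod_eq_of_lt (b := 2 ^ w) h
    · intro r hrd; simp [Function.update_of_ne hrd.ne]
  | var r =>
    have hr100 : r < 100 := h
    -- A register is copied by subtracting zero: subtraction is not reduced modulo `2 ^ w`, so no
    -- bound on the content is needed.
    refine ⟨_, .seq (.const s d 0) (.arith _ .sub d r d), ?_, ?_, rfl, rfl⟩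
    · have : r ≠ d := by omega
      simp [Op.eval, Function.update_of_ne this, hr r hr100]
    · intro r' hrd; simp [Function.update_of_ne hrd.ne]
  | bin o a b iha ihb =>
    obtain ⟨ha, hb, ho⟩ := h
    obtain ⟨s₁, e₁, v₁, r₁, m₁, o₁⟩ := iha ha d hd s hr hm
    obtain ⟨s₂, e₂, v₂, r₂, m₂, o₂⟩ := ihb hb (d + 1) (by omega) s₁
      (fun r h => by rw [r₁ r (by omega), hr r h]) (m₁.trans hm)
    refine ⟨_, .seq (.seq e₁ e₂) (.arith s₂ o d d (d + 1)), ?_, ?_, m₂.trans m₁, o₂.trans o₁⟩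
    · simp only [Function.update_self, v₂, r₂ d (by omega), v₁]
      exact Op.eval_of_safe o _ _ ho
    · intro r hrd
      simp only [Function.update_of_ne hrd.ne]
      rw [r₂ r (by omega), r₁ r hrd]
  | ld a iha =>
    obtain ⟨s₁, e₁, v₁, r₁, m₁, o₁⟩ := iha h d hd s hr hm
    refine ⟨_, .seq e₁ (.load s₁ d d), ?_, ?_, m₁, o₁⟩
    · simp [v₁, m₁, hm]
    · intro r hrd
      simp only [Function.update_of_ne hrd.ne]
      exact r₁ r hrd

end Exp

infixr:60 " ;; " => Program.seq

/-- `R[r] := e` -/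
def assign (r : ℕ) (e : Exp) : Program :=
  e.code 100 ;; .const 101 0 ;; .arith .sub r 100 101

/-- `M[a] := b` -/
def write (a b : Exp) : Program :=
  a.code 100 ;; b.code 101 ;; .store 100 101

def emit (e : Exp) : Program := e.code 100 ;; .out 100

def ite (e : Exp) (p q : Program) : Program := e.code 100 ;; .cond 100 p q

def while_ (e : Exp) (p : Program) : Program := e.code 100 ;; .loop 100 (p ;; e.code 100)

/-- Equality up to the scratch registers. -/
def Sim (s H : State) : Prop :=
  (∀ r < 100, s.reg r = H.reg r) ∧ s.mem = H.mem ∧ s.output = H.output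

/-- The program `p`, started in `H`, halts in a state and after a time that satisfy `Q`. States are
considered up to the scratch registers. -/
def Runs (w : ℕ) (p : Program) (H : State) (Q : State → ℕ → Prop) : Prop :=
  ∀ s, Sim s H → ∃ s' H' t, Exec w p s s' t ∧ Sim s' H' ∧ Q H' t

def State.set (H : State) (r x : ℕ) : State := { H with reg := Function.update H.reg r x }

def State.put (H : State) (a x : ℕ) : State := { H with mem := Function.update H.mem a x }

def State.print (H : State) (x : ℕ) : State := { H with output := H.output ++ [x] }

section
variable (H : State) (r x a : ℕ)
@[simp] theorem State.set_reg (r' : ℕ) : (H.set r x).reg r' = if r' = r then x else H.reg r' := by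
  simp [State.set, Function.update_apply]
@[simp] theorem State.set_mem : (H.set r x).mem = H.mem := rfl
@[simp] theorem State.set_output : (H.set r x).output = H.output := rfl
@[simp] theorem State.put_reg : (H.put a x).reg = H.reg := rfl
@[simp] theorem State.put_mem (a' : ℕ) :
    (H.put a x).mem a' = if a' = a then x else H.mem a' := by
  simp [State.put, Function.update_apply]
@[simp] theorem State.put_output : (H.put a x).output = H.output := rfl
@[simp] theorem State.print_reg : (H.print x).reg = H.reg := rfl
@[simp] theorem State.print_mem : (H.print x).mem = H.mem := rfl
@[simp] theorem State.print_output : (H.print x).output = H.output ++ [x] := rfl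
end

variable {w : ℕ} {p q : Program} {H : State} {Q Q' : State → ℕ → Prop} {e : Exp} {r : ℕ}

theorem Runs.mono (h : Runs w p H Q) (hQ : ∀ H' t, Q H' t → Q' H' t) : Runs w p H Q' := by
  intro s hs
  obtain ⟨s', H', t, h1, h2, h3⟩ := h s hs
  exact ⟨s', H', t, h1, h2, hQ _ _ h3⟩

/-- The time already spent is absorbed into the postcondition of what follows, so that a proof about
straight-line code runs forwards through the program. -/
theorem Runs.seq (h : Runs w p H fun H' t => Runs w q H' fun H'' t' => Q H'' (t + t')) :
    Runs w (p ;; q) H Q := by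
  intro s hs
  obtain ⟨s', H', t, h1, h2, h3⟩ := h s hs
  obtain ⟨s'', H'', t', h4, h5, h6⟩ := h3 s' h2
  exact ⟨s'', H'', t + t', .seq h1 h4, h5, h6⟩

theorem Runs.skip (h : Q H 1) : Runs w .skip H Q := fun s hs => ⟨s, H, 1, .skip s, hs, h⟩

theorem Runs.assign (he : e.Ok w H) (h : Q (H.set r (e.eval H)) (e.cost + 2)) :
    Runs w (assign r e) H Q := by
  intro s hs
  obtain ⟨s₁, e₁, v₁, r₁, m₁, o₁⟩ := e.exec_code he 100 le_rfl s hs.1 hs.2.1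
  refine ⟨_, _, _, .seq e₁ (.seq (.const s₁ 101 0) (.arith _ .sub r 100 101)), ⟨?_, ?_, ?_⟩, h⟩
  · intro r' hr'
    have h1 : r' ≠ 101 := by omega
    by_cases h2 : r' = r
    · simp [Op.eval, Function.update_apply, h2, v₁]
    · simp [h2, h1, r₁ r' hr', hs.1 r' hr']
  · exact m₁.trans hs.2.1
  · exact o₁.trans hs.2.2

theorem Runs.write {a : Exp} (ha : a.Ok w H) (he : e.Ok w H)
    (h : Q (H.put (a.eval H) (e.eval H)) (a.cost + (e.cost + 1))) : Runs w (write a e) H Q := by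
  intro s hs
  obtain ⟨s₁, e₁, v₁, r₁, m₁, o₁⟩ := a.exec_code ha 100 le_rfl s hs.1 hs.2.1
  obtain ⟨s₂, e₂, v₂, r₂, m₂, o₂⟩ := e.exec_code he 101 (by norm_num) s₁
    (fun r h => (r₁ r h).trans (hs.1 r h)) (m₁.trans hs.2.1)
  refine ⟨_, _, _, .seq e₁ (.seq e₂ (.store s₂ 100 101)), ⟨?_, ?_, ?_⟩, h⟩
  · intro r' hr'
    exact (r₂ r' (by omega)).trans ((r₁ r' hr').trans (hs.1 r' hr'))
  · simp only [v₂, r₂ 100 (by norm_num), v₁, m₂, m₁, hs.2.1, State.put]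
  · exact o₂.trans (o₁.trans hs.2.2)

theorem Runs.emit (he : e.Ok w H) (h : Q (H.print (e.eval H)) (e.cost + 1)) :
    Runs w (emit e) H Q := by
  intro s hs
  obtain ⟨s₁, e₁, v₁, r₁, m₁, o₁⟩ := e.exec_code he 100 le_rfl s hs.1 hs.2.1
  refine ⟨_, _, _, .seq e₁ (.out s₁ 100), ⟨?_, ?_, ?_⟩, h⟩
  · intro r' hr'
    exact (r₁ r' hr').trans (hs.1 r' hr')
  · exact m₁.trans hs.2.1
  · simp [v₁, o₁, hs.2.2]

theorem Runs.ite (he : e.Ok w H) (hp : e.eval H ≠ 0 → Runs w p H fun H' t => Q H' (e.cost + 1 + t))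
    (hq : e.eval H = 0 → Runs w q H fun H' t => Q H' (e.cost + 1 + t)) :
    Runs w (ite e p q) H Q := by
  intro s hs
  obtain ⟨s₁, e₁, v₁, r₁, m₁, o₁⟩ := e.exec_code he 100 le_rfl s hs.1 hs.2.1
  have hs₁ : Sim s₁ H :=
    ⟨fun r h => (r₁ r h).trans (hs.1 r h), m₁.trans hs.2.1, o₁.trans hs.2.2⟩
  by_cases h0 : e.eval H = 0
  · obtain ⟨s₂, H₂, t, h1, h2, h3⟩ := hq h0 s₁ hs₁
    refine ⟨s₂, H₂, _, .seq e₁ (.cond_false (v₁.trans h0) h1), h2, ?_⟩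
    rwa [Nat.add_comm t 1, ← Nat.add_assoc]
  · obtain ⟨s₂, H₂, t, h1, h2, h3⟩ := hp h0 s₁ hs₁
    refine ⟨s₂, H₂, _, .seq e₁ (.cond_true (by rwa [v₁]) h1), h2, ?_⟩
    rwa [Nat.add_comm t 1, ← Nat.add_assoc]

theorem Runs.ite_lt {a b : Exp} (he : (Exp.lt a b).Ok w H)
    (hp : a.eval H < b.eval H → Runs w p H fun H' t => Q H' (a.cost + b.cost + 2 + t))
    (hq : b.eval H ≤ a.eval H → Runs w q H fun H' t => Q H' (a.cost + b.cost + 2 + t)) :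
    Runs w (WordRAM.ite (.lt a b) p q) H Q := by
  refine Runs.ite he (fun h => hp ?_) (fun h => hq ?_)
  · by_contra hcon; exact h (if_neg hcon)
  · by_contra hcon; exact absurd (h.symm.trans (if_pos (not_le.1 hcon))) zero_ne_one

theorem Runs.ite_eq {a b : Exp} (he : (Exp.eq a b).Ok w H)
    (hp : a.eval H = b.eval H → Runs w p H fun H' t => Q H' (a.cost + b.cost + 2 + t))
    (hq : a.eval H ≠ b.eval H → Runs w q H fun H' t => Q H' (a.cost + b.cost + 2 + t)) :
    Runs w (WordRAM.ite (.eq a b) p q) H Q := by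
  refine Runs.ite he (fun h => hp ?_) (fun h => hq ?_)
  · by_contra hcon; exact h (if_neg hcon)
  · intro hcon; exact absurd (h.symm.trans (if_pos hcon)) zero_ne_one

/-- Loops: the invariant `I k H t` speaks of a variant `k`, the state `H` and the elapsed
time `t`. -/
theorem Runs.while_time (I : ℕ → State → ℕ → Prop) (hok : ∀ k H t, I k H t → e.Ok w H)
    (step : ∀ k H t, I k H t → e.eval H ≠ 0 →
      Runs w p H fun H' t' => ∃ k' < k, I k' H' (t + (t' + (e.cost + 1))))
    (k : ℕ) (h0 : I k H (e.cost + 1)) :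
    Runs w (while_ e p) H fun H' t => e.eval H' = 0 ∧ ∃ k, I k H' t := by
  -- The final failing test is prepaid by the initial time `e.cost + 1` of the invariant; this is
  -- the `+ 1` of the loop's time here. Each round charges its body, the new value of the condition
  -- and one test.
  have key : ∀ k H t, I k H t → ∀ s, Sim s H → s.reg 100 = e.eval H →
      ∃ s' H' t', Exec w (.loop 100 (p ;; e.code 100)) s s' (t' + 1) ∧ Sim s' H' ∧
        e.eval H' = 0 ∧ ∃ k, I k H' (t + t') := by
    intro k
    induction k using Nat.strong_induction_on with
    | _ k ih =>
      intro H t hI s hs hv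
      by_cases h0 : e.eval H = 0
      · exact ⟨s, H, 0, .loop_false (hv.trans h0), hs, h0, k, hI⟩
      · obtain ⟨s₁, H₁, t₁, x₁, i₁, k₁, hk₁, I₁⟩ := step k H t hI h0 s hs
        obtain ⟨s₂, e₂, v₂, r₂, m₂, o₂⟩ :=
          e.exec_code (hok _ _ _ I₁) 100 le_rfl s₁ i₁.1 i₁.2.1
        have hs₂ : Sim s₂ H₁ :=
          ⟨fun r h => (r₂ r h).trans (i₁.1 r h), m₂.trans i₁.2.1, o₂.trans i₁.2.2⟩
        obtain ⟨s₃, H₃, t₃, x₃, i₃, z₃, k₃, I₃⟩ := ih k₁ hk₁ H₁ _ I₁ s₂ hs₂ v₂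
        refine ⟨s₃, H₃, t₁ + e.cost + (t₃ + 1), .loop_true (by rwa [hv]) (.seq x₁ e₂) x₃, i₃, z₃,
          k₃, ?_⟩
        convert I₃ using 1
        omega
  intro s hs
  obtain ⟨s₁, e₁, v₁, r₁, m₁, o₁⟩ := e.exec_code (hok _ _ _ h0) 100 le_rfl s hs.1 hs.2.1
  have hs₁ : Sim s₁ H :=
    ⟨fun r h => (r₁ r h).trans (hs.1 r h), m₁.trans hs.2.1, o₁.trans hs.2.2⟩
  obtain ⟨s₂, H₂, t₂, x₂, i₂, z₂, k₂, I₂⟩ := key k H _ h0 s₁ hs₁ v₁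
  refine ⟨s₂, H₂, _, .seq e₁ x₂, i₂, z₂, k₂, ?_⟩
  convert I₂ using 1
  omega

/-- Loops whose body takes at most `c` steps. -/
theorem Runs.while_le (I : ℕ → State → Prop) (c : ℕ) (hok : ∀ k H, I k H → e.Ok w H)
    (step : ∀ k H, I k H → e.eval H ≠ 0 →
      Runs w p H fun H' t => t ≤ c ∧ ∃ k' < k, I k' H')
    (k : ℕ) (h0 : I k H) :
    Runs w (while_ e p) H fun H' t =>
      t ≤ k * (c + e.cost + 1) + e.cost + 1 ∧ e.eval H' = 0 ∧ ∃ k, I k H' := by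
  have := Runs.while_time (w := w) (p := p) (H := H) (e := e)
    -- Elapsed time plus the price of `k'` further rounds never grows.
    (fun k' H' t => I k' H' ∧ t + k' * (c + e.cost + 1) ≤ k * (c + e.cost + 1) + e.cost + 1)
    (fun k H t h => hok k H h.1)
    (fun k' H' t h hne => (step k' H' h.1 hne).mono fun H'' t' h' => by
      obtain ⟨ht, k'', hk, hI⟩ := h'
      refine ⟨k'', hk, hI, ?_⟩
      have : (k'' + 1) * (c + e.cost + 1) ≤ k' * (c + e.cost + 1) := Nat.mul_le_mul_right _ hk
      rw [Nat.add_mul] at this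
      have := h.2
      omega)
    k ⟨h0, by omega⟩
  refine this.mono fun H' t h => ?_
  obtain ⟨hz, k', hI, ht⟩ := h
  exact ⟨by omega, hz, k', hI⟩

theorem Runs.assign_seq (he : e.Ok w H)
    (h : Runs w q (H.set r (e.eval H)) fun H' t => Q H' (e.cost + 2 + t)) :
    Runs w (WordRAM.assign r e ;; q) H Q :=
  Runs.seq (Runs.assign he h)

/-- Registers below `K`, the memory and the output are unchanged. -/
def Keeps (K : ℕ) (H H' : State) : Prop :=
  (∀ r < K, H'.reg r = H.reg r) ∧ H'.mem = H.mem ∧ H'.output = H.output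

theorem Keeps.refl (K : ℕ) (H : State) : Keeps K H H := ⟨fun _ _ => rfl, rfl, rfl⟩

theorem Keeps.trans {K : ℕ} {H H' H'' : State} (h : Keeps K H H') (h' : Keeps K H' H'') :
    Keeps K H H'' :=
  ⟨fun r hr => (h'.1 r hr).trans (h.1 r hr), h'.2.1.trans h.2.1, h'.2.2.trans h.2.2⟩

theorem Keeps.le {K L : ℕ} {H H' : State} (h : Keeps K H H') (hL : L ≤ K) : Keeps L H H' :=
  ⟨fun r hr => h.1 r (hr.trans_le hL), h.2⟩

theorem Keeps.set {K x : ℕ} {H H' : State} (h : Keeps K H H') (hr : K ≤ r) :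
    Keeps K H (H'.set r x) :=
  ⟨fun r' hr' => by simp [h.1 r' hr', (hr'.trans_le hr).ne], h.2⟩

end WordRAM

/-! ## Occurrences and periods -/

namespace Occ

variable {α : Type}

/-- The word `c` of length `m` occurs in the text `T` at the position `x`. -/
def At (T c : ℕ → α) (m x : ℕ) : Prop := ∀ k < m, T (x + k) = c k

variable {T c : ℕ → α} {m : ℕ}

/-- Occurrences of a word of length `m` within a distance of `m` form an arithmetic progression. -/
theorem At.sub_gap {x₀ x₁ x : ℕ} (h₀ : At T c m x₀) (h₁ : At T c m x₁) (h : At T c m x)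
    (h01 : x₀ < x₁) (h1x : x₁ < x) (hx : x ≤ x₀ + m)
    (gap : ∀ y, x₀ < y → y < x₁ → ¬ At T c m y) : At T c m (x - (x₁ - x₀)) := by
  classical
  obtain ⟨d, rfl⟩ : ∃ d, x₁ = x₀ + d := ⟨x₁ - x₀, by omega⟩
  -- The last occurrence `y` before `x`, searched downwards from `x - 1`. It will turn out to lie
  -- exactly `d` before `x`.
  obtain ⟨y, hyP, hymax⟩ : ∃ y, (x₀ + d ≤ y ∧ y < x ∧ At T c m y) ∧
      ∀ z, y < z → z < x → ¬ At T c m z := by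
    have hex : ∃ k, x₀ + d + k < x ∧ At T c m (x - 1 - k) :=
      ⟨x - 1 - (x₀ + d), by omega, by
        rwa [show x - 1 - (x - 1 - (x₀ + d)) = x₀ + d by omega]⟩
    obtain ⟨h1, h2⟩ := Nat.find_spec hex
    refine ⟨_, ⟨?_, ?_, h2⟩, ?_⟩
    · omega
    · omega
    · intro z hz hzx hA
      refine Nat.find_min hex (m := x - 1 - z) (by omega) ⟨by omega, ?_⟩
      rwa [show x - 1 - (x - 1 - z) = z by omega]
  obtain ⟨hy1, hyx, hyA⟩ := hyP
  obtain ⟨q, rfl⟩ : ∃ q, x = y + q := ⟨x - y, by omega⟩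
  -- Overlapping copies make both `d` and the last distance `q` periods of `c`. The hypothesis `hx`
  -- gives `d + q ≤ m`, which is what makes these periods interact.
  have hd : ∀ i, i + d < m → c (i + d) = c i := fun i hi => by
    rw [← h₀ (i + d) hi, ← h₁ i (by omega)]; congr 1; omega
  have hq : ∀ i, i + q < m → c (i + q) = c i := fun i hi => by
    rw [← hyA (i + q) hi, ← h i (by omega)]; congr 1; omega
  rw [Nat.add_sub_cancel_left]
  rcases lt_trichotomy q d with hlt | rfl | hlt
  -- If `q < d`, the word also occurs at `x₀ + q`, inside the first gap: its front is read off the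
  -- copy at `x₀`, its end off the copy at `x₀ + d`.
  · refine absurd ?_ (gap (x₀ + q) (by omega) (by omega))
    intro i hi
    by_cases hiq : i + q < m
    · rw [← hq i hiq, ← h₀ (i + q) hiq]; congr 1; omega
    · have e1 : T (x₀ + q + i) = c (i - d + q) := by
        rw [← h₁ (i - d + q) (by omega)]; congr 1; omega
      rw [e1, hq _ (by omega), ← hd (i - d) (by omega)]; congr 1; omega
  · rwa [Nat.add_sub_cancel]
  -- If `q > d`, the word also occurs `d` before `x`, hence strictly between `y` and `x`.
  · refine absurd ?_ (hymax (y + q - d) (by omega) (by omega))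
    intro i hi
    by_cases hid : d ≤ i
    · obtain ⟨i, rfl⟩ := Nat.exists_eq_add_of_le hid
      rw [show d + i = i + d by omega, hd i (by omega), ← h i (by omega)]; congr 1; omega
    · have e1 : T (y + q - d + i) = c (q - d + i) := by
        rw [← hyA (q - d + i) (by omega)]; congr 1; omega
      rw [e1, ← hd _ (by omega), ← hq i (by omega)]; congr 1; omega

variable {cu cv : ℕ → α} {lu lv : ℕ}

/-- Along a progression of occurrences of `u`, let `v` follow the occurrence number `t`, but not the
one before it. Then `v` does not occur earlier than that after the occurrence number `1`, unless the
progression ends with the number `t`. -/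
theorem not_at_after {x₀ d k t y : ℕ} (hd : d ≤ lu)
    (hA : ∀ s ≤ k, At T cu lu (x₀ + s * d)) (htk : t < k)
    (hB : At T cv lv (x₀ + t * d + lu)) (hB' : ¬ At T cv lv (x₀ + (t - 1) * d + lu))
    (hy : x₀ + d ≤ y) (hyt : y < x₀ + t * d) : ¬ At T cv lv (y + lu) := by
  intro hyB
  obtain ⟨t, rfl⟩ : ∃ t', t = t' + 1 := by
    refine ⟨t - 1, ?_⟩
    rcases t with _ | t
    · omega
    · rfl
  rw [Nat.add_sub_cancel] at hB'
  obtain ⟨k, rfl⟩ : ∃ k', k = t + 2 + k' := ⟨k - (t + 2), by omega⟩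
  have e1 : (t + 1) * d = t * d + d := by ring
  -- Consecutive copies of `u` overlap or touch because `d ≤ lu`, so they cover this stretch.
  -- Comparing the copy `s` with the copy `s + 1` gives the period; the last comparison needs a copy
  -- after the one numbered `t + 1`, hence the strict `htk`.
  have run : ∀ z, x₀ ≤ z → z < x₀ + (t + 1) * d + lu → T z = T (z + d) := by
    intro z hz hz'
    have key : ∃ s ≤ t + 1, x₀ + s * d ≤ z ∧ z < x₀ + s * d + lu := by
      by_cases hbig : x₀ + (t + 1) * d ≤ z
      · exact ⟨t + 1, le_rfl, hbig, hz'⟩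
      · have hdpos : 0 < d := by
          rcases Nat.eq_zero_or_pos d with rfl | h
          · simp at hbig; omega
          · exact h
        refine ⟨(z - x₀) / d, ?_, ?_, ?_⟩
        · exact Nat.div_le_of_le_mul (by rw [mul_comm]; omega)
        · have := Nat.div_mul_le_self (z - x₀) d; omega
        · have := Nat.div_add_mod' (z - x₀) d
          have := Nat.mod_lt (z - x₀) hdpos
          omega
    obtain ⟨s, hs, h1, h2⟩ := key
    have a1 := hA s (by omega) (z - (x₀ + s * d)) (by omega)
    have a2 := hA (s + 1) (by omega) (z - (x₀ + s * d)) (by omega)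
    rw [← a1] at a2
    rw [show x₀ + s * d + (z - (x₀ + s * d)) = z by omega,
      show x₀ + (s + 1) * d + (z - (x₀ + s * d)) = z + d by rw [Nat.add_mul]; omega] at a2
    exact a2.symm
  -- The period continues over `v`. The first `d` letters still belong to the run. Later, the
  -- letters `i - d` and `i` of `v` are compared in the copy after `y`, which lies further left, in
  -- the run or at an index already treated.
  have per : ∀ i < lv, T (x₀ + (t * d) + lu + i) = T (x₀ + t * d + lu + i + d) := by
    intro i
    induction i using Nat.strong_induction_on with
    | _ i ih =>
      intro hi
      by_cases hid : i < d
      · exact run _ (by omega) (by omega)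
      · have b1 := hB i hi
        have b2 := hB (i - d) (by omega)
        have b3 := hyB i hi
        have b4 := hyB (i - d) (by omega)
        have key : T (y + lu + (i - d)) = T (y + lu + (i - d) + d) := by
          by_cases hlt : y + lu + (i - d) < x₀ + (t + 1) * d + lu
          · exact run _ (by omega) hlt
          · have := ih (y + lu + (i - d) - (x₀ + t * d + lu)) (by omega) (by omega)
            rwa [show x₀ + t * d + lu + (y + lu + (i - d) - (x₀ + t * d + lu))
              = y + lu + (i - d) by omega] at this
        rw [show y + lu + (i - d) + d = y + lu + i by omega, b4, b3, ← b1, ← b2] at key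
        rw [show x₀ + t * d + lu + i = x₀ + (t + 1) * d + lu + (i - d) by omega, key]
        congr 1; omega
  -- By periodicity `v` can be moved one period to the left, where it was assumed not to occur.
  apply hB'
  intro i hi
  rw [per i hi, ← hB i hi]; congr 1; omega

/-- The same when `v` precedes `u`; the end of the progression plays no role. -/
theorem not_at_before {x₀ d k t y : ℕ} (hd : d ≤ lu)
    (hA : ∀ s ≤ k, At T cu lu (x₀ + s * d + lv)) (htk : t ≤ k)
    (hB : At T cv lv (x₀ + t * d)) (hB' : ¬ At T cv lv (x₀ + (t - 1) * d))
    (hy : x₀ + d ≤ y) (hyt : y ≤ x₀ + (t - 1) * d) : ¬ At T cv lv y := by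
  intro hyB
  have hdpos : 0 < d := by
    rcases Nat.eq_zero_or_pos d with rfl | h
    · simp at hB hB'; exact absurd hB hB'
    · exact h
  obtain ⟨t, rfl⟩ : ∃ t', t = t' + 2 := by
    rcases t with _ | _ | t
    · simp at hyt; omega
    · simp at hyt; omega
    · exact ⟨t, rfl⟩
  simp only [Nat.add_succ_sub_one] at hB' hyt
  have e1 : (t + 1) * d = t * d + d := by ring
  have e2 : (t + 2) * d = t * d + d + d := by ring
  have run : ∀ z, x₀ + lv ≤ z → z < x₀ + (t + 1) * d + lu + lv → T z = T (z + d) := by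
    intro z hz hz'
    have key : ∃ s ≤ t + 1, x₀ + lv + s * d ≤ z ∧ z < x₀ + lv + s * d + lu := by
      by_cases hbig : x₀ + lv + (t + 1) * d ≤ z
      · exact ⟨t + 1, le_rfl, hbig, by omega⟩
      · refine ⟨(z - (x₀ + lv)) / d, ?_, ?_, ?_⟩
        · exact Nat.div_le_of_le_mul (by rw [mul_comm]; omega)
        · have := Nat.div_mul_le_self (z - (x₀ + lv)) d; omega
        · have := Nat.div_add_mod' (z - (x₀ + lv)) d
          have := Nat.mod_lt (z - (x₀ + lv)) hdpos
          omega
    obtain ⟨s, hs, h1, h2⟩ := key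
    have a1 := hA s (by omega) (z - (x₀ + lv + s * d)) (by omega)
    have a2 := hA (s + 1) (by omega) (z - (x₀ + lv + s * d)) (by omega)
    rw [← a1] at a2
    rw [show x₀ + s * d + lv + (z - (x₀ + lv + s * d)) = z by omega,
      show x₀ + (s + 1) * d + lv + (z - (x₀ + lv + s * d)) = z + d by
        rw [Nat.add_mul]; omega] at a2
    exact a2.symm
  -- Mirror image of the previous proof: the period spreads to the left, by induction on the
  -- distance `j` to the right end. A letter before the run is transferred from the copy of `v` at
  -- `y` to the one at `x₀ + (t + 2) * d`, further right.
  have per : ∀ j z, x₀ + (t + 1) * d + lv ≤ z + j → y ≤ z → z < x₀ + (t + 1) * d + lv →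
      T z = T (z + d) := by
    intro j
    induction j using Nat.strong_induction_on with
    | _ j ih =>
      intro z hzj hyz hz
      by_cases hrun : x₀ + lv ≤ z
      · exact run z hrun (by omega)
      · have b1 := hB (z - y) (by omega)
        have b2 := hB (z - y + d) (by omega)
        have b3 := hyB (z - y) (by omega)
        have b4 := hyB (z - y + d) (by omega)
        rw [show y + (z - y) = z by omega] at b3
        rw [show y + (z - y + d) = z + d by omega] at b4
        rw [b3, b4, ← b1, ← b2, ← Nat.add_assoc]
        by_cases hlt : x₀ + (t + 2) * d + (z - y) < x₀ + (t + 1) * d + lv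
        · exact ih (j - 1) (by omega) _ (by omega) (by omega) hlt
        · exact run _ (by omega) (by omega)
  apply hB'
  intro i hi
  rw [← hB i hi, per (x₀ + (t + 1) * d + lv) (x₀ + (t + 1) * d + i) (by omega) (by omega) (by omega)]
  congr 1; omega

end Occ

/-! ## First occurrences and progressions -/

open Classical in
/-- The least `y ≥ x` with `P y` if that is at most `inf`, and `inf` otherwise. -/
noncomputable def nxt (P : ℕ → Prop) (inf x : ℕ) : ℕ :=
  Nat.find (p := fun y => (x ≤ y ∧ P y) ∨ y = inf) ⟨inf, Or.inr rfl⟩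

section nxt
variable {P : ℕ → Prop} {inf x y r : ℕ}

theorem nxt_le : nxt P inf x ≤ inf := by
  classical exact Nat.find_min' _ (Or.inr rfl)

theorem nxt_le_of (hy : x ≤ y) (h : P y) : nxt P inf x ≤ y := by
  classical exact Nat.find_min' _ (Or.inl ⟨hy, h⟩)

theorem nxt_spec (h : nxt P inf x < inf) : x ≤ nxt P inf x ∧ P (nxt P inf x) := by
  classical
  rcases Nat.find_spec (p := fun y => (x ≤ y ∧ P y) ∨ y = inf) ⟨inf, Or.inr rfl⟩ with h' | h'
  · exact h'
  · exact absurd h' h.ne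

theorem nxt_eq_of (h1 : r ≤ inf) (h2 : r < inf → x ≤ r ∧ P r) (h3 : ∀ y, x ≤ y → P y → r ≤ y) :
    nxt P inf x = r := by
  apply le_antisymm
  · rcases h1.lt_or_eq with h | h
    · exact nxt_le_of (h2 h).1 (h2 h).2
    · exact h ▸ nxt_le
  · rcases (nxt_le (P := P) (inf := inf) (x := x)).lt_or_eq with h | h
    · exact h3 _ (nxt_spec h).1 (nxt_spec h).2
    · rwa [h]

theorem nxt_eq_self_iff (hx : x < inf) : nxt P inf x = x ↔ P x := by
  constructor
  · intro h
    have := (nxt_spec (P := P) (inf := inf) (x := x) (by omega)).2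
    rwa [h] at this
  · intro h
    exact nxt_eq_of hx.le (fun _ => ⟨le_rfl, h⟩) fun _ h _ => h

end nxt

/-- A window in which `P` holds along an arithmetic progression. -/
def Prog (P : ℕ → Prop) (lo hi : ℕ) : Prop :=
  ∀ x₀ x₁ x, P x₀ → P x₁ → P x → lo ≤ x₀ → x₀ < x₁ → x₁ < x → x ≤ hi →
    (∀ y, x₀ < y → y < x₁ → ¬ P y) → P (x - (x₁ - x₀))

section Prog
variable {P : ℕ → Prop} {lo hi x₀ d : ℕ}

/-- An element beyond `x₀ + d` stays in `P` when `d` is subtracted; repeating this ends at `x₀ + d`,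
since the gap before it contains no element. -/
theorem Prog.exists_eq (h : Prog P lo hi) (hlo : lo ≤ x₀) (h₀ : P x₀) (h₁ : P (x₀ + d))
    (gap : ∀ y, x₀ < y → y < x₀ + d → ¬ P y) {x : ℕ} (hx : P x) (hx₀ : x₀ ≤ x) (hxhi : x ≤ hi)
    (hd : 0 < d) : ∃ s, x = x₀ + s * d := by
  induction x using Nat.strong_induction_on with
  | _ x ih =>
    rcases hx₀.eq_or_lt with rfl | hlt
    · exact ⟨0, by simp⟩
    rcases lt_trichotomy x (x₀ + d) with h1 | h1 | h1
    · exact absurd hx (gap x hlt h1)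
    · exact ⟨1, by omega⟩
    · have := h x₀ (x₀ + d) x h₀ h₁ hx hlo (by omega) h1 hxhi gap
      rw [Nat.add_sub_cancel_left] at this
      obtain ⟨s, hs⟩ := ih (x - d) (by omega) this (by omega) (by omega)
      exact ⟨s + 1, by rw [Nat.add_mul]; omega⟩

/-- Descent by `d` from the term `t`. `Prog` only moves elements beyond `x₀ + d`, so the term `0` is
taken from `h₀`. -/
theorem Prog.down (h : Prog P lo hi) (hlo : lo ≤ x₀) (h₀ : P x₀) (h₁ : P (x₀ + d))
    (gap : ∀ y, x₀ < y → y < x₀ + d → ¬ P y) (hd : 0 < d) {s t : ℕ} (ht : P (x₀ + t * d))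
    (hhi : x₀ + t * d ≤ hi) (hst : s ≤ t) : P (x₀ + s * d) := by
  induction t with
  | zero => rwa [Nat.le_zero.1 hst]
  | succ t ih =>
    rcases hst.eq_or_lt with rfl | hlt
    · exact ht
    have e : (t + 1) * d = t * d + d := by ring
    apply ih _ (by omega) (by omega)
    rcases Nat.eq_zero_or_pos t with rfl | htpos
    · simpa using h₀
    · have h2 : d ≤ t * d := Nat.le_mul_of_pos_left d htpos
      have := h x₀ (x₀ + d) _ h₀ h₁ ht hlo (by omega) (by omega) hhi gap
      rwa [show x₀ + (t + 1) * d - (x₀ + d - x₀) = x₀ + t * d by omega] at this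

end Prog

/-- `R` is the first element of `[lo, hi]` with `P`, or `inf` if there is none. -/
def FirstIn (P : ℕ → Prop) (lo hi inf R : ℕ) : Prop :=
  (R = inf ∧ ∀ x, lo ≤ x → x ≤ hi → ¬ P x) ∨
    (lo ≤ R ∧ R ≤ hi ∧ P R ∧ ∀ x, lo ≤ x → x < R → ¬ P x)

/-- The three candidates for the first common element of a progression `A` and a set `B`. -/
theorem first_common {A B : ℕ → Prop} {lo hi x₀ d k z y x : ℕ} (hA : Prog A lo hi)
    (hlo : lo ≤ x₀) (h₀ : A x₀) (h₁ : A (x₀ + d)) (hd : 0 < d)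
    (gap₀ : ∀ y, lo ≤ y → y < x₀ → ¬ A y)
    (gap : ∀ y, x₀ < y → y < x₀ + d → ¬ A y)
    (hk : A (x₀ + k * d)) (hkhi : x₀ + k * d ≤ hi)
    (hk' : x₀ + (k + 1) * d ≤ hi → ¬ A (x₀ + (k + 1) * d))
    (key : ∀ t y, t < k → (∀ s ≤ k, A (x₀ + s * d)) → B (x₀ + t * d) → ¬ B (x₀ + (t - 1) * d) →
      x₀ + d ≤ y → y ≤ x₀ + (t - 1) * d → ¬ B y)
    (hxA : A x) (hxB : B x) (hxlo : lo ≤ x) (hxhi : x ≤ hi)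
    (hmin : ∀ y, lo ≤ y → y < x → A y → ¬ B y) (hx₀ : x ≠ x₀)
    (hz : ∀ y, x₀ + d ≤ y → B y → z ≤ y ∧ x₀ + d ≤ z ∧ B z)
    (hy : ∀ v, z ≤ v → A v → y ≤ v ∧ z ≤ y ∧ A y) :
    x = y ∨ x = x₀ + k * d := by
  have hx0 : x₀ < x := by
    by_contra hcon
    exact gap₀ x hxlo (by omega) hxA
  obtain ⟨t, rfl⟩ := hA.exists_eq hlo h₀ h₁ gap hxA hx0.le hxhi hd
  have htpos : 0 < t := by
    rcases Nat.eq_zero_or_pos t with rfl | h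
    · simp at hx₀
    · exact h
  have htk : t ≤ k := by
    by_contra hcon
    have h2 : (k + 1) * d ≤ t * d := Nat.mul_le_mul_right d (by omega)
    exact hk' (by omega) (hA.down hlo h₀ h₁ gap hd hxA hxhi (by omega))
  rcases htk.eq_or_lt with rfl | htk
  · exact Or.inr rfl
  left
  have hall : ∀ s ≤ k, A (x₀ + s * d) := fun s hs => hA.down hlo h₀ h₁ gap hd hk hkhi hs
  have e : (t - 1) * d + d = t * d := by
    rw [← Nat.succ_mul]; congr 1; omega
  have h1 : d ≤ t * d := Nat.le_mul_of_pos_left d htpos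
  obtain ⟨z1, z2, z3⟩ := hz (x₀ + t * d) (by omega) hxB
  have hBn : ¬ B (x₀ + (t - 1) * d) := hmin _ (by omega) (by omega) (hall _ (by omega))
  -- By minimality of the common element, `B` fails at the term `t - 1`. Hence `key` excludes
  -- elements of `B` from `x₀ + d` to that term, and `z` lies beyond it. The next element of `A`
  -- from `z` on is then the term `t` itself.
  have hzt : x₀ + (t - 1) * d < z := by
    by_contra hcon
    exact key t z htk hall hxB hBn z2 (by omega) z3
  obtain ⟨y1, y2, y3⟩ := hy _ z1 hxA
  obtain ⟨s, rfl⟩ := hA.exists_eq hlo h₀ h₁ gap y3 (by omega) (by omega) hd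
  have hs1 : t - 1 < s := by
    by_contra hcon
    have := Nat.mul_le_mul_right d (show s ≤ t - 1 by omega)
    omega
  have := Nat.mul_le_mul_right d (show t ≤ s by omega)
  omega

/-- The set `C` is the arithmetic progression from `f` to `e - 1` with difference `d`
(empty if `e = 0`). -/
def IsProg (f d e : ℕ) (C : ℕ → Prop) : Prop :=
  (∀ x, C x ↔ f ≤ x ∧ x < e ∧ (x - f) % d = 0) ∧ (0 < e → C (e - 1))

/-- The distance `x - f` is rounded up to a multiple of `d`; the result stays below `e` because `e -
1` is itself a term. Truncated subtraction covers `x < f`. For `d = 0` the set is at most `{f}`, and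
division by zero gives the right value `f`. -/
theorem IsProg.next {f d e x : ℕ} {C : ℕ → Prop} (h : IsProg f d e C) (hx : x < e) :
    C (f + (x - f + d - 1) / d * d) ∧ x ≤ f + (x - f + d - 1) / d * d ∧
      ∀ y, x ≤ y → C y → f + (x - f + d - 1) / d * d ≤ y := by
  obtain ⟨h1, h2⟩ := h
  have hlast := (h1 _).1 (h2 (by omega))
  rcases Nat.eq_zero_or_pos d with rfl | hd
  · simp only [Nat.mod_zero] at h1 hlast
    simp only [Nat.div_zero, Nat.zero_mul, Nat.add_zero]
    refine ⟨(h1 f).2 (by omega), by omega, fun y hy hC => ?_⟩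
    have := (h1 y).1 hC
    omega
  · set q := (x - f + d - 1) / d with hq
    have ub : q * d ≤ x - f + d - 1 := Nat.div_mul_le_self _ _
    have lb : x - f ≤ q * d := by
      have := Nat.lt_div_mul_add hd (a := x - f + d - 1)
      rw [← hq] at this
      omega
    have least : ∀ y, x ≤ y → f ≤ y → (y - f) % d = 0 → f + q * d ≤ y := by
      intro y hy hfy hm
      obtain ⟨a, ha⟩ := Nat.dvd_of_mod_eq_zero hm
      rw [mul_comm] at ha
      have : q ≤ a := by
        by_contra hcon
        have := Nat.mul_le_mul_right d (show a + 1 ≤ q by omega)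
        rw [Nat.add_mul] at this
        omega
      have := Nat.mul_le_mul_right d this
      omega
    refine ⟨(h1 _).2 ⟨by omega, ?_, by simp⟩, by omega, fun y hy hC => ?_⟩
    · have := least (e - 1) (by omega) hlast.1 hlast.2.2
      omega
    · have := (h1 y).1 hC
      exact least y hy this.1 this.2.2

theorem IsProg.not_of_le {f d e x : ℕ} {C : ℕ → Prop} (h : IsProg f d e C) (hx : e ≤ x) :
    ¬ C x := fun hC => by
  have := ((h.1 x).1 hC).2.1
  omega

/-- A straight line program with words as letters, all of whose variables are bounded in
length by the last one. The field `l` holds the letter if `kind` is `0`. -/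
structure Gram where
  n : ℕ
  n_pos : 0 < n
  kind : ℕ → ℕ
  l : ℕ → ℕ
  r : ℕ → ℕ
  val : ℕ → List ℕ
  pair : ∀ j < n, kind j ≠ 0 → l j < j ∧ r j < j ∧ val j = val (l j) ++ val (r j)
  leaf : ∀ j < n, kind j = 0 → val j = [l j]
  len_le : ∀ j < n, (val j).length ≤ (val (n - 1)).length

/-! ### Occurrences in the variables of a grammar -/

namespace Gram
variable (g : Gram)

def len (j : ℕ) : ℕ := (g.val j).length
def N : ℕ := g.len (g.n - 1)
-- Occurrences of nonempty patterns start below this number, which can therefore stand for absence.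
def inf : ℕ := g.N + 1

theorem len_leaf {j : ℕ} (hj : j < g.n) (h : g.kind j = 0) : g.len j = 1 := by
  simp [len, g.leaf j hj h]

theorem len_pair {j : ℕ} (hj : j < g.n) (h : g.kind j ≠ 0) :
    g.len j = g.len (g.l j) + g.len (g.r j) := by
  simp [len, (g.pair j hj h).2.2]

theorem len_pos {j : ℕ} (hj : j < g.n) : 0 < g.len j := by
  induction j using Nat.strong_induction_on with
  | _ j ih =>
    by_cases h : g.kind j = 0
    · simp [g.len_leaf hj h]
    · have h1 := g.pair j hj h
      have := ih (g.l j) h1.1 (by omega)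
      rw [g.len_pair hj h]
      omega

theorem len_le_N {j : ℕ} (hj : j < g.n) : g.len j ≤ g.N := g.len_le j hj

/-- The word `pat` occurs in the string of the variable `j` at the position `x`. -/
def occ (pat : List ℕ) (j x : ℕ) : Prop :=
  Occ.At (fun y => (g.val j)[y]?) (fun k => pat[k]?) pat.length x

variable {g} {pat : List ℕ} {j x : ℕ}

/-- Beyond the end of the string `none` is read, so agreement with the last letter of the pattern
already forces the occurrence to fit. -/
theorem occ.le (h : g.occ pat j x) (hp : pat ≠ []) : x + pat.length ≤ g.len j := by
  have hpos := List.length_pos_iff.2 hp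
  have := h (pat.length - 1) (by omega)
  simp only at this
  rw [List.getElem?_eq_getElem (l := pat) (by omega)] at this
  have := (List.getElem?_eq_some_iff.1 this).1
  simp only [len]
  omega

theorem occ.lt_inf (h : g.occ pat j x) (hp : pat ≠ []) (hj : j < g.n) : x < g.inf := by
  have := h.le hp
  have := g.len_le_N hj
  simp only [inf]
  omega

theorem occ_left (hj : j < g.n) (hk : g.kind j ≠ 0) (hx : x + pat.length ≤ g.len (g.l j)) :
    g.occ pat j x ↔ g.occ pat (g.l j) x := by
  refine forall₂_congr fun k hkm => ?_
  simp only [(g.pair j hj hk).2.2]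
  rw [List.getElem?_append_left (by simp only [len] at hx; omega)]

theorem occ_right (hj : j < g.n) (hk : g.kind j ≠ 0) :
    g.occ pat j (g.len (g.l j) + x) ↔ g.occ pat (g.r j) x := by
  refine forall₂_congr fun k hkm => ?_
  simp only [(g.pair j hj hk).2.2, len]
  rw [List.getElem?_append_right (by omega)]
  rw [show (g.val (g.l j)).length + x + k - (g.val (g.l j)).length = x + k by omega]

/-- Occurrences that cross the cut of a pair. -/
def cross (g : Gram) (pat : List ℕ) (j x : ℕ) : Prop :=
  x < g.len (g.l j) ∧ g.len (g.l j) < x + pat.length ∧ g.occ pat j x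

theorem occ_cases (hj : j < g.n) (hk : g.kind j ≠ 0) (h : g.occ pat j x) :
    g.occ pat (g.l j) x ∨ g.cross pat j x ∨
      ∃ y, x = g.len (g.l j) + y ∧ g.occ pat (g.r j) y := by
  by_cases h1 : x + pat.length ≤ g.len (g.l j)
  · exact Or.inl ((occ_left hj hk h1).1 h)
  · by_cases h2 : x < g.len (g.l j)
    · exact Or.inr (Or.inl ⟨h2, by omega, h⟩)
    · refine Or.inr (Or.inr ⟨x - g.len (g.l j), by omega, ?_⟩)
      rw [← occ_right hj hk]
      rwa [show g.len (g.l j) + (x - g.len (g.l j)) = x by omega]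

theorem occ_of_left (hp : pat ≠ []) (hj : j < g.n) (hk : g.kind j ≠ 0)
    (h : g.occ pat (g.l j) x) : g.occ pat j x :=
  (occ_left hj hk (h.le hp)).2 h

/-- The next occurrence of `pat` in the string of `j`, from `x` on. -/
noncomputable def next (g : Gram) (pat : List ℕ) (j x : ℕ) : ℕ := nxt (g.occ pat j) g.inf x

theorem next_le : g.next pat j x ≤ g.inf := nxt_le

/-- One step of the descent for `next`, to the left. -/
theorem next_left (hp : pat ≠ []) (hj : j < g.n) (hk : g.kind j ≠ 0) {f d e : ℕ}
    (he : IsProg f d e (g.cross pat j)) (hx : x < g.len (g.l j)) (s b : ℕ) (hb : b ≤ g.inf) :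
    min b (s + g.next pat j x) =
      min (min (if x < e then min b (s + (f + (x - f + d - 1) / d * d)) else b)
        (s + g.len (g.l j) + g.next pat (g.r j) 0)) (s + g.next pat (g.l j) x) := by
  have hl := (g.pair j hj hk).1
  have hr := (g.pair j hj hk).2.1
  have a1 : g.next pat j x ≤ g.inf := nxt_le
  have a2 : g.next pat (g.l j) x ≤ g.inf := nxt_le
  have a3 : g.next pat (g.r j) 0 ≤ g.inf := nxt_le
  have a4 : g.next pat (g.l j) x < g.inf → g.next pat j x ≤ g.next pat (g.l j) x := fun h =>
    nxt_le_of (nxt_spec h).1 (occ_of_left hp hj hk (nxt_spec h).2)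
  have a5 : g.next pat (g.r j) 0 < g.inf →
      g.next pat j x ≤ g.len (g.l j) + g.next pat (g.r j) 0 := fun h =>
    nxt_le_of (by omega) ((occ_right hj hk).2 (nxt_spec h).2)
  have a6 : x < e → g.next pat j x ≤ f + (x - f + d - 1) / d * d := fun h =>
    nxt_le_of (he.next h).2.1 (he.next h).1.2.2
  have a7 : g.next pat j x < g.inf → g.next pat (g.l j) x ≤ g.next pat j x ∨
      (x < e ∧ f + (x - f + d - 1) / d * d ≤ g.next pat j x) ∨
      g.len (g.l j) + g.next pat (g.r j) 0 ≤ g.next pat j x := by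
    intro h
    have hs := nxt_spec h
    rcases occ_cases hj hk hs.2 with h1 | h1 | ⟨y, h1, h2⟩
    · exact Or.inl (nxt_le_of hs.1 h1)
    · right; left
      have hxe : x < e := by
        by_contra hcon
        exact he.not_of_le (by omega) h1
      exact ⟨hxe, (he.next hxe).2.2 _ hs.1 h1⟩
    · right; right
      have : g.next pat (g.r j) 0 ≤ y := nxt_le_of (Nat.zero_le _) h2
      simp only [next] at *
      omega
  -- The rest is linear arithmetic: absent occurrences have the value `inf`, and `s + inf` cannot
  -- lower `b ≤ inf`.
  generalize f + (x - f + d - 1) / d * d = c at *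
  split_ifs with hxe <;> omega

/-- One step of the descent for `next`, to the right. -/
theorem next_right (hj : j < g.n) (hk : g.kind j ≠ 0) {f d e : ℕ}
    (he : IsProg f d e (g.cross pat j)) (hx : g.len (g.l j) ≤ x) (hp : pat ≠ []) (s b : ℕ)
    (hb : b ≤ g.inf) : ¬ x < e ∧
    min b (s + g.next pat j x) =
      min b (s + g.len (g.l j) + g.next pat (g.r j) (x - g.len (g.l j))) := by
  constructor
  -- The next crossing occurrence would start at or after `x`, hence not before the cut.
  · intro hlt
    have h1 := (he.next hlt).2.1
    have h2 := (he.next hlt).1.1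
    omega
  have a1 : g.next pat j x ≤ g.inf := nxt_le
  have a3 : g.next pat (g.r j) (x - g.len (g.l j)) ≤ g.inf := nxt_le
  have a5 : g.next pat (g.r j) (x - g.len (g.l j)) < g.inf →
      g.next pat j x ≤ g.len (g.l j) + g.next pat (g.r j) (x - g.len (g.l j)) := fun h =>
    nxt_le_of (by have := (nxt_spec h).1; simp only [next] at *; omega)
      ((occ_right hj hk).2 (nxt_spec h).2)
  have a7 : g.next pat j x < g.inf →
      g.len (g.l j) + g.next pat (g.r j) (x - g.len (g.l j)) ≤ g.next pat j x := by
    intro h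
    have hs := nxt_spec h
    rcases occ_cases hj hk hs.2 with h1 | h1 | ⟨y, h1, h2⟩
    · have := h1.le hp
      have := List.length_pos_iff.2 hp
      omega
    · have := h1.1
      omega
    · have : g.next pat (g.r j) (x - g.len (g.l j)) ≤ y := nxt_le_of (by omega) h2
      simp only [next] at *
      omega
  omega

/-- A leaf is one letter long, so nothing occurs in it from a positive position on. -/
theorem next_leaf (hj : j < g.n) (hk : g.kind j = 0) (hp : pat ≠ []) (s b : ℕ) (hb : b ≤ g.inf) :
    min b (s + g.next pat j x) = if x = 0 then min b (s + g.next pat j 0) else b := by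
  split_ifs with h
  · rw [h]
  · have : g.next pat j x = g.inf := by
      refine nxt_eq_of le_rfl (by omega) fun y hy ho => ?_
      have := ho.le hp
      have := List.length_pos_iff.2 hp
      have := g.len_leaf hj hk
      omega
    omega

end Gram

/-! ## Memory layout and the search for the next occurrence -/

namespace WordRAM

open Exp

/-- The address of the field `f` of the entry `j` in the row `i`. -/
def addr (n i j f : ℕ) : ℕ := 3 * n + 1 + ((i * n + j) * 4 + f)

theorem addr_inj {n i j f i' j' f' : ℕ} (hj : j < n) (hj' : j' < n) (hf : f < 4) (hf' : f' < 4) :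
    addr n i j f = addr n i' j' f' ↔ i = i' ∧ j = j' ∧ f = f' := by
  constructor
  · intro h
    simp only [addr] at h
    have h1 : i * n + j = i' * n + j' := by omega
    have h2 : f = f' := by omega
    have hi : i = i' := by
      have a1 : (i * n + j) / n = i := by
        rw [mul_comm, Nat.mul_add_div (by omega), Nat.div_eq_of_lt hj, Nat.add_zero]
      have a2 : (i' * n + j') / n = i' := by
        rw [mul_comm, Nat.mul_add_div (by omega), Nat.div_eq_of_lt hj', Nat.add_zero]
      rw [← a1, ← a2, h1]
    subst hi
    exact ⟨rfl, by omega, h2⟩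
  · rintro ⟨rfl, rfl, rfl⟩
    rfl

theorem addr_lt {n i j f i' : ℕ} (hi : i < i') (hj : j < n) (hf : f < 4) :
    addr n i j f < 3 * n + 1 + i' * n * 4 := by
  have := Nat.mul_le_mul_right n (show i + 1 ≤ i' by omega)
  rw [Nat.add_mul] at this
  simp only [addr]
  omega

def cellAddr (i j : Exp) (f : ℕ) : Exp := 3 * var 0 + 1 + ((i * var 0 + j) * 4 + lit f)
def cell (i j : Exp) (f : ℕ) : Exp := ld (cellAddr i j f)
def kindOf (j : Exp) : Exp := ld (1 + 3 * j)
def leftOf (j : Exp) : Exp := ld (2 + 3 * j)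
def rightOf (j : Exp) : Exp := ld (3 + 3 * j)
def lenOf (j : Exp) : Exp := cell (var 0 + 2) j 0

section simps
variable (H : State) (w : ℕ) (i j : Exp) (f : ℕ)
@[simp] theorem eval_cellAddr :
    (cellAddr i j f).eval H = addr (H.reg 0) (i.eval H) (j.eval H) f := rfl
@[simp] theorem eval_cell :
    (cell i j f).eval H = H.mem (addr (H.reg 0) (i.eval H) (j.eval H) f) := rfl
@[simp] theorem eval_kindOf : (kindOf j).eval H = H.mem (1 + 3 * j.eval H) := rfl
@[simp] theorem eval_leftOf : (leftOf j).eval H = H.mem (2 + 3 * j.eval H) := rfl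
@[simp] theorem eval_rightOf : (rightOf j).eval H = H.mem (3 + 3 * j.eval H) := rfl
@[simp] theorem eval_lenOf :
    (lenOf j).eval H = H.mem (addr (H.reg 0) (H.reg 0 + 2) (j.eval H) 0) := rfl
@[simp] theorem cost_cellAddr : (cellAddr i j f).cost = i.cost + j.cost + 15 := by
  simp [cellAddr]; ring
@[simp] theorem cost_cell : (cell i j f).cost = i.cost + j.cost + 16 := by simp [cell]
@[simp] theorem cost_kindOf : (kindOf j).cost = j.cost + 5 := by simp [kindOf]; ring
@[simp] theorem cost_leftOf : (leftOf j).cost = j.cost + 5 := by simp [leftOf]; ring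
@[simp] theorem cost_rightOf : (rightOf j).cost = j.cost + 5 := by simp [rightOf]; ring
@[simp] theorem cost_lenOf : (lenOf j).cost = j.cost + 20 := by simp [lenOf]; ring
@[simp] theorem ok_cellAddr : (cellAddr i j f).Ok w H ↔
    i.Ok w H ∧ j.Ok w H ∧ 4 < cap w ∧ addr (H.reg 0) (i.eval H) (j.eval H) f < cap w := by
  simp only [cellAddr, ok_add, ok_mul, ok_ofNat, ok_var, ok_lit, eval_add, eval_mul, eval_ofNat,
    eval_var, eval_lit, addr]
  constructor
  · rintro ⟨-, ⟨⟨⟨⟨hi, -⟩, hj, -⟩, h4, -⟩, -⟩, h⟩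
    exact ⟨hi, hj, h4, h⟩
  · rintro ⟨h1, h2, h3, h4⟩
    refine ⟨⟨⟨by omega, by omega, by omega⟩, by omega, by omega⟩,
      ⟨⟨⟨⟨h1, by omega, by omega⟩, h2, by omega⟩, by omega, by omega⟩, by omega, by omega⟩, by omega⟩
@[simp] theorem ok_cell : (cell i j f).Ok w H ↔
    i.Ok w H ∧ j.Ok w H ∧ 4 < cap w ∧ addr (H.reg 0) (i.eval H) (j.eval H) f < cap w :=
  ok_cellAddr H w i j f
@[simp] theorem ok_kindOf : (kindOf j).Ok w H ↔
    j.Ok w H ∧ 3 < cap w ∧ 1 + 3 * j.eval H < cap w := by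
  simp only [kindOf, ok_ld, ok_add, ok_mul, ok_ofNat, eval_mul, eval_ofNat]
  constructor
  · rintro ⟨-, ⟨h3, hj, -⟩, h⟩
    exact ⟨hj, h3, h⟩
  · rintro ⟨hj, h3, h⟩
    exact ⟨by omega, ⟨h3, hj, by omega⟩, h⟩
@[simp] theorem ok_leftOf : (leftOf j).Ok w H ↔
    j.Ok w H ∧ 3 < cap w ∧ 2 + 3 * j.eval H < cap w := by
  simp only [leftOf, ok_ld, ok_add, ok_mul, ok_ofNat, eval_mul, eval_ofNat]
  constructor
  · rintro ⟨-, ⟨h3, hj, -⟩, h⟩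
    exact ⟨hj, h3, h⟩
  · rintro ⟨hj, h3, h⟩
    exact ⟨by omega, ⟨h3, hj, by omega⟩, h⟩
@[simp] theorem ok_rightOf : (rightOf j).Ok w H ↔
    j.Ok w H ∧ 3 < cap w ∧ 3 + 3 * j.eval H < cap w := by
  simp only [rightOf, ok_ld, ok_add, ok_mul, ok_ofNat, eval_mul, eval_ofNat]
  constructor
  · rintro ⟨-, ⟨h3, hj, -⟩, h⟩
    exact ⟨hj, h3, h⟩
  · rintro ⟨hj, h3, h⟩
    exact ⟨by omega, ⟨h3, hj, by omega⟩, h⟩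
@[simp] theorem ok_lenOf : (lenOf j).Ok w H ↔
    j.Ok w H ∧ 4 < cap w ∧ addr (H.reg 0) (H.reg 0 + 2) (j.eval H) 0 < cap w := by
  simp only [lenOf, ok_cell, ok_add, ok_var, ok_ofNat, eval_add, eval_var, eval_ofNat]
  constructor
  · tauto
  · rintro ⟨h1, h2, h3⟩
    refine ⟨⟨by omega, by omega, ?_⟩, h1, h2, h3⟩
    rcases Nat.eq_zero_or_pos (H.reg 0) with h | h
    · omega
    · have : H.reg 0 + 2 ≤ (H.reg 0 + 2) * H.reg 0 := Nat.le_mul_of_pos_right _ h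
      simp only [addr] at h3
      omega
end simps

/-- The words are large enough for the numbers that occur. -/
structure Fits (g : Gram) (w : ℕ) : Prop where
  num : 20 * g.inf ≤ cap w
  mem : 3 * g.n + 1 + (g.n + 3) * g.n * 4 ≤ cap w

theorem Fits.addr {g : Gram} {w i j f : ℕ} (h : Fits g w) (hi : i < g.n + 3) (hj : j < g.n)
    (hf : f < 4) : addr g.n i j f < cap w := (addr_lt hi hj hf).trans_le h.mem

theorem Fits.two_mul {g : Gram} {w : ℕ} (h : Fits g w) : 40 ≤ cap w := by
  have := h.num
  have := g.len_pos (Nat.sub_lt g.n_pos Nat.one_pos)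
  simp only [Gram.inf, Gram.N] at *
  omega

/-- The memory holds the grammar and the lengths of its variables. -/
structure Holds (g : Gram) (mem : ℕ → ℕ) : Prop where
  kind : ∀ j < g.n, mem (1 + 3 * j) = g.kind j
  l : ∀ j < g.n, mem (2 + 3 * j) = g.l j
  r : ∀ j < g.n, mem (3 + 3 * j) = g.r j
  len : ∀ j < g.n, mem (addr g.n (g.n + 2) j 0) = g.len j

/-- The entry `j` of the row `i` describes the occurrences of `pat` in the variable `j`. -/
structure EntryOk (g : Gram) (mem : ℕ → ℕ) (i : ℕ) (pat : List ℕ) (j : ℕ) : Prop where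
  prog : g.kind j ≠ 0 → IsProg (mem (addr g.n i j 0)) (mem (addr g.n i j 1)) (mem (addr g.n i j 2))
    (g.cross pat j)
  diff : mem (addr g.n i j 1) ≤ g.inf
  first : mem (addr g.n i j 3) = g.next pat j 0

def RowOk (g : Gram) (mem : ℕ → ℕ) (i : ℕ) (pat : List ℕ) : Prop :=
  ∀ j < g.n, EntryOk g mem i pat j

/-- The constants of the computation: register `0` holds the size, register `1` is `inf`. -/
structure Ctx (g : Gram) (w : ℕ) (H : State) : Prop where
  fits : Fits g w
  n : H.reg 0 = g.n
  inf : H.reg 1 = g.inf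
  holds : Holds g H.mem

theorem Ctx.keeps {g : Gram} {w K : ℕ} {H H' : State} (h : Ctx g w H) (hk : Keeps K H H')
    (hK : 2 ≤ K) : Ctx g w H' :=
  ⟨h.fits, by rw [hk.1 0 (by omega), h.n], by rw [hk.1 1 (by omega), h.inf], by
    rw [hk.2.1]; exact h.holds⟩

/-- `R[d] := min R[d] R[a]` -/
def lower (d a : ℕ) : Program := ite (lt (var a) (var d)) (assign d (var a)) .skip

theorem runs_lower {w d a : ℕ} {H : State} {Q : State → ℕ → Prop} (hd : d < 100) (ha : a < 100)
    (hw : 1 < cap w)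
    (h : ∀ t ≤ 10, Q (H.set d (min (H.reg d) (H.reg a))) t) : Runs w (lower d a) H Q := by
  refine Runs.ite_lt (by simp [hd, ha, hw]) (fun hlt => ?_) (fun hlt => ?_)
  · refine Runs.assign (by simpa using ha) ?_
    have := h 10 (by norm_num)
    rw [min_eq_right (by exact hlt.le)] at this
    simpa using this
  · refine Runs.skip ?_
    have h1 : H.set d (H.reg d) = H := by simp [State.set]
    have := h 7 (by norm_num)
    rw [min_eq_left (by exact hlt), h1] at this
    simpa using this

/-- The next occurrence of the pattern of the row `R[80]` in the variable `R[81]` from the position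
`R[82]` on, into `R[83]`. -/
def nextOcc : Program :=
  assign 83 (var 1) ;; assign 84 0 ;;
  while_ (kindOf (var 81))
    (assign 85 (lenOf (leftOf (var 81))) ;;
     assign 86 (cell (var 80) (var 81) 0) ;;
     assign 87 (cell (var 80) (var 81) 1) ;;
     ite (lt (var 82) (cell (var 80) (var 81) 2))
      (assign 89 (var 84 + (var 86 + (var 82 - var 86 + var 87 - 1) / var 87 * var 87)) ;;
        lower 83 89) .skip ;;
     ite (lt (var 82) (var 85))
      (assign 89 (var 84 + var 85 + cell (var 80) (rightOf (var 81)) 3) ;; lower 83 89 ;;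
        assign 81 (leftOf (var 81)))
      (assign 82 (var 82 - var 85) ;; assign 84 (var 84 + var 85) ;;
        assign 81 (rightOf (var 81)))) ;;
  ite (eq (var 82) 0) (assign 89 (var 84 + cell (var 80) (var 81) 3) ;; lower 83 89) .skip

/-- The descent never branches: when it goes left, the whole right part is settled by its first
occurrence, and when it goes right, nothing on the left is relevant any more. The position may
exceed the text; then nothing is found. -/
theorem runs_nextOcc {g : Gram} {w i j x : ℕ} {pat : List ℕ} {H : State} (hc : Ctx g w H)
    (hrow : RowOk g H.mem i pat) (hp : pat ≠ []) (hi : i < g.n + 2) (hj : j < g.n)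
    (hx : x ≤ 4 * g.inf) (h80 : H.reg 80 = i) (h81 : H.reg 81 = j) (h82 : H.reg 82 = x) :
    Runs w nextOcc H fun H' t =>
      t ≤ 400 * g.n ∧ Keeps 80 H H' ∧ H'.reg 83 = g.next pat j x := by
  have hnum := hc.fits.num
  have h40 := hc.fits.two_mul
  have hmem := hc.fits.mem
  refine Runs.assign_seq (by simp) (Runs.assign_seq (by simp; omega) (Runs.seq ?_))
  -- `R[83]` is the best candidate so far and `R[84]` the start of the current variable `k` inside
  -- `j`. The minimum in the last line never changes. The variable itself serves as the variant,
  -- since parts have smaller indices.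
  let I : ℕ → State → Prop := fun k H' => Keeps 80 H H' ∧ H'.reg 80 = i ∧ H'.reg 81 = k ∧
    k < g.n ∧ H'.reg 82 ≤ 4 * g.inf ∧ H'.reg 83 ≤ g.inf ∧ H'.reg 84 + g.len k ≤ g.N ∧
    min (H'.reg 83) (H'.reg 84 + g.next pat k (H'.reg 82)) = g.next pat j x
  refine (Runs.while_le I 300 ?_ ?_ j ?_).mono ?_
  · rintro k H' ⟨hk, -, h81, hkn, -⟩
    simp [h81]
    omega
  · rintro k H' ⟨hk, h80, h81, hkn, h82, h83, h84, hmin⟩ hne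
    have hc' := hc.keeps hk (by norm_num)
    have hrow' : RowOk g H'.mem i pat := by rw [hk.2.1]; exact hrow
    have hkind : g.kind k ≠ 0 := by
      simpa [h81, hc'.holds.kind k hkn] using hne
    obtain ⟨hlk, hrk, -⟩ := g.pair k hkn hkind
    have hln : g.l k < g.n := by omega
    have hrn : g.r k < g.n := by omega
    have hlen := g.len_pair hkn hkind
    have hlpos := g.len_pos hln
    have hrpos := g.len_pos hrn
    have hent := hrow' k hkn
    have hprog := hent.prog hkind
    have ml := hc'.holds.l k hkn
    have mr := hc'.holds.r k hkn
    have mlen := hc'.holds.len (g.l k) hln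
    have ad := hc'.fits.addr (i := g.n + 2) (j := g.l k) (f := 0) (by omega) hln (by omega)
    have ad0 := hc'.fits.addr (i := i) (j := k) (f := 0) (by omega) hkn (by omega)
    have ad1 := hc'.fits.addr (i := i) (j := k) (f := 1) (by omega) hkn (by omega)
    have ad2 := hc'.fits.addr (i := i) (j := k) (f := 2) (by omega) hkn (by omega)
    have ad3 := hc'.fits.addr (i := i) (j := g.r k) (f := 3) (by omega) hrn (by omega)
    have mF := (hrow' (g.r k) hrn).first
    have hd := hent.diff
    have hn := hc'.n
    have hFle : g.next pat (g.r k) 0 ≤ g.inf := Gram.next_le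
    generalize hf : H'.mem (addr g.n i k 0) = f at *
    generalize hdd : H'.mem (addr g.n i k 1) = d at *
    generalize he : H'.mem (addr g.n i k 2) = e at *
    have hN : g.inf = g.N + 1 := rfl
    refine Runs.assign_seq (by simp [*]; omega) ?_
    refine Runs.assign_seq (by simp [*]; omega) ?_
    refine Runs.assign_seq (by simp [*]; omega) ?_
    simp only [eval_lenOf, eval_leftOf, eval_var, eval_cell, State.set_reg, State.set_mem,
      Nat.reduceEqDiff, if_false, h80, h81, hn, ml, mlen, hf, hdd]
    set b := if H'.reg 82 < e then
      min (H'.reg 83) (H'.reg 84 + (f + (H'.reg 82 - f + d - 1) / d * d)) else H'.reg 83 with hb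
    set c := f + (H'.reg 82 - f + d - 1) / d * d with hcdef
    have hbinf : b ≤ g.inf := by rw [hb]; split_ifs <;> omega
    refine Runs.seq (Runs.mono (Q := fun H₂ t => t ≤ 100 ∧ Keeps 80 H H₂ ∧ H₂.reg 80 = i ∧
      H₂.reg 81 = k ∧ H₂.reg 82 = H'.reg 82 ∧ H₂.reg 83 = b ∧ H₂.reg 84 = H'.reg 84 ∧
      H₂.reg 85 = g.len (g.l k)) ?_ ?_)
    · refine Runs.ite_lt (by simp [*]; omega) (fun hlt => ?_) (fun hlt => ?_)
      · replace hlt : H'.reg 82 < e := by simpa [*] using hlt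
        obtain ⟨c1, c2, c3⟩ := hprog.next hlt
        have hcl := c1.1
        rw [← hcdef] at c1 c2 c3 hcl
        have hfe := ((hprog.1 _).1 c1).1
        refine Runs.assign_seq ?_ (runs_lower (by omega) (by omega) (by omega) fun t ht => ?_)
        · simp
          omega
        · refine ⟨by simp; omega, ?_, ?_⟩
          · exact ((((hk.set (by omega)).set (by omega)).set (by omega)).set (by omega)).set
              (by omega)
          · simp [h80, h81, hb, hlt, hcdef]
      · replace hlt : ¬ H'.reg 82 < e := by simpa [*] using hlt
        refine Runs.skip ⟨by simp, ((hk.set (by omega)).set (by omega)).set (by omega), ?_⟩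
        simp [h80, h81, hb, hlt]
    · rintro H₂ t₂ ⟨ht₂, hk₂, g80, g81, g82, g83, g84, g85⟩
      have hc₂ := hc.keeps hk₂ (by norm_num)
      have hn₂ := hc₂.n
      have hmem₂ : H₂.mem = H'.mem := by rw [hk₂.2.1, hk.2.1]
      refine Runs.ite_lt (by simp; omega) (fun hlt => ?_) (fun hlt => ?_)
      · replace hlt : H'.reg 82 < g.len (g.l k) := by simpa [g82, g85] using hlt
        refine Runs.assign_seq (by simp [*]; omega) ?_
        refine Runs.seq (runs_lower (by omega) (by omega) (by omega) fun t₃ ht₃ => ?_)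
        refine Runs.assign (by simp [*]; omega) ⟨by simp; omega, g.l k, hlk, ?_⟩
        refine ⟨((hk₂.set (by omega)).set (by omega)).set (by omega), ?_⟩
        simp only [eval_leftOf, eval_add, eval_var, eval_cell, eval_rightOf, State.set_reg,
          State.set_mem, Nat.reduceEqDiff, if_false, if_true, g80, g81, g82,
          g83, g84, g85, hmem₂, mr, ml, hn₂, mF]
        refine ⟨trivial, trivial, hln, h82, by omega, by omega, ?_⟩
        rw [← hmin, Gram.next_left hp hkn hkind hprog hlt _ _ h83]
      · replace hlt : g.len (g.l k) ≤ H'.reg 82 := by simpa [g82, g85] using hlt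
        obtain ⟨r1, r2⟩ := Gram.next_right hkn hkind hprog hlt hp (H'.reg 84) _ h83
        refine Runs.assign_seq (by simp) (Runs.assign_seq (by simp [*]; omega) ?_)
        refine Runs.assign (by simp [*]; omega) ⟨by simp; omega, g.r k, hrk, ?_⟩
        refine ⟨((hk₂.set (by omega)).set (by omega)).set (by omega), ?_⟩
        simp only [eval_rightOf, eval_add, eval_sub, eval_var, State.set_reg, State.set_mem,
          Nat.reduceEqDiff, if_false, if_true, g80, g81, g82, g83, g84, g85,
          hmem₂, mr]
        refine ⟨trivial, trivial, hrn, by omega, by omega, by omega, ?_⟩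
        rw [← hmin, r2, hb, if_neg r1]
  · refine ⟨((Keeps.refl 80 H).set (by omega)).set (by omega), ?_⟩
    have := g.len_le_N hj
    have hle : g.next pat j x ≤ g.inf := Gram.next_le
    simp [h80, h81, h82, hc.inf]
    omega
  · rintro H' t ⟨ht, hz, k, hk, h80', h81', hkn, h82', h83, h84, hmin⟩
    have hc' := hc.keeps hk (by norm_num)
    have hrow' : RowOk g H'.mem i pat := by rw [hk.2.1]; exact hrow
    have hkind : g.kind k = 0 := by
      simpa [h81', hc'.holds.kind k hkn] using hz
    have ad := hc'.fits.addr (i := i) (j := k) (f := 3) (by omega) hkn (by omega)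
    have hn := hc'.n
    have mF := (hrow' k hkn).first
    have hFle : g.next pat k 0 ≤ g.inf := Gram.next_le
    have hN : g.inf = g.N + 1 := rfl
    have hjn : j * (300 + (kindOf (var 81)).cost + 1) ≤ (g.n - 1) * 308 := by
      simp; omega
    rw [Gram.next_leaf hkn hkind hp _ _ h83] at hmin
    simp only [cost_kindOf, cost_var] at ht
    refine Runs.ite_eq (by simp; omega) (fun hx0 => ?_) (fun hx0 => ?_)
    · replace hx0 : H'.reg 82 = 0 := hx0
      refine Runs.assign_seq (by simp [*]; omega)
        (runs_lower (by omega) (by omega) (by omega) fun t₃ ht₃ => ?_)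
      refine ⟨by simp; omega, (hk.set (by omega)).set (by omega), ?_⟩
      rw [if_pos hx0] at hmin
      simp [*]
    · replace hx0 : H'.reg 82 ≠ 0 := hx0
      rw [if_neg hx0] at hmin
      exact Runs.skip ⟨by simp; omega, hk, hmin⟩

end WordRAM

/-! ## Occurrences of a concatenation of two patterns -/

namespace Gram

variable {g : Gram} {pu pv : List ℕ} {j ou ov : ℕ}

/-- The patterns `pu` and `pv` occur with the offsets `ou` and `ov` from `x`. -/
def both (g : Gram) (pu pv : List ℕ) (ou ov j x : ℕ) : Prop :=
  g.occ pu j (x + ou) ∧ g.occ pv j (x + ov)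

/-- `Occ.At.sub_gap`, shifted by the offset; the bound on the window is the distance allowed there.
-/
theorem prog_occ {lo hi : ℕ} (hhi : hi ≤ lo + pu.length) :
    Prog (fun x => g.occ pu j (x + ou)) lo hi := by
  intro x₀ x₁ x h₀ h₁ h hlo h01 h1x hx gap
  have := Occ.At.sub_gap h₀ h₁ h (by omega) (by omega) (by omega) (fun y hy hy' => by
    have : ¬ g.occ pu j (y - ou + ou) := gap (y - ou) (by omega) (by omega)
    rwa [show y - ou + ou = y by omega] at this)
  rwa [show x + ou - (x₁ + ou - (x₀ + ou)) = x - (x₁ - x₀) + ou by omega] at this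

/-- The offsets of the two halves of a concatenation, in either order. -/
def Offsets (pu pv : List ℕ) (ou ov : ℕ) : Prop :=
  (ou = 0 ∧ ov = pu.length) ∨ (ou = pv.length ∧ ov = 0)

/-- The two cases of `Offsets` are `v` behind `u` and `v` before `u`. With `t = 0` or `d = 0` the
terms `t` and `t - 1` coincide, against `hB` and `hB'`. -/
theorem not_occ_between (ho : Offsets pu pv ou ov) {x₀ d k t y : ℕ} (hd : d ≤ pu.length)
    (htk : t < k) (hA : ∀ s ≤ k, g.occ pu j (x₀ + s * d + ou))
    (hB : g.occ pv j (x₀ + t * d + ov)) (hB' : ¬ g.occ pv j (x₀ + (t - 1) * d + ov))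
    (hy : x₀ + d ≤ y) (hyt : y ≤ x₀ + (t - 1) * d) : ¬ g.occ pv j (y + ov) := by
  rcases ho with ⟨rfl, rfl⟩ | ⟨rfl, rfl⟩
  · refine Occ.not_at_after (k := k) (t := t) hd hA htk hB hB' hy ?_
    rcases t with _ | t
    · exact absurd hB hB'
    · have : (t + 1) * d = t * d + d := by ring
      rcases Nat.eq_zero_or_pos d with rfl | h
      · simp at hB hB'
        exact absurd hB hB'
      · rw [Nat.add_sub_cancel] at hyt
        omega
  · exact Occ.not_at_before hd hA htk.le hB hB' hy hyt

end Gram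

namespace WordRAM

open Exp

/-- The budget for one table entry, up to a constant. -/
def _root_.Gram.K (g : Gram) : ℕ := g.n * (Nat.log 2 g.N + 1)

theorem _root_.Gram.n_le_K (g : Gram) : g.n ≤ g.K := Nat.le_mul_of_pos_right _ (Nat.succ_pos _)

/-- `nextOcc` for the row in the register `ru`, the variable `R[24]` and the position `x`. -/
def callNext (ru : ℕ) (x : Exp) : Program :=
  assign 82 x ;; assign 80 (var ru) ;; assign 81 (var 24) ;; nextOcc

theorem runs_callNext {g : Gram} {w ru : ℕ} {x : Exp} {pat : List ℕ} {H : State}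
    (hc : Ctx g w H) (hrow : RowOk g H.mem (H.reg ru) pat) (hp : pat ≠ [])
    (hi : H.reg ru < g.n + 2) (hj : H.reg 24 < g.n) (hru : ru < 80) (hx : x.Ok w H)
    (hxle : x.eval H ≤ 4 * g.inf) (hcost : x.cost ≤ 20) :
    Runs w (callNext ru x) H fun H' t =>
      t ≤ 440 * g.n ∧ Keeps 80 H H' ∧ H'.reg 83 = g.next pat (H.reg 24) (x.eval H) := by
  have hn := g.n_pos
  have k0 : Keeps 80 H (((H.set 82 (x.eval H)).set 80 (H.reg ru)).set 81 (H.reg 24)) :=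
    (((Keeps.refl 80 H).set (by omega)).set (by omega)).set (by omega)
  refine Runs.assign_seq hx (Runs.assign_seq (by simp; omega) (Runs.assign_seq (by simp) ?_))
  have h82 : ru ≠ 82 := by omega
  simp only [eval_var, State.set_reg, h82, if_false, Nat.reduceEqDiff]
  refine (runs_nextOcc (i := H.reg ru) (j := H.reg 24) (x := x.eval H) (pat := pat)
    (hc.keeps k0 (by omega)) hrow hp hi hj hxle ?_ ?_ ?_).mono ?_
  · simp
  · simp
  · simp
  · rintro H' t ⟨ht, hk, h⟩
    exact ⟨by simp only [cost_var]; omega, k0.trans hk, h⟩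

/-- Test whether the rows in `ru` and `rv` occur with the offsets in `ro` and `rp` from the position
in `rx`; the answer goes to `R[70]`. -/
def testAt (ru ro rv rp rx : ℕ) : Program :=
  callNext ru (var rx + var ro) ;; assign 70 (eq (var 83) (var rx + var ro)) ;;
  callNext rv (var rx + var rp) ;; assign 70 (var 70 * eq (var 83) (var rx + var rp))

/-- Two rows in the registers `ru` and `rv`, with offsets in `ro` and `rp`. -/
structure Setup (g : Gram) (w : ℕ) (H : State) (ru ro rv rp : ℕ) (pu pv : List ℕ) : Prop where
  ctx : Ctx g w H
  rowU : RowOk g H.mem (H.reg ru) pu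
  rowV : RowOk g H.mem (H.reg rv) pv
  u_lt : H.reg ru < g.n + 2
  v_lt : H.reg rv < g.n + 2
  u_ne : pu ≠ []
  v_ne : pv ≠ []
  j_lt : H.reg 24 < g.n
  ru_lt : ru < 25
  ro_lt : ro < 25
  rv_lt : rv < 25
  rp_lt : rp < 25

theorem Setup.keeps {g : Gram} {w K ru ro rv rp : ℕ} {H H' : State} {pu pv : List ℕ}
    (h : Setup g w H ru ro rv rp pu pv) (hk : Keeps K H H') (hK : 25 ≤ K) :
    Setup g w H' ru ro rv rp pu pv := by
  have h1 := h.ru_lt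
  have h2 := h.rv_lt
  exact { ctx := h.ctx.keeps hk (by omega)
          rowU := by rw [hk.2.1, hk.1 ru (by omega)]; exact h.rowU
          rowV := by rw [hk.2.1, hk.1 rv (by omega)]; exact h.rowV
          u_lt := by rw [hk.1 ru (by omega)]; exact h.u_lt
          v_lt := by rw [hk.1 rv (by omega)]; exact h.v_lt
          u_ne := h.u_ne
          v_ne := h.v_ne
          j_lt := by rw [hk.1 24 (by omega)]; exact h.j_lt
          ru_lt := h.ru_lt
          ro_lt := h.ro_lt
          rv_lt := h.rv_lt
          rp_lt := h.rp_lt }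

theorem runs_testAt {g : Gram} {w ru ro rv rp rx : ℕ} {pu pv : List ℕ} {H : State}
    (hs : Setup g w H ru ro rv rp pu pv) (hrx : rx < 70)
    (hu : H.reg rx + H.reg ro < g.inf) (hv : H.reg rx + H.reg rp < g.inf) :
    Runs w (testAt ru ro rv rp rx) H fun H' t => t ≤ 1000 * g.n ∧ Keeps 70 H H' ∧
      (H'.reg 70 ≠ 0 ↔ g.both pu pv (H.reg ro) (H.reg rp) (H.reg 24) (H.reg rx)) := by
  have h1 := hs.ru_lt
  have h2 := hs.rv_lt
  have h3 := hs.ro_lt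
  have h4 := hs.rp_lt
  have hn := g.n_pos
  have hnum := hs.ctx.fits.num
  have h40 := hs.ctx.fits.two_mul
  refine Runs.seq ((runs_callNext hs.ctx hs.rowU hs.u_ne hs.u_lt hs.j_lt (by omega)
    (by simp; omega) (by simp; omega) (by simp)).mono ?_)
  rintro H₁ t₁ ⟨ht₁, hk₁, e₁⟩
  have b1 : H₁.reg rx = H.reg rx := hk₁.1 rx (by omega)
  have b2 : H₁.reg ro = H.reg ro := hk₁.1 ro (by omega)
  have b3 : H₁.reg rp = H.reg rp := hk₁.1 rp (by omega)
  have hs₁ := hs.keeps hk₁ (by omega)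
  -- A pattern occurs at a position exactly if this is the next occurrence from there on. The bound
  -- `hu` excludes the position `inf`, where absence would look like a match.
  have e₁' : H₁.reg 83 = H.reg rx + H.reg ro ↔ g.occ pu (H.reg 24) (H.reg rx + H.reg ro) := by
    rw [e₁]; exact nxt_eq_self_iff hu
  refine Runs.assign_seq (by simp; omega) ?_
  simp only [eval_eq, eval_var, eval_add, b1, b2]
  set a := if H₁.reg 83 = H.reg rx + H.reg ro then 1 else 0 with ha
  have k₂ : Keeps 70 H₁ (H₁.set 70 a) := (Keeps.refl _ _).set le_rfl
  have hs₂ := hs₁.keeps k₂ (by omega)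
  refine Runs.seq ((runs_callNext hs₂.ctx hs₂.rowV hs₂.v_ne hs₂.v_lt hs₂.j_lt (by omega)
    (by simp [b1, b3]; rw [if_neg (by omega), if_neg (by omega)]; omega)
    (by simp [b1, b3]; rw [if_neg (by omega), if_neg (by omega)]; omega) (by simp)).mono ?_)
  rintro H₃ t₃ ⟨ht₃, hk₃, e₃⟩
  have c1 : H₃.reg rx = H.reg rx := by
    rw [hk₃.1 rx (by omega), k₂.1 rx (by omega), b1]
  have c3 : H₃.reg rp = H.reg rp := by
    rw [hk₃.1 rp (by omega), k₂.1 rp (by omega), b3]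
  have c4 : H₃.reg 70 = a := by rw [hk₃.1 70 (by omega)]; simp
  have e₃' : H₃.reg 83 = H.reg rx + H.reg rp ↔ g.occ pv (H.reg 24) (H.reg rx + H.reg rp) := by
    rw [e₃, eval_add, eval_var, eval_var, k₂.1 rx (by omega), k₂.1 rp (by omega),
      k₂.1 24 (by omega), b1, b3, hk₁.1 24 (by omega)]
    exact nxt_eq_self_iff hv
  have hk : Keeps 70 H H₃ := ((hk₁.le (by omega)).trans k₂).trans (hk₃.le (by omega))
  refine Runs.assign ?_ ⟨?_, hk.set le_rfl, ?_⟩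
  · simp only [ok_mul, ok_var, ok_eq, ok_add, eval_var, eval_eq, eval_add, c1, c3, c4]
    refine ⟨by omega, ⟨by omega, ⟨by omega, by omega, by omega⟩, by omega⟩, ?_⟩
    rw [ha]
    split_ifs <;> omega
  · simp
    omega
  · simp only [State.set_reg, if_true, eval_mul, eval_eq, eval_add, eval_var, c1, c3, c4, ha,
      Gram.both, ← e₃', ← e₁']
    by_cases p1 : H₁.reg 83 = H.reg rx + H.reg ro <;>
      by_cases p2 : H₃.reg 83 = H.reg rx + H.reg rp <;> simp [p1, p2]

/-- The last element of a progression from `R[rf]` with difference `R[rd]` below `R[rhi]`, by binary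
search, into `R[60]`. -/
def lastOf (ru ro rv rp rf rd rhi : ℕ) : Program :=
  assign 61 0 ;; assign 62 ((var rhi - var rf) / var rd + 1) ;;
  while_ (lt (var 61 + 1) (var 62))
    (assign 63 ((var 61 + var 62) / 2) ;; assign 64 (var rf + var 63 * var rd) ;;
      testAt ru ro rv rp 64 ;; ite (var 70) (assign 61 (var 63)) (assign 62 (var 63))) ;;
  assign 60 (var rf + var 61 * var rd)

/-- No monotonicity is assumed: the search maintains an index that succeeds and a larger one that
fails or leaves the window, until they are adjacent. That the resulting term is the last one follows
afterwards from the structure of the progression. -/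
theorem runs_lastOf {g : Gram} {w ru ro rv rp rf rd rhi f d hi ou ov j : ℕ} {pu pv : List ℕ}
    {H : State} (hs : Setup g w H ru ro rv rp pu pv) (hrf : rf < 60) (hrd : rd < 60)
    (hrhi : rhi < 60) (ef : H.reg rf = f) (ed : H.reg rd = d) (ehi : H.reg rhi = hi)
    (eo : H.reg ro = ou) (ep : H.reg rp = ov) (ej : H.reg 24 = j)
    (hu : hi + ou < g.inf) (hv : hi + ov < g.inf) (hf : f ≤ hi) (hd : 0 < d)
    (hP : g.both pu pv ou ov j f) :
    Runs w (lastOf ru ro rv rp rf rd rhi) H fun H' t => t ≤ 1400 * g.K ∧ Keeps 60 H H' ∧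
      ∃ k, H'.reg 60 = f + k * d ∧ g.both pu pv ou ov j (f + k * d) ∧ f + k * d ≤ hi ∧
        (f + (k + 1) * d ≤ hi → ¬ g.both pu pv ou ov j (f + (k + 1) * d)) := by
  have h1 := hs.ru_lt
  have h2 := hs.rv_lt
  have h3 := hs.ro_lt
  have h4 := hs.rp_lt
  have hn := g.n_pos
  have hnum := hs.ctx.fits.num
  have h40 := hs.ctx.fits.two_mul
  have hN : g.inf = g.N + 1 := rfl
  have hq : (hi - f) / d ≤ hi - f := Nat.div_le_self _ _
  have hqd := Nat.lt_div_mul_add hd (a := hi - f)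
  have hqd' := Nat.div_mul_le_self (hi - f) d
  obtain ⟨q, hqdef⟩ : ∃ q, q = (hi - f) / d := ⟨_, rfl⟩
  rw [← hqdef] at hq hqd hqd'
  refine Runs.assign_seq (by simp; omega) (Runs.assign_seq ?_ (Runs.seq ?_))
  · simp
    refine ⟨⟨by omega, by omega⟩, by omega, ?_⟩
    rw [if_neg (by omega), if_neg (by omega), if_neg (by omega), ef, ed, ehi]
    omega
  -- The two indices differ by at most `2 ^ k`, so `k` counts the halvings that are left; initially
  -- `log N + 1` of them suffice.
  let I : ℕ → State → Prop := fun k H' => Keeps 60 H H' ∧ H'.reg 61 < H'.reg 62 ∧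
    H'.reg 62 ≤ H'.reg 61 + 2 ^ k ∧ H'.reg 62 ≤ q + 1 ∧
    g.both pu pv ou ov j (f + H'.reg 61 * d) ∧
    (f + H'.reg 62 * d ≤ hi → ¬ g.both pu pv ou ov j (f + H'.reg 62 * d))
  refine (Runs.while_le I (1100 * g.n) ?_ ?_ (Nat.log 2 g.N + 1) ?_).mono ?_
  · rintro k H' ⟨hk, hlt, hpow, hq, -, -⟩
    simp
    omega
  · rintro k H' ⟨hk, hlt, hpow, hq', hP61, hP62⟩ hne
    have hlt2 : H'.reg 61 + 1 < H'.reg 62 := by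
      by_contra hcon; exact hne (if_neg hcon)
    obtain ⟨k, rfl⟩ : ∃ k', k = k' + 1 := by
      rcases k with _ | k
      · simp at hpow; omega
      · exact ⟨k, rfl⟩
    rw [pow_succ] at hpow
    set m := (H'.reg 61 + H'.reg 62) / 2 with hm
    have hmq : m ≤ q := by omega
    have hmd : m * d ≤ q * d := Nat.mul_le_mul_right d hmq
    have f1 : H'.reg rf = f := by rw [hk.1 rf (by omega), ef]
    have f2 : H'.reg rd = d := by rw [hk.1 rd (by omega), ed]
    refine Runs.assign_seq (by simp; omega) (Runs.assign_seq ?_ ?_)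
    · simp
      rw [if_neg (by omega), if_neg (by omega), f1, f2, ← hm]
      refine ⟨by omega, ⟨by omega, by omega⟩, by omega⟩
    · simp only [eval_add, eval_mul, eval_var, eval_div, eval_ofNat, State.set_reg,
        show rf ≠ 63 by omega, show rd ≠ 63 by omega, if_true, if_false, f1, f2, ← hm]
      set H₁ := (H'.set 63 m).set 64 (f + m * d) with hH₁
      have kk : Keeps 60 H H₁ := (hk.set (by omega)).set (by omega)
      have s1 := hs.keeps kk (by omega)
      have g1 : H₁.reg ro = ou := by rw [kk.1 ro (by omega), eo]
      have g2 : H₁.reg rp = ov := by rw [kk.1 rp (by omega), ep]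
      have g3 : H₁.reg 24 = j := by rw [kk.1 24 (by omega), ej]
      have g4 : H₁.reg 64 = f + m * d := by simp [hH₁]
      have g5 : H₁.reg 63 = m := by simp [hH₁]
      have g6 : H₁.reg 61 = H'.reg 61 := by simp [hH₁]
      have g7 : H₁.reg 62 = H'.reg 62 := by simp [hH₁]
      refine Runs.seq ((runs_testAt s1 (by omega) (by omega) (by omega)).mono ?_)
      rintro H₂ t₂ ⟨ht₂, hk₂, e₂⟩
      rw [g1, g2, g3, g4] at e₂
      have m1 := hk₂.1 61 (by omega)
      have m2 := hk₂.1 62 (by omega)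
      have m3 := hk₂.1 63 (by omega)
      have kk₂ : Keeps 60 H H₂ := kk.trans (hk₂.le (by omega))
      refine Runs.ite (by simp) (fun hyes => ?_) (fun hno => ?_)
      · refine Runs.assign (by simp) ⟨by simp; omega, k, by omega, kk₂.set (by omega), ?_⟩
        simp only [State.set_reg, if_true, if_false, Nat.reduceEqDiff, eval_var, m1, m2, m3, g5,
          g6, g7]
        exact ⟨by omega, by omega, hq', e₂.1 hyes, hP62⟩
      · refine Runs.assign (by simp) ⟨by simp; omega, k, by omega, kk₂.set (by omega), ?_⟩
        simp only [State.set_reg, if_true, if_false, Nat.reduceEqDiff, eval_var, m1, m2, m3, g5,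
          g6, g7]
        refine ⟨by omega, by omega, by omega, hP61, fun _ hb => ?_⟩
        exact e₂.2 hb hno
  · refine ⟨((Keeps.refl _ _).set (by omega)).set (by omega), ?_⟩
    simp only [State.set_reg, if_true, if_false, Nat.reduceEqDiff, eval_add, eval_sub, eval_div,
      eval_var, eval_ofNat, show rf ≠ 61 by omega, show rd ≠ 61 by omega, show rhi ≠ 61 by omega,
      ef, ed, ehi, ← hqdef]
    have hlog : g.N < 2 ^ (Nat.log 2 g.N + 1) := Nat.lt_pow_succ_log_self (by norm_num) _
    -- The upper index `q + 1` is the first to leave the window, so it need not fail a test.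
    refine ⟨by omega, by omega, by omega, by simpa using hP, fun h => ?_⟩
    rw [Nat.add_mul] at h
    omega
  · rintro H' t ⟨ht, hz, k, hk, hlt, hpow, hq', hP61, hP62⟩
    have heq : H'.reg 62 = H'.reg 61 + 1 := by
      by_contra hcon
      have : H'.reg 61 + 1 < H'.reg 62 := by omega
      exact absurd (hz.symm.trans (if_pos this)) zero_ne_one
    have hmd : H'.reg 61 * d ≤ q * d := Nat.mul_le_mul_right d (by omega)
    have f1 : H'.reg rf = f := by rw [hk.1 rf (by omega), ef]
    have f2 : H'.reg rd = d := by rw [hk.1 rd (by omega), ed]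
    refine Runs.assign ?_ ⟨?_, hk.set (by omega), H'.reg 61, ?_, hP61, by omega, ?_⟩
    · simp [f1, f2]
      omega
    · have e : (Nat.log 2 g.N + 1) * (1100 * g.n + (lt (var 61 + 1) (var 62)).cost + 1) =
          1100 * g.K + 8 * (Nat.log 2 g.N + 1) := by
        simp [Gram.K]; ring
      have e2 : Nat.log 2 g.N + 1 ≤ g.K := Nat.le_mul_of_pos_left _ hn
      rw [e] at ht
      simp at ht ⊢
      omega
    · simp [f1, f2]
    · rw [heq] at hP62
      exact hP62

end WordRAM

/-! ### The first common element of a progression and a set -/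

section
variable {A B : ℕ → Prop} {lo hi x₀ d z y inf : ℕ}

/-- The least element of `P` from `lo` on exists and is at most `R`, so it lies in the window; it
suffices to identify it with `R`. -/
theorem FirstIn.of_forall {P : ℕ → Prop} {R : ℕ} (hR : P R) (hlo : lo ≤ R) (hhi : R ≤ hi)
    (h : ∀ x, lo ≤ x → x ≤ hi → P x → (∀ y, lo ≤ y → y < x → ¬ P y) → x = R) :
    FirstIn P lo hi inf R := by
  classical
  have hex : ∃ x, lo ≤ x ∧ P x := ⟨R, hlo, hR⟩
  obtain ⟨h1, h2⟩ := Nat.find_spec hex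
  have hmin : ∀ y, lo ≤ y → y < Nat.find hex → ¬ P y := fun y hy hlt hP =>
    Nat.find_min hex hlt ⟨hy, hP⟩
  have hle : Nat.find hex ≤ R := Nat.find_min' hex ⟨hlo, hR⟩
  have := h _ h1 (by omega) h2 hmin
  rw [this] at hmin
  exact Or.inr ⟨hlo, hhi, hR, hmin⟩

theorem FirstIn.none {P : ℕ → Prop}
    (h : ∀ x, lo ≤ x → x ≤ hi → P x → (∀ y, lo ≤ y → y < x → ¬ P y) → False) :
    FirstIn P lo hi inf inf := by
  classical
  refine Or.inl ⟨rfl, fun x hlo hhi hP => ?_⟩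
  have hex : ∃ x, lo ≤ x ∧ P x := ⟨x, hlo, hP⟩
  obtain ⟨h1, h2⟩ := Nat.find_spec hex
  have hle : Nat.find hex ≤ x := Nat.find_min' hex ⟨hlo, hP⟩
  exact h _ h1 (by omega) h2 fun y hy hlt hP => Nat.find_min hex hlt ⟨hy, hP⟩

/-- The first common element of a progression `A` and a set `B`, from the candidates. -/
theorem firstIn_common (hA : Prog A lo hi)
    (hlo : lo ≤ x₀) (h₀ : A x₀) (h₁ : A (x₀ + d)) (hd : 0 < d) (hhi : x₀ + d ≤ hi)
    (gap₀ : ∀ y, lo ≤ y → y < x₀ → ¬ A y)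
    (gap : ∀ y, x₀ < y → y < x₀ + d → ¬ A y)
    (key : ∀ k t y, t < k → (∀ s ≤ k, A (x₀ + s * d)) → B (x₀ + t * d) →
      ¬ B (x₀ + (t - 1) * d) → x₀ + d ≤ y → y ≤ x₀ + (t - 1) * d → ¬ B y)
    (hB₀ : ¬ B x₀)
    (hz : ∀ y, x₀ + d ≤ y → B y → z ≤ y ∧ x₀ + d ≤ z ∧ B z)
    (hy : ∀ v, z ≤ v → A v → y ≤ v ∧ z ≤ y ∧ A y) :
    (A y → B y → lo ≤ y → y ≤ hi → FirstIn (fun x => A x ∧ B x) lo hi inf y) ∧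
    ∀ k, A (x₀ + k * d) → x₀ + k * d ≤ hi →
      (x₀ + (k + 1) * d ≤ hi → ¬ A (x₀ + (k + 1) * d)) → ¬ (A y ∧ B y ∧ lo ≤ y ∧ y ≤ hi) →
      (B (x₀ + k * d) → FirstIn (fun x => A x ∧ B x) lo hi inf (x₀ + k * d)) ∧
      (¬ B (x₀ + k * d) → FirstIn (fun x => A x ∧ B x) lo hi inf inf) := by
  classical
  have main : ∀ k, A (x₀ + k * d) → x₀ + k * d ≤ hi →
      (x₀ + (k + 1) * d ≤ hi → ¬ A (x₀ + (k + 1) * d)) → ∀ x, lo ≤ x → x ≤ hi → A x ∧ B x →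
      (∀ y, lo ≤ y → y < x → ¬ (A y ∧ B y)) → x = y ∨ x = x₀ + k * d := by
    intro k hk1 hk2 hk3 x hxlo hxhi hx hmin
    refine first_common hA hlo h₀ h₁ hd gap₀ gap hk1 hk2 hk3 (key k) hx.1 hx.2 hxlo hxhi
      (fun y h1 h2 h3 h4 => hmin y h1 h2 ⟨h3, h4⟩) ?_ hz hy
    rintro rfl
    exact hB₀ hx.2
  constructor
  · intro hyA hyB hylo hyhi
    -- When `y` succeeds, the last term is never computed, but the argument still refers to one.
    obtain ⟨k, hk1, hk2, hk3⟩ : ∃ k, A (x₀ + k * d) ∧ x₀ + k * d ≤ hi ∧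
        (x₀ + (k + 1) * d ≤ hi → ¬ A (x₀ + (k + 1) * d)) := by
      let Q : ℕ → Prop := fun k => A (x₀ + k * d) ∧ x₀ + k * d ≤ hi
      have h0 : Q 0 := ⟨by simpa using h₀, by omega⟩
      have hf := Nat.findGreatest_spec (P := Q) (Nat.zero_le hi) h0
      refine ⟨Nat.findGreatest Q hi, hf.1, hf.2, fun hle hA' => ?_⟩
      have h1 : Nat.findGreatest Q hi + 1 ≤ (Nat.findGreatest Q hi + 1) * d :=
        Nat.le_mul_of_pos_right _ hd
      exact Nat.findGreatest_is_greatest (P := Q) (Nat.lt_succ_self _) (by omega) ⟨hA', hle⟩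
    refine FirstIn.of_forall ⟨hyA, hyB⟩ hylo hyhi fun x hxlo hxhi hx hmin => ?_
    rcases main k hk1 hk2 hk3 x hxlo hxhi hx hmin with h | h
    · exact h
    -- If the least common element is the last term, then `y`, being a term too, cannot lie beyond
    -- it, and the two coincide.
    · have hxy : x ≤ y := by
        by_contra hcon
        exact hmin y hylo (by omega) ⟨hyA, hyB⟩
      obtain ⟨s, rfl⟩ := hA.exists_eq hlo h₀ h₁ gap hyA (by omega) hyhi hd
      have hsk : s ≤ k := by
        by_contra hcon
        have h2 : (k + 1) * d ≤ s * d := Nat.mul_le_mul_right d (by omega)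
        exact hk3 (by omega) (hA.down hlo h₀ h₁ gap hd hyA hyhi (by omega))
      have := Nat.mul_le_mul_right d hsk
      omega
  · intro k hk1 hk2 hk3 hno
    constructor
    · intro hB
      refine FirstIn.of_forall ⟨hk1, hB⟩ (by omega) hk2 fun x hxlo hxhi hx hmin => ?_
      rcases main k hk1 hk2 hk3 x hxlo hxhi hx hmin with rfl | h
      · exact absurd ⟨hx.1, hx.2, hxlo, hxhi⟩ hno
      · exact h
    · intro hB
      refine FirstIn.none fun x hxlo hxhi hx hmin => ?_
      rcases main k hk1 hk2 hk3 x hxlo hxhi hx hmin with rfl | rfl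
      · exact absurd ⟨hx.1, hx.2, hxlo, hxhi⟩ hno
      · exact hB hx.2

end

/-! ### The search for the first joint occurrence of two patterns -/

namespace WordRAM

open Exp

/-- The candidates for the first occurrence after the start of the progression, `R[54]` with
difference `R[56]`. -/
def candidates : Program :=
  callNext 22 (var 54 + var 56 + var 23) ;; assign 57 (var 83 - var 23) ;;
  callNext 20 (var 57 + var 21) ;; assign 58 (var 83) ;; assign 59 0 ;;
  ite (lt (var 58) (var 51 + var 21 + 1))
    (assign 58 (var 58 - var 21) ;; testAt 20 21 22 23 58 ;; assign 59 (var 70)) .skip ;;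
  ite (var 59) (assign 52 (var 58))
    (lastOf 20 21 20 21 54 56 51 ;; testAt 20 21 22 23 60 ;;
      ite (var 70) (assign 52 (var 60)) .skip)

theorem runs_candidates {g : Gram} {w lo hi x₀ d ou ov j : ℕ} {pu pv : List ℕ}
    {H : State} (hs : Setup g w H 20 21 22 23 pu pv) (ho : Gram.Offsets pu pv ou ov)
    (eo : H.reg 21 = ou) (ep : H.reg 23 = ov) (ej : H.reg 24 = j) (ehi : H.reg 51 = hi)
    (e52 : H.reg 52 = g.inf) (e54 : H.reg 54 = x₀) (e56 : H.reg 56 = d)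
    (hu : hi + ou < g.inf) (hv : hi + ov < g.inf) (hlohi : hi ≤ lo + pu.length)
    (hlo : lo ≤ x₀) (h₀ : g.occ pu j (x₀ + ou)) (h₁ : g.occ pu j (x₀ + d + ou)) (hd : 0 < d)
    (hhi : x₀ + d ≤ hi) (gap₀ : ∀ y, lo ≤ y → y < x₀ → ¬ g.occ pu j (y + ou))
    (gap : ∀ y, x₀ < y → y < x₀ + d → ¬ g.occ pu j (y + ou)) (hB₀ : ¬ g.occ pv j (x₀ + ov)) :
    Runs w candidates H fun H' t => t ≤ 5000 * g.K ∧ Keeps 52 H H' ∧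
      FirstIn (g.both pu pv ou ov j) lo hi g.inf (H'.reg 52) := by
  have hn := g.n_pos
  have hnK := g.n_le_K
  have hnum := hs.ctx.fits.num
  have h40 := hs.ctx.fits.two_mul
  have hj : j < g.n := ej ▸ hs.j_lt
  unfold candidates
  -- the next occurrence of `pv`
  refine Runs.seq ((runs_callNext hs.ctx hs.rowV hs.v_ne hs.v_lt hs.j_lt (by omega)
    (by simp; omega) (by simp; omega) (by simp)).mono ?_)
  rintro H₁ t₁ ⟨ht₁, hk₁, e₁⟩
  simp only [eval_add, eval_var, e54, e56, ep, ej] at e₁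
  refine Runs.assign_seq (by simp) ?_
  have ep₁ := hk₁.1 23 (by omega)
  simp only [eval_sub, eval_var, ep₁, ep, e₁]
  -- If `pv` does not occur any more, then `z = inf - ov`, which is beyond `hi` by `hv`; the
  -- candidate obtained from it leaves the window as well.
  set z := g.next pv j (x₀ + d + ov) - ov with hz
  have kk₁ : Keeps 53 H (H₁.set 57 z) := (hk₁.le (by omega)).set (by omega)
  have k54 : ∀ r, r = 54 ∨ r = 56 → (H₁.set 57 z).reg r = H.reg r := by
    rintro r (rfl | rfl) <;> simp [hk₁.1]
  have k57 : (H₁.set 57 z).reg 57 = z := by simp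
  generalize H₁.set 57 z = H₂ at kk₁ k54 k57 ⊢
  have hs₂ := hs.keeps kk₁ (by omega)
  have eo₂ : H₂.reg 21 = ou := by rw [kk₁.1 21 (by omega), eo]
  have hzle : z ≤ g.inf := (Nat.sub_le _ _).trans Gram.next_le
  refine Runs.seq ((runs_callNext hs₂.ctx hs₂.rowU hs₂.u_ne hs₂.u_lt hs₂.j_lt (by omega)
    (by simp; omega) (by simp; omega) (by simp)).mono ?_)
  rintro H₃ t₃ ⟨ht₃, hk₃, e₃⟩
  simp only [eval_add, eval_var, k57, eo₂, kk₁.1 24 (by omega), ej] at e₃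
  refine Runs.assign_seq (by simp) (Runs.assign_seq (by simp; omega) ?_)
  simp only [eval_var, e₃, eval_ofNat]
  set y' := g.next pu j (z + ou) with hy'
  have kk₃ : Keeps 53 H ((H₃.set 58 y').set 59 0) :=
    ((kk₁.trans (hk₃.le (by omega))).set (by omega)).set (by omega)
  have m54 : ∀ r, r = 54 ∨ r = 56 → ((H₃.set 58 y').set 59 0).reg r = H.reg r := by
    rintro r (rfl | rfl)
    · simp [hk₃.1, k54 54]
    · simp [hk₃.1, k54 56]
  have m58 : ((H₃.set 58 y').set 59 0).reg 58 = y' := by simp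
  have m59 : ((H₃.set 58 y').set 59 0).reg 59 = 0 := by simp
  generalize (H₃.set 58 y').set 59 0 = H₄ at kk₃ m54 m58 m59 ⊢
  have hs₄ := hs.keeps kk₃ (by omega)
  have eo₄ : H₄.reg 21 = ou := by rw [kk₃.1 21 (by omega), eo]
  have ep₄ : H₄.reg 23 = ov := by rw [kk₃.1 23 (by omega), ep]
  have ej₄ : H₄.reg 24 = j := by rw [kk₃.1 24 (by omega), ej]
  have ehi₄ : H₄.reg 51 = hi := by rw [kk₃.1 51 (by omega), ehi]
  obtain ⟨case₁, case₂⟩ := firstIn_common (A := fun x => g.occ pu j (x + ou))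
    (B := fun x => g.occ pv j (x + ov)) (z := z) (y := y' - ou) (inf := g.inf)
    (Gram.prog_occ hlohi) hlo h₀ h₁ hd hhi gap₀ gap
    (fun k t y a1 a2 a3 a4 a5 a6 => Gram.not_occ_between ho (by omega) a1 a2 a3 a4 a5 a6) hB₀
    (fun y h1 h2 => by
      have h3 : g.next pv j (x₀ + d + ov) ≤ y + ov := nxt_le_of (by omega) h2
      have h4 := h2.lt_inf hs.v_ne hj
      have h5 := nxt_spec (P := g.occ pv j) (x := x₀ + d + ov) (lt_of_le_of_lt h3 h4)
      change _ ≤ g.next pv j (x₀ + d + ov) ∧ g.occ pv j (g.next pv j (x₀ + d + ov)) at h5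
      refine ⟨by omega, by omega, ?_⟩
      rw [show z + ov = g.next pv j (x₀ + d + ov) by omega]
      exact h5.2)
    (fun v h1 h2 => by
      have h3 : y' ≤ v + ou := nxt_le_of (by omega) h2
      have h4 := h2.lt_inf hs.u_ne hj
      have h5 := nxt_spec (P := g.occ pu j) (x := z + ou) (lt_of_le_of_lt h3 h4)
      change _ ≤ y' ∧ g.occ pu j y' at h5
      refine ⟨by omega, by omega, ?_⟩
      rw [show y' - ou + ou = y' by omega]
      exact h5.2)
  refine Runs.seq (Runs.mono (Q := fun H₅ t => t ≤ 1050 * g.n ∧ Keeps 53 H H₅ ∧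
    (∀ r, r = 54 ∨ r = 56 → H₅.reg r = H.reg r) ∧
    ((H₅.reg 59 ≠ 0 ∧ H₅.reg 58 = y' - ou ∧ y' - ou ≤ hi ∧ g.both pu pv ou ov j (y' - ou)) ∨
      (H₅.reg 59 = 0 ∧ ¬ (y' - ou ≤ hi ∧ g.both pu pv ou ov j (y' - ou))))) ?_ ?_)
  · refine Runs.ite_lt (by simp; omega) (fun hlt => ?_) (fun hlt => ?_)
    · simp only [eval_var, eval_add, eval_ofNat, m58, ehi₄, eo₄] at hlt
      refine Runs.assign_seq (by simp) ?_
      simp only [eval_var, eval_sub, m58, eo₄]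
      have k₅ : Keeps 53 H (H₄.set 58 (y' - ou)) := kk₃.set (by omega)
      refine Runs.seq ((runs_testAt (hs.keeps k₅ (by omega)) (by omega)
        (by simp [eo₄]; omega) (by simp [ep₄]; omega)).mono ?_)
      rintro H₆ t₆ ⟨ht₆, hk₆, e₆⟩
      simp only [State.set_reg, Nat.reduceEqDiff, if_false, if_true, eo₄, ep₄, ej₄] at e₆
      refine Runs.assign (by simp) ⟨by simp; omega, (k₅.trans (hk₆.le (by omega))).set (by omega),
        ?_, ?_⟩
      · rintro r (rfl | rfl)
        · simp [hk₆.1, m54 54]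
        · simp [hk₆.1, m54 56]
      · simp only [State.set_reg, eval_var, if_true, hk₆.1 58 (by omega), Nat.reduceEqDiff,
          if_false]
        by_cases h : H₆.reg 70 = 0
        · right
          refine ⟨h, fun h' => ?_⟩
          exact e₆.2 h'.2 h
        · exact Or.inl ⟨h, trivial, by omega, e₆.1 h⟩
    · simp only [eval_var, eval_add, eval_ofNat, m58, ehi₄, eo₄] at hlt
      refine Runs.skip ⟨by simp; omega, kk₃, m54, Or.inr ⟨m59, fun h => ?_⟩⟩
      omega
  · rintro H₅ t₅ ⟨ht₅, kk₅, k5456, hcase⟩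
    have hs₅ := hs.keeps kk₅ (by omega)
    refine Runs.ite (by simp) (fun hne => ?_) (fun heq => ?_)
    · rcases hcase with ⟨-, c2, c3, c4⟩ | ⟨c1, -⟩
      · refine Runs.assign (by simp) ⟨by simp; omega, (kk₅.le (by omega)).set (by omega), ?_⟩
        simp only [State.set_reg, if_true, eval_var, c2]
        have hge : lo ≤ y' - ou := by
          by_contra hcon
          have : y' - ou < x₀ := by omega
          have h5 := nxt_spec (P := g.occ pu j) (inf := g.inf) (x := z + ou)
            (show y' < g.inf by omega)
          change z + ou ≤ y' ∧ _ at h5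
          have h6 : g.next pv j (x₀ + d + ov) < g.inf := by omega
          have h7 := nxt_spec (P := g.occ pv j) h6
          change _ ≤ g.next pv j (x₀ + d + ov) ∧ _ at h7
          omega
        exact case₁ c4.1 c4.2 hge c3
      · exact absurd c1 hne
    · rcases hcase with ⟨c1, -⟩ | ⟨-, c2⟩
      · exact absurd heq c1
      -- The last term concerns `pu` alone, so its row plays both parts in the binary search.
      · have hsU : Setup g w H₅ 20 21 20 21 pu pu :=
          { hs₅ with
            rowV := hs₅.rowU
            v_lt := hs₅.u_lt
            v_ne := hs₅.u_ne
            rv_lt := hs₅.ru_lt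
            rp_lt := hs₅.ro_lt }
        refine Runs.seq ((runs_lastOf (f := x₀) (d := d) (hi := hi) (ou := ou) (ov := ou) (j := j)
          hsU (by omega) (by omega) (by omega) (by rw [k5456 54 (by simp), e54])
          (by rw [k5456 56 (by simp), e56]) (by rw [kk₅.1 51 (by omega), ehi])
          (by rw [kk₅.1 21 (by omega), eo]) (by rw [kk₅.1 21 (by omega), eo])
          (by rw [kk₅.1 24 (by omega), ej]) hu hu (by omega) hd ⟨h₀, h₀⟩).mono ?_)
        rintro H₆ t₆ ⟨ht₆, hk₆, k, e60, c3, c4, c5⟩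
        have kk₆ : Keeps 53 H H₆ := kk₅.trans (hk₆.le (by omega))
        have eo₆ : H₆.reg 21 = ou := by rw [kk₆.1 21 (by omega), eo]
        have ep₆ : H₆.reg 23 = ov := by rw [kk₆.1 23 (by omega), ep]
        have ej₆ : H₆.reg 24 = j := by rw [kk₆.1 24 (by omega), ej]
        refine Runs.seq ((runs_testAt (hs.keeps kk₆ (by omega)) (by omega)
          (by rw [e60, eo₆]; omega) (by rw [e60, ep₆]; omega)).mono ?_)
        rintro H₇ t₇ ⟨ht₇, hk₇, e₇⟩
        rw [e60, eo₆, ep₆, ej₆] at e₇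
        have kk₇ : Keeps 53 H H₇ := kk₆.trans (hk₇.le (by omega))
        obtain ⟨y1, y2⟩ := case₂ k c3.1 c4 (fun h1 h2 => c5 h1 ⟨h2, h2⟩)
          (fun h => c2 ⟨h.2.2.2, h.1, h.2.1⟩)
        refine Runs.ite (by simp) (fun hyes => ?_) (fun hno => ?_)
        · refine Runs.assign (by simp) ⟨by simp; omega, (kk₇.le (by omega)).set (by omega), ?_⟩
          simp only [State.set_reg, if_true, eval_var, hk₇.1 60 (by omega), e60]
          exact y1 (e₇.1 hyes).2
        · refine Runs.skip ⟨by simp; omega, kk₇.le (by omega), ?_⟩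
          rw [kk₇.1 52 (by omega), e52]
          refine y2 fun h => ?_
          exact e₇.2 ⟨c3.1, h⟩ hno

end WordRAM

namespace WordRAM

open Exp

/-- The first position in `[R[50], R[51]]` where both patterns occur, into `R[52]`. The window is at
most as wide as the first pattern. -/
def firstInChunk : Program :=
  assign 52 (var 1) ;; callNext 20 (var 50 + var 21) ;; assign 53 (var 83) ;;
  ite (lt (var 53) (var 51 + var 21 + 1))
    (assign 54 (var 53 - var 21) ;; testAt 20 21 22 23 54 ;;
      ite (var 70) (assign 52 (var 54))
        (callNext 20 (var 53 + 1) ;;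
          ite (lt (var 83) (var 51 + var 21 + 1))
            (assign 56 (var 83 - var 53) ;; candidates) .skip)) .skip

/-- The first two occurrences of `pu` in the window determine its progression. With fewer than two,
or with a match at the first, the answer is immediate; otherwise the remaining candidates decide. -/
theorem runs_firstInChunk {g : Gram} {w lo hi ou ov j : ℕ} {pu pv : List ℕ}
    {H : State} (hs : Setup g w H 20 21 22 23 pu pv) (ho : Gram.Offsets pu pv ou ov)
    (eo : H.reg 21 = ou) (ep : H.reg 23 = ov) (ej : H.reg 24 = j) (elo : H.reg 50 = lo)
    (ehi : H.reg 51 = hi) (hu : hi + ou < g.inf) (hv : hi + ov < g.inf)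
    (hlo : lo ≤ 2 * g.inf) (hlohi : hi ≤ lo + pu.length) :
    Runs w firstInChunk H fun H' t => t ≤ 8000 * g.K ∧ Keeps 52 H H' ∧
      FirstIn (g.both pu pv ou ov j) lo hi g.inf (H'.reg 52) := by
  have hn := g.n_pos
  have hnK := g.n_le_K
  have hnum := hs.ctx.fits.num
  have h40 := hs.ctx.fits.two_mul
  have hj : j < g.n := ej ▸ hs.j_lt
  refine Runs.assign_seq (by simp) ?_
  simp only [eval_var, hs.ctx.inf]
  have k₀ : Keeps 52 H (H.set 52 g.inf) := (Keeps.refl _ _).set (by omega)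
  have v₀ : (H.set 52 g.inf).reg 52 = g.inf := by simp
  generalize H.set 52 g.inf = H₀ at k₀ v₀ ⊢
  have hs₀ := hs.keeps k₀ (by omega)
  have elo₀ : H₀.reg 50 = lo := by rw [k₀.1 50 (by omega), elo]
  have eo₀ : H₀.reg 21 = ou := by rw [k₀.1 21 (by omega), eo]
  refine Runs.seq ((runs_callNext hs₀.ctx hs₀.rowU hs₀.u_ne hs₀.u_lt hs₀.j_lt (by omega)
    (by simp; omega) (by simp; omega) (by simp)).mono ?_)
  rintro H₁ t₁ ⟨ht₁, hk₁, e₁⟩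
  simp only [eval_add, eval_var, elo₀, eo₀, k₀.1 24 (by omega), ej] at e₁
  refine Runs.assign_seq (by simp) ?_
  simp only [eval_var, e₁]
  set y₀ := g.next pu j (lo + ou) with hy₀
  have kk₁ : Keeps 52 H (H₁.set 53 y₀) := (k₀.trans (hk₁.le (by omega))).set (by omega)
  have v₁ : (H₁.set 53 y₀).reg 53 = y₀ := by simp
  have v₁' : (H₁.set 53 y₀).reg 52 = g.inf := by simp [hk₁.1, v₀]
  generalize H₁.set 53 y₀ = H₂ at kk₁ v₁ v₁' ⊢
  have hs₂ := hs.keeps kk₁ (by omega)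
  have eo₂ : H₂.reg 21 = ou := by rw [kk₁.1 21 (by omega), eo]
  have ep₂ : H₂.reg 23 = ov := by rw [kk₁.1 23 (by omega), ep]
  have ej₂ : H₂.reg 24 = j := by rw [kk₁.1 24 (by omega), ej]
  have ehi₂ : H₂.reg 51 = hi := by rw [kk₁.1 51 (by omega), ehi]
  refine Runs.ite_lt (by simp; omega) (fun hlt => ?_) (fun hlt => ?_)
  swap
  · simp only [eval_var, eval_add, eval_ofNat, v₁, ehi₂, eo₂] at hlt
    refine Runs.skip ⟨by simp; omega, kk₁, ?_⟩
    rw [v₁']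
    refine Or.inl ⟨rfl, fun x h1 h2 h3 => ?_⟩
    have : y₀ ≤ x + ou := nxt_le_of (by omega) h3.1
    omega
  simp only [eval_var, eval_add, eval_ofNat, v₁, ehi₂, eo₂] at hlt
  have hy₀inf : y₀ < g.inf := by omega
  have sp₀ := nxt_spec (P := g.occ pu j) (inf := g.inf) (x := lo + ou) hy₀inf
  change lo + ou ≤ y₀ ∧ g.occ pu j y₀ at sp₀
  obtain ⟨x₀, hx₀⟩ : ∃ x₀, y₀ = x₀ + ou := ⟨y₀ - ou, by omega⟩
  have gap₀ : ∀ y, lo ≤ y → y < x₀ → ¬ g.occ pu j (y + ou) := by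
    intro y h1 h2 h3
    have : y₀ ≤ y + ou := nxt_le_of (by omega) h3
    omega
  rw [hx₀] at sp₀
  refine Runs.assign_seq (by simp) ?_
  simp only [eval_var, eval_sub, v₁, eo₂, hx₀, Nat.add_sub_cancel]
  have kk₃ : Keeps 52 H (H₂.set 54 x₀) := kk₁.set (by omega)
  have v₃ : (H₂.set 54 x₀).reg 54 = x₀ := by simp
  have v₃' : (H₂.set 54 x₀).reg 53 = x₀ + ou := by simp [v₁, hx₀]
  have v₃'' : (H₂.set 54 x₀).reg 52 = g.inf := by simp [v₁']
  generalize H₂.set 54 x₀ = H₃ at kk₃ v₃ v₃' v₃'' ⊢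
  have hs₃ := hs.keeps kk₃ (by omega)
  have eo₃ : H₃.reg 21 = ou := by rw [kk₃.1 21 (by omega), eo]
  have ep₃ : H₃.reg 23 = ov := by rw [kk₃.1 23 (by omega), ep]
  have ej₃ : H₃.reg 24 = j := by rw [kk₃.1 24 (by omega), ej]
  refine Runs.seq ((runs_testAt hs₃ (by omega) (by rw [v₃, eo₃]; omega)
    (by rw [v₃, ep₃]; omega)).mono ?_)
  rintro H₄ t₄ ⟨ht₄, hk₄, e₄⟩
  rw [v₃, eo₃, ep₃, ej₃] at e₄
  have kk₄ : Keeps 52 H H₄ := kk₃.trans (hk₄.le (by omega))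
  have hs₄ := hs.keeps kk₄ (by omega)
  have eo₄ : H₄.reg 21 = ou := by rw [kk₄.1 21 (by omega), eo]
  have ej₄ : H₄.reg 24 = j := by rw [kk₄.1 24 (by omega), ej]
  have v₄ : H₄.reg 54 = x₀ := by rw [hk₄.1 54 (by omega), v₃]
  have v₄' : H₄.reg 53 = x₀ + ou := by rw [hk₄.1 53 (by omega), v₃']
  have v₄'' : H₄.reg 52 = g.inf := by rw [hk₄.1 52 (by omega), v₃'']
  refine Runs.ite (by simp) (fun hyes => ?_) (fun hno => ?_)
  · refine Runs.assign (by simp) ⟨by simp; omega, kk₄.set (by omega), ?_⟩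
    simp only [State.set_reg, if_true, eval_var, v₄]
    exact Or.inr ⟨by omega, by omega, e₄.1 hyes, fun x h1 h2 h3 => gap₀ x h1 h2 h3.1⟩
  have hB₀ : ¬ g.occ pv j (x₀ + ov) := fun h => e₄.2 ⟨sp₀.2, h⟩ hno
  refine Runs.seq ((runs_callNext hs₄.ctx hs₄.rowU hs₄.u_ne hs₄.u_lt hs₄.j_lt (by omega)
    (by simp; omega) (by simp; omega) (by simp)).mono ?_)
  rintro H₅ t₅ ⟨ht₅, hk₅, e₅⟩
  simp only [eval_add, eval_var, eval_ofNat, v₄', ej₄] at e₅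
  have kk₅ : Keeps 52 H H₅ := kk₄.trans (hk₅.le (by omega))
  have eo₅ : H₅.reg 21 = ou := by rw [kk₅.1 21 (by omega), eo]
  have ehi₅ : H₅.reg 51 = hi := by rw [kk₅.1 51 (by omega), ehi]
  have v₅' : H₅.reg 53 = x₀ + ou := by rw [hk₅.1 53 (by omega), v₄']
  have v₅'' : H₅.reg 52 = g.inf := by rw [hk₅.1 52 (by omega), v₄'']
  set y₁ := g.next pu j (x₀ + ou + 1) with hy₁
  refine Runs.ite_lt (by simp; omega) (fun hlt' => ?_) (fun hlt' => ?_)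
  swap
  · simp only [eval_var, eval_add, eval_ofNat, e₅, ehi₅, eo₅] at hlt'
    refine Runs.skip ⟨by simp; omega, kk₅, ?_⟩
    rw [v₅'']
    refine Or.inl ⟨rfl, fun x h1 h2 h3 => ?_⟩
    rcases lt_trichotomy x x₀ with h | h | h
    · exact gap₀ x h1 h h3.1
    · exact hB₀ (h ▸ h3.2)
    · have : y₁ ≤ x + ou := nxt_le_of (by omega) h3.1
      omega
  simp only [eval_var, eval_add, eval_ofNat, e₅, ehi₅, eo₅] at hlt'
  have sp₁ := nxt_spec (P := g.occ pu j) (inf := g.inf) (x := x₀ + ou + 1)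
    (show y₁ < g.inf by omega)
  change x₀ + ou + 1 ≤ y₁ ∧ g.occ pu j y₁ at sp₁
  obtain ⟨d, hd⟩ : ∃ d, y₁ = x₀ + d + ou := ⟨y₁ - ou - x₀, by omega⟩
  have gap : ∀ y, x₀ < y → y < x₀ + d → ¬ g.occ pu j (y + ou) := by
    intro y h1 h2 h3
    have : y₁ ≤ y + ou := nxt_le_of (by omega) h3
    omega
  refine Runs.assign_seq (by simp) ?_
  have kk₆ : Keeps 52 H (H₅.set 56 (eval H₅ (var 83 - var 53))) := kk₅.set (by omega)
  refine (runs_candidates (hs.keeps kk₆ (by omega)) ho (x₀ := x₀) (d := d) (lo := lo) (hi := hi)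
    (ou := ou) (ov := ov) (j := j)
    (by rw [kk₆.1 21 (by omega), eo]) (by rw [kk₆.1 23 (by omega), ep])
    (by rw [kk₆.1 24 (by omega), ej]) (by rw [kk₆.1 51 (by omega), ehi])
    (by simp [v₅'']) (by simp [hk₅.1, v₄]) (by simp [e₅, v₅']; omega) hu hv hlohi (by omega)
    sp₀.2 (hd ▸ sp₁.2) (by omega) (by omega) gap₀ gap hB₀).mono ?_
  rintro H' t ⟨ht, hk, hfirst⟩
  exact ⟨by simp; omega, kk₆.trans hk, hfirst⟩

/-- The first position in `[R[ra], R[rb]]` where both patterns occur, into `R[out]`. The window is at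
most twice as wide as the first pattern, whose length is `R[25]`. -/
def firstInWindow (ra rb out : ℕ) : Program :=
  assign 50 (var ra) ;; assign 51 (var rb) ;; assign 53 (var ra + var 25) ;; lower 51 53 ;;
  firstInChunk ;;
  ite (eq (var 52) (var 1))
    (assign 50 (var ra + var 25) ;; assign 51 (var rb) ;; firstInChunk) .skip ;;
  assign out (var 52)

theorem runs_firstInWindow {g : Gram} {w lo hi ou ov j ra rb out : ℕ} {pu pv : List ℕ}
    {H : State} (hs : Setup g w H 20 21 22 23 pu pv) (ho : Gram.Offsets pu pv ou ov)
    (eo : H.reg 21 = ou) (ep : H.reg 23 = ov) (ej : H.reg 24 = j) (el : H.reg 25 = pu.length)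
    (hra : ra < 50) (hrb : rb < 50) (elo : H.reg ra = lo)
    (ehi : H.reg rb = hi) (hu : hi + ou < g.inf) (hv : hi + ov < g.inf)
    (hlo : lo ≤ g.inf) (hlohi : hi ≤ lo + 2 * pu.length) (hul : pu.length ≤ g.inf) :
    Runs w (firstInWindow ra rb out) H fun H' t => t ≤ 17000 * g.K ∧
      (∀ r < 50, r ≠ out → H'.reg r = H.reg r) ∧ H'.mem = H.mem ∧ H'.output = H.output ∧
      FirstIn (g.both pu pv ou ov j) lo hi g.inf (H'.reg out) := by
  have hn := g.n_pos
  have hnK := g.n_le_K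
  have hnum := hs.ctx.fits.num
  have h40 := hs.ctx.fits.two_mul
  refine Runs.assign_seq (by simp; omega) (Runs.assign_seq (by simp; omega)
    (Runs.assign_seq ?_ (Runs.seq (runs_lower (by omega) (by omega) (by omega) fun t₀ ht₀ => ?_))))
  · simp
    rw [if_neg (by omega)]
    omega
  set H₀ := State.set _ 51 _ with hH₀
  have kk : Keeps 50 H H₀ :=
    ((((Keeps.refl _ _).set le_rfl).set (by omega)).set (by omega)).set (by omega)
  have v50 : H₀.reg 50 = lo := by simp [hH₀, elo]
  have v51 : H₀.reg 51 = min hi (lo + pu.length) := by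
    simp [hH₀, el, show ra ≠ 50 by omega, show ra ≠ 51 by omega, show rb ≠ 50 by omega, elo, ehi]
  generalize H₀ = H₁ at kk v50 v51
  have hs₁ := hs.keeps kk (by omega)
  refine Runs.seq ((runs_firstInChunk hs₁ ho (by rw [kk.1 21 (by omega), eo])
    (by rw [kk.1 23 (by omega), ep]) (by rw [kk.1 24 (by omega), ej]) v50 v51 (by omega)
    (by omega) (by omega) (by omega)).mono ?_)
  rintro H₂ t₂ ⟨ht₂, hk₂, f₂⟩
  have kk₂ : Keeps 50 H H₂ := kk.trans (hk₂.le (by omega))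
  have hs₂ := hs.keeps kk₂ (by omega)
  have hinf := hs₂.ctx.inf
  refine Runs.seq (Runs.mono (Q := fun H₃ t => t ≤ 8100 * g.K ∧ Keeps 50 H H₃ ∧
    FirstIn (g.both pu pv ou ov j) lo hi g.inf (H₃.reg 52)) ?_ ?_)
  · refine Runs.ite_eq (by simp; omega) (fun heq => ?_) (fun hne => ?_)
    · simp only [eval_var, hinf] at heq
      have b1 : H₂.reg ra = lo := by rw [kk₂.1 ra (by omega), elo]
      have b2 : H₂.reg rb = hi := by rw [kk₂.1 rb (by omega), ehi]
      have b3 : H₂.reg 25 = pu.length := by rw [kk₂.1 25 (by omega), el]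
      refine Runs.assign_seq (by simp; omega) (Runs.assign_seq (by simp; omega) ?_)
      simp only [eval_add, eval_var, b1, b3, State.set_reg, show rb ≠ 50 by omega, if_false, b2]
      have kk₃ : Keeps 50 H ((H₂.set 50 (lo + pu.length)).set 51 hi) :=
        (kk₂.set (by omega)).set (by omega)
      refine (runs_firstInChunk (hs.keeps kk₃ (by omega)) ho (lo := lo + pu.length) (hi := hi)
        (by rw [kk₃.1 21 (by omega), eo]) (by rw [kk₃.1 23 (by omega), ep])
        (by rw [kk₃.1 24 (by omega), ej]) (by simp) (by simp) (by omega)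
        (by omega) (by omega) (by omega)).mono ?_
      rintro H₄ t₄ ⟨ht₄, hk₄, f₄⟩
      refine ⟨by simp; omega, kk₃.trans (hk₄.le (by omega)), ?_⟩
      -- The two chunks share the position `lo + pu.length`, which the first search has already
      -- excluded.
      have none : ∀ x, lo ≤ x → x ≤ min hi (lo + pu.length) → ¬ g.both pu pv ou ov j x := by
        rcases f₂ with h | h
        · exact h.2
        · omega
      rcases f₄ with ⟨h1, h2⟩ | ⟨h1, h2, h3, h4⟩
      · refine Or.inl ⟨h1, fun x a1 a2 => ?_⟩
        by_cases h : x ≤ lo + pu.length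
        · exact none x a1 (by omega)
        · exact h2 x (by omega) a2
      · refine Or.inr ⟨by omega, h2, h3, fun x a1 a2 => ?_⟩
        by_cases h : x ≤ lo + pu.length
        · exact none x a1 (by omega)
        · exact h4 x (by omega) a2
    · simp only [eval_var, hinf] at hne
      refine Runs.skip ⟨by simp; omega, kk₂, ?_⟩
      rcases f₂ with h | ⟨h1, h2, h3, h4⟩
      · exact absurd h.1 hne
      · exact Or.inr ⟨h1, by omega, h3, h4⟩
  · rintro H₃ t₃ ⟨ht₃, hk₃, f₃⟩
    refine Runs.assign (by simp) ⟨by simp; omega, fun r hr hne => ?_, hk₃.2.1, hk₃.2.2, ?_⟩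
    · simp [hne, hk₃.1 r hr]
    · simpa using f₃

end WordRAM

/-! ## Table rows -/

/-- The first two elements fix start and difference. A term whose successor fails or leaves the
window is the last, because by `Prog.down` every later term would bring the successor with it. -/
theorem IsProg.of_prog {P : ℕ → Prop} {lo hi f d k : ℕ} (h : Prog P lo hi) (hlo : lo ≤ f)
    (h₀ : P f) (h₁ : P (f + d)) (gap₀ : ∀ y, lo ≤ y → y < f → ¬ P y)
    (gap : ∀ y, f < y → y < f + d → ¬ P y) (hd : 0 < d)
    (hk : P (f + k * d)) (hkhi : f + k * d ≤ hi)
    (hk' : f + (k + 1) * d ≤ hi → ¬ P (f + (k + 1) * d)) :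
    IsProg f d (f + k * d + 1) (fun x => lo ≤ x ∧ x ≤ hi ∧ P x) := by
  refine ⟨fun x => ⟨fun ⟨h1, h2, h3⟩ => ?_, fun ⟨h1, h2, h3⟩ => ?_⟩,
    fun _ => ⟨by omega, by omega, hk⟩⟩
  · have hfx : f ≤ x := by
      by_contra hcon
      exact gap₀ x h1 (by omega) h3
    obtain ⟨s, rfl⟩ := h.exists_eq hlo h₀ h₁ gap h3 hfx h2 hd
    have hs : s ≤ k := by
      by_contra hcon
      have h4 : (k + 1) * d ≤ s * d := Nat.mul_le_mul_right d (by omega)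
      exact hk' (by omega) (h.down hlo h₀ h₁ gap hd h3 h2 (by omega))
    have := Nat.mul_le_mul_right d hs
    exact ⟨by omega, by omega, by simp⟩
  · obtain ⟨s, hs⟩ := Nat.dvd_of_mod_eq_zero h3
    rw [mul_comm] at hs
    have hsk : s ≤ k := by
      by_contra hcon
      have h4 : (k + 1) * d ≤ s * d := Nat.mul_le_mul_right d (by omega)
      rw [Nat.add_mul] at h4
      omega
    have := h.down hlo h₀ h₁ gap hd hk hkhi hsk
    rw [show f + s * d = x by omega] at this
    exact ⟨by omega, by omega, this⟩

theorem IsProg.congr {f d e : ℕ} {C D : ℕ → Prop} (h : IsProg f d e C) (hCD : ∀ x, D x ↔ C x) :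
    IsProg f d e D :=
  ⟨fun x => (hCD x).trans (h.1 x), fun he => (hCD _).2 (h.2 he)⟩

namespace WordRAM

open Exp

/-- The concatenation of the two patterns is `pat`. -/
structure Joins (g : Gram) (pu pv : List ℕ) (ou ov : ℕ) (pat : List ℕ) : Prop where
  off : Gram.Offsets pu pv ou ov
  length : pat.length = pu.length + pv.length
  occ : ∀ j x, g.both pu pv ou ov j x ↔ g.occ pat j x

/-- Both orders of the halves are provided, so that the longer one can always be taken as the first
pattern, whose progression is followed. -/
theorem Joins.of_append {g : Gram} {pu pv : List ℕ} :
    Joins g pu pv 0 pu.length (pu ++ pv) ∧ Joins g pv pu pu.length 0 (pu ++ pv) := by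
  have key : ∀ j x, g.occ (pu ++ pv) j x ↔ g.occ pu j x ∧ g.occ pv j (x + pu.length) := by
    intro j x
    constructor
    · intro h
      refine ⟨fun k hk => ?_, fun k hk => ?_⟩
      · have := h k (by rw [List.length_append]; omega)
        simp only [List.getElem?_append_left hk] at this
        exact this
      · have := h (pu.length + k) (by rw [List.length_append]; omega)
        simp only at this
        rw [List.getElem?_append_right (by omega), Nat.add_sub_cancel_left] at this
        simp only [Nat.add_assoc, this]
    · rintro ⟨h1, h2⟩ k hk
      by_cases hlt : k < pu.length
      · simp only [List.getElem?_append_left hlt]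
        exact h1 k hlt
      · rw [List.length_append] at hk
        have := h2 (k - pu.length) (by omega)
        simp only at this ⊢
        rw [List.getElem?_append_right (by omega), ← this]
        congr 1
        omega
  constructor
  · exact ⟨Or.inl ⟨rfl, rfl⟩, List.length_append, fun j x => (key j x).symm⟩
  · refine ⟨Or.inr ⟨rfl, rfl⟩, by rw [List.length_append, add_comm], fun j x => ?_⟩
    rw [key]
    exact and_comm

/-- The crossing occurrences in the pair `R[24]` of the concatenation, whose length is `R[26]`, as a
progression in `R[40]`, `R[41]`, `R[42]`. -/
def entry : Program :=
  assign 30 (lenOf (leftOf (var 24))) ;; assign 31 (lenOf (var 24)) ;;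
  assign 40 (var 1) ;; assign 41 0 ;; assign 42 0 ;;
  ite (lt (var 31) (var 26)) .skip
    (assign 32 (var 30 + 1 - var 26) ;; assign 33 (var 30 - 1) ;; assign 34 (var 31 - var 26) ;;
      lower 33 34 ;; firstInWindow 32 33 40 ;;
      ite (lt (var 40) (var 1))
        (assign 42 (var 40 + 1) ;; assign 35 (var 40 + 1) ;; firstInWindow 35 33 36 ;;
          ite (lt (var 36) (var 1))
            (assign 41 (var 36 - var 40) ;; lastOf 20 21 22 23 40 41 33 ;; assign 42 (var 60 + 1))
            .skip)
        .skip)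

set_option maxHeartbeats 1000000 in
-- The starts of crossing occurrences form a window narrower than `pat.length`, hence no wider than
-- `2 * pu.length`, as `pu` is the longer half. Its first element, the first one after that and a
-- binary search determine the progression. No element is encoded by `e = 0`, a single one by `d =
-- 0`.
theorem runs_entry {g : Gram} {w ou ov j : ℕ} {pu pv pat : List ℕ}
    {H : State} (hs : Setup g w H 20 21 22 23 pu pv) (hjn : Joins g pu pv ou ov pat)
    (eo : H.reg 21 = ou) (ep : H.reg 23 = ov) (ej : H.reg 24 = j) (el : H.reg 25 = pu.length)
    (em : H.reg 26 = pat.length) (huv : pv.length ≤ pu.length) (hul : pu.length ≤ g.inf)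
    (hkind : g.kind j ≠ 0) :
    Runs w entry H fun H' t => t ≤ 40000 * g.K ∧ Keeps 30 H H' ∧
      IsProg (H'.reg 40) (H'.reg 41) (H'.reg 42) (g.cross pat j) ∧ H'.reg 41 ≤ g.inf ∧
      H'.reg 40 = nxt (g.cross pat j) g.inf 0 := by
  have hn := g.n_pos
  have hnK := g.n_le_K
  have hnum := hs.ctx.fits.num
  have h40 := hs.ctx.fits.two_mul
  have hmem := hs.ctx.fits.mem
  have hw1 : 1 < cap w := by omega
  have hj : j < g.n := ej ▸ hs.j_lt
  have hupos := List.length_pos_iff.2 hs.u_ne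
  have hvpos := List.length_pos_iff.2 hs.v_ne
  have hm := hjn.length
  have hou : ou ≤ pat.length ∧ ov ≤ pat.length := by
    rcases hjn.off with ⟨rfl, rfl⟩ | ⟨rfl, rfl⟩ <;> omega
  obtain ⟨hlj, hrj, -⟩ := g.pair j hj hkind
  have hln : g.l j < g.n := by omega
  have hrn : g.r j < g.n := by omega
  have hlen := g.len_pair hj hkind
  have hlpos := g.len_pos hln
  have hrpos := g.len_pos hrn
  have hlenN := g.len_le_N hj
  have hN : g.inf = g.N + 1 := rfl
  have ad1 := hs.ctx.fits.addr (i := g.n + 2) (j := g.l j) (f := 0) (by omega) hln (by omega)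
  have ad2 := hs.ctx.fits.addr (i := g.n + 2) (j := j) (f := 0) (by omega) hj (by omega)
  have ml := hs.ctx.holds.l j hj
  have m1 := hs.ctx.holds.len (g.l j) hln
  have m2 := hs.ctx.holds.len j hj
  have hn' := hs.ctx.n
  have hinf := hs.ctx.inf
  refine Runs.assign_seq (by simp [ej, ml, hn']; omega) (Runs.assign_seq (by simp [ej, hn']; omega)
    (Runs.assign_seq (by simp) (Runs.assign_seq (by simp; omega)
    (Runs.assign_seq (by simp; omega) ?_))))
  simp only [eval_lenOf, eval_leftOf, eval_var, eval_ofNat, State.set_reg, State.set_mem,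
    Nat.reduceEqDiff, if_false, ej, hn', ml, m1, m2, hinf, OfNat.zero_ne_ofNat,
    OfNat.one_ne_ofNat]
  set H₀ := State.set _ 42 0 with hH₀
  have k₀ : Keeps 30 H H₀ := (((((Keeps.refl _ _).set (by omega)).set (by omega)).set
    (by omega)).set (by omega)).set (by omega)
  have v30 : H₀.reg 30 = g.len (g.l j) := by simp [hH₀]
  have v31 : H₀.reg 31 = g.len j := by simp [hH₀]
  have v40 : H₀.reg 40 = g.inf := by simp [hH₀]
  have v41 : H₀.reg 41 = 0 := by simp [hH₀]
  have v42 : H₀.reg 42 = 0 := by simp [hH₀]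
  generalize H₀ = H₁ at k₀ v30 v31 v40 v41 v42
  have v26 : H₁.reg 26 = pat.length := by rw [k₀.1 26 (by omega), em]
  have hpne : pat ≠ [] := by
    rintro rfl
    simp at hm
    omega
  refine Runs.ite_lt (by simp [hw1]) (fun hlt => ?_) (fun hlt => ?_)
  · simp only [eval_var, v31, v26] at hlt
    have none : ∀ x, ¬ g.cross pat j x := fun x hx => by
      have := hx.2.2.le hpne
      omega
    refine Runs.skip ⟨by simp; omega, k₀, ?_, by omega, ?_⟩
    · rw [v42]
      exact ⟨fun x => by simp [none x], fun h => by omega⟩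
    · rw [v40]
      exact (nxt_eq_of le_rfl (by omega) fun y _ hy => absurd hy (none y)).symm
  simp only [eval_var, v31, v26] at hlt
  -- The window: to cross, an occurrence starts at most `pat.length - 1` before the cut and strictly
  -- before it; to fit, it ends within the string. Truncation at `0` only narrows it.
  obtain ⟨lo, hlo⟩ : ∃ lo, lo = g.len (g.l j) + 1 - pat.length := ⟨_, rfl⟩
  obtain ⟨hi, hhi⟩ : ∃ hi, hi = min (g.len (g.l j) - 1) (g.len j - pat.length) := ⟨_, rfl⟩
  have hcross : ∀ x, g.cross pat j x ↔ lo ≤ x ∧ x ≤ hi ∧ g.occ pat j x := by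
    intro x
    constructor
    · rintro ⟨h1, h2, h3⟩
      have := h3.le hpne
      exact ⟨by omega, by omega, h3⟩
    · rintro ⟨h1, h2, h3⟩
      exact ⟨by omega, by omega, h3⟩
  have hP : ∀ x, g.both pu pv ou ov j x ↔ g.occ pat j x := hjn.occ j
  have hP' : g.both pu pv ou ov j = g.occ pat j := funext fun x => propext (hP x)
  -- Here periodicity is applied to the whole concatenation, not to one half.
  have hprog : Prog (g.occ pat j) lo hi := Gram.prog_occ (ou := 0) (by omega)
  refine Runs.assign_seq (by simp; omega) (Runs.assign_seq (by simp; omega)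
    (Runs.assign_seq (by simp) (Runs.seq (runs_lower (by omega) (by omega) (by omega)
      fun t₀ ht₀ => ?_))))
  simp only [eval_var, eval_ofNat, eval_sub, eval_add, State.set_reg, Nat.reduceEqDiff, if_false,
    if_true, v30, v31, v26, ← hlo, ← hhi]
  set H₀ := State.set _ 33 hi with hH₀
  have k₂ : Keeps 30 H H₀ := (((k₀.set (by omega)).set (by omega)).set (by omega)).set (by omega)
  have v32 : H₀.reg 32 = lo := by simp [hH₀]
  have v33 : H₀.reg 33 = hi := by simp [hH₀]
  have v41 : H₀.reg 41 = 0 := by simp [hH₀, v41]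
  have v42 : H₀.reg 42 = 0 := by simp [hH₀, v42]
  generalize H₀ = H₂ at k₂ v32 v33 v41 v42
  have hs₂ := hs.keeps k₂ (by omega)
  have hu : hi + ou < g.inf := by omega
  have hv : hi + ov < g.inf := by omega
  have hlo' : lo ≤ g.inf := by omega
  have hlohi : hi ≤ lo + 2 * pu.length := by omega
  clear hlo hhi v30 v31 v26 ad1 ad2 ml m1 m2 hlen hlpos hrpos hmem hlenN hou hlt hm hvpos hlj hrj
    hln hrn hn' hinf hN em huv
  refine Runs.seq ((runs_firstInWindow hs₂ hjn.off (by rw [k₂.1 21 (by omega), eo])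
    (by rw [k₂.1 23 (by omega), ep]) (by rw [k₂.1 24 (by omega), ej])
    (by rw [k₂.1 25 (by omega), el]) (by omega) (by omega) v32 v33 hu hv hlo' hlohi hul).mono ?_)
  rintro H₃ t₃ ⟨ht₃, r₃, mem₃, out₃, f₃⟩
  have k₃ : Keeps 30 H H₃ := ⟨fun r hr => by rw [r₃ r (by omega) (by omega), k₂.1 r hr],
    by rw [mem₃, k₂.2.1], by rw [out₃, k₂.2.2]⟩
  have hs₃ := hs.keeps k₃ (by omega)
  have v33 : H₃.reg 33 = hi := by rw [r₃ 33 (by omega) (by omega), v33]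
  have v41 : H₃.reg 41 = 0 := by rw [r₃ 41 (by omega) (by omega), v41]
  have v42 : H₃.reg 42 = 0 := by rw [r₃ 42 (by omega) (by omega), v42]
  have hinf₃ := hs₃.ctx.inf
  rw [hP'] at f₃
  refine Runs.ite_lt (by simp [hw1]) (fun hlt₂ => ?_) (fun hlt₂ => ?_)
  swap
  · simp only [eval_var, hinf₃] at hlt₂
    have f₄ : H₃.reg 40 = g.inf ∧ ∀ x, lo ≤ x → x ≤ hi → ¬ g.occ pat j x := by
      rcases f₃ with h | h
      · exact h
      · omega
    have none : ∀ x, ¬ g.cross pat j x := fun x hx =>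
      f₄.2 x ((hcross x).1 hx).1 ((hcross x).1 hx).2.1 ((hcross x).1 hx).2.2
    refine Runs.skip ⟨by simp; clear * - ht₀ ht₃ hn hnK; linarith, k₃, ?_, by omega, ?_⟩
    · rw [v42]
      exact ⟨fun x => by simp [none x], fun h => by omega⟩
    · rw [f₄.1]
      exact (nxt_eq_of le_rfl (by omega) fun y _ hy => absurd hy (none y)).symm
  simp only [eval_var, hinf₃] at hlt₂
  obtain ⟨f, hf⟩ : ∃ f, f = H₃.reg 40 := ⟨_, rfl⟩
  rw [← hf] at f₃ hlt₂
  have f₄ : lo ≤ f ∧ f ≤ hi ∧ g.occ pat j f ∧ ∀ x, lo ≤ x → x < f → ¬ g.occ pat j x := by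
    rcases f₃ with h | h
    · omega
    · exact h
  obtain ⟨a1, a2, a3, a4⟩ := f₄
  have hfirst : f = nxt (g.cross pat j) g.inf 0 := by
    refine (nxt_eq_of (by omega) (fun _ => ⟨by omega, (hcross f).2 ⟨a1, a2, a3⟩⟩)
      fun y _ hy => ?_).symm
    by_contra hcon
    exact a4 y ((hcross y).1 hy).1 (by omega) ((hcross y).1 hy).2.2
  refine Runs.assign_seq (by simp; clear * - hw1 hf hlt₂ hnum; omega)
    (Runs.assign_seq (by simp; clear * - hw1 hf hlt₂ hnum; omega) ?_)
  simp only [eval_var, eval_ofNat, eval_add, State.set_reg, Nat.reduceEqDiff, if_false, ← hf]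
  set H₀ := State.set _ 35 (f + 1) with hH₀
  have k₄ : Keeps 30 H H₀ := (k₃.set (by omega)).set (by omega)
  have v35 : H₀.reg 35 = f + 1 := by simp [hH₀]
  have v33 : H₀.reg 33 = hi := by simp [hH₀, v33]
  have v41 : H₀.reg 41 = 0 := by simp [hH₀, v41]
  have v42 : H₀.reg 42 = f + 1 := by simp [hH₀]
  have v40 : H₀.reg 40 = f := by simp [hH₀, hf]
  generalize H₀ = H₄ at k₄ v35 v33 v41 v42 v40
  have hs₄ := hs.keeps k₄ (by omega)
  refine Runs.seq ((runs_firstInWindow hs₄ hjn.off (by rw [k₄.1 21 (by omega), eo])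
    (by rw [k₄.1 23 (by omega), ep]) (by rw [k₄.1 24 (by omega), ej])
    (by rw [k₄.1 25 (by omega), el]) (by omega) (by omega) v35 v33 hu hv (by clear * - a2 hu; omega)
    (by clear * - a1 hlohi; omega) hul).mono ?_)
  rintro H₅ t₅ ⟨ht₅, r₅, mem₅, out₅, f₅⟩
  have k₅ : Keeps 30 H H₅ := ⟨fun r hr => by rw [r₅ r (hr.trans (by decide)) (by rintro rfl; exact absurd hr (by decide)), k₄.1 r hr],
    by rw [mem₅, k₄.2.1], by rw [out₅, k₄.2.2]⟩
  have hs₅ := hs.keeps k₅ (by decide)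
  have v33 : H₅.reg 33 = hi := by rw [r₅ 33 (by decide) (by decide), v33]
  have v41 : H₅.reg 41 = 0 := by rw [r₅ 41 (by decide) (by decide), v41]
  have v42 : H₅.reg 42 = f + 1 := by rw [r₅ 42 (by decide) (by decide), v42]
  have v40 : H₅.reg 40 = f := by rw [r₅ 40 (by decide) (by decide), v40]
  have hinf₅ := hs₅.ctx.inf
  rw [hP'] at f₅
  refine Runs.ite_lt (by simp [hw1]) (fun hlt₃ => ?_) (fun hlt₃ => ?_)
  swap
  · simp only [eval_var, hinf₅] at hlt₃
    have f₆ : ∀ x, f + 1 ≤ x → x ≤ hi → ¬ g.occ pat j x := by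
      rcases f₅ with h | h
      · exact h.2
      · exact absurd h.2.1 (by clear * - hlt₃ hu; omega)
    refine Runs.skip ⟨by simp; clear * - ht₀ ht₃ ht₅ hn hnK; linarith, k₅, ?_, by rw [v41]; exact Nat.zero_le _, by rw [v40, hfirst]⟩
    rw [v40, v41, v42]
    -- A single crossing occurrence: the difference is `0`, and reduction modulo `0` leaves only `x
    -- = f`.
    have hcf : g.cross pat j f := (hcross f).2 ⟨a1, a2, a3⟩
    refine ⟨fun x => ⟨fun hx => ?_, fun ⟨h1, h2, _⟩ => ?_⟩, fun _ => by simpa using hcf⟩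
    · obtain ⟨h1, h2, h3⟩ := (hcross x).1 hx
      have : x = f := by
        rcases lt_trichotomy x f with h | h | h
        · exact absurd h3 (a4 x h1 h)
        · exact h
        · exact absurd h3 (f₆ x h h2)
      subst this
      simp
    · rwa [show x = f by clear * - h1 h2; omega]
  simp only [eval_var, hinf₅] at hlt₃
  obtain ⟨b1, b2, b3, b4⟩ : f + 1 ≤ H₅.reg 36 ∧ H₅.reg 36 ≤ hi ∧ g.occ pat j (H₅.reg 36) ∧
      ∀ x, f + 1 ≤ x → x < H₅.reg 36 → ¬ g.occ pat j x := by
    rcases f₅ with h | h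
    · exact absurd h.1 hlt₃.ne
    · exact h
  obtain ⟨d, hd⟩ : ∃ d, H₅.reg 36 = f + d := ⟨H₅.reg 36 - f, by clear * - b1; omega⟩
  rw [hd] at b1 b2 b3 b4
  refine Runs.assign_seq (by simp) ?_
  simp only [eval_var, eval_sub, hd, v40, Nat.add_sub_cancel_left]
  have k₆ : Keeps 30 H (H₅.set 41 d) := k₅.set (by decide)
  refine Runs.seq ((runs_lastOf (f := f) (d := d) (hi := hi) (ou := ou) (ov := ov) (j := j)
    (hs.keeps k₆ (by decide)) (by decide) (by decide) (by decide) (by simp [v40]) (by simp)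
    (by simp [v33]) (by rw [k₆.1 21 (by decide), eo]) (by rw [k₆.1 23 (by decide), ep])
    (by rw [k₆.1 24 (by decide), ej]) hu hv a2 (by clear * - b1; omega) ((hP f).2 a3)).mono ?_)
  rintro H₇ t₇ ⟨ht₇, hk₇, k, e60, c1, c2, c3⟩
  refine Runs.assign (by simp; clear * - e60 c2 hu hw1 hnum; omega) ⟨by simp; clear * - ht₀ ht₃ ht₅ ht₇ hn hnK; linarith, (k₆.trans (hk₇.le (by decide))).set
    (by decide), ?_⟩
  simp only [State.set_reg, Nat.reduceEqDiff, if_false, if_true, eval_add, eval_var, eval_ofNat,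
    e60, hk₇.1 40 (by decide), hk₇.1 41 (by decide), v40]
  rw [hP'] at c1 c3
  refine ⟨IsProg.congr (IsProg.of_prog hprog a1 a3 b3 a4 (fun y h1 h2 => b4 y h1 h2)
    (by clear * - b1; omega) c1 c2 c3) hcross, by clear * - b2 hu; omega, hfirst⟩

end WordRAM

/-! ### First occurrences in pairs and leaves -/

namespace Gram

variable {g : Gram} {pat : List ℕ} {j : ℕ}

/-- An occurrence lies on the left, crosses the cut or lies on the right; absent ones count as
`inf`, which does not affect the minimum. -/
theorem next_pair_zero (hp : pat ≠ []) (hj : j < g.n) (hk : g.kind j ≠ 0) :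
    g.next pat j 0 = min (min (nxt (g.cross pat j) g.inf 0) (g.next pat (g.l j) 0))
      (g.len (g.l j) + g.next pat (g.r j) 0) := by
  have hl := (g.pair j hj hk).1
  have hr := (g.pair j hj hk).2.1
  have a1 : g.next pat j 0 ≤ g.inf := nxt_le
  have a2 : g.next pat (g.l j) 0 ≤ g.inf := nxt_le
  have a3 : g.next pat (g.r j) 0 ≤ g.inf := nxt_le
  have a0 : nxt (g.cross pat j) g.inf 0 ≤ g.inf := nxt_le
  have a4 : g.next pat (g.l j) 0 < g.inf → g.next pat j 0 ≤ g.next pat (g.l j) 0 := fun h =>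
    nxt_le_of (Nat.zero_le _) (occ_of_left hp hj hk (nxt_spec h).2)
  have a5 : g.next pat (g.r j) 0 < g.inf →
      g.next pat j 0 ≤ g.len (g.l j) + g.next pat (g.r j) 0 := fun h =>
    nxt_le_of (Nat.zero_le _) ((occ_right hj hk).2 (nxt_spec h).2)
  have a6 : nxt (g.cross pat j) g.inf 0 < g.inf → g.next pat j 0 ≤ nxt (g.cross pat j) g.inf 0 :=
    fun h => nxt_le_of (Nat.zero_le _) (nxt_spec h).2.2.2
  have a7 : g.next pat j 0 < g.inf → g.next pat (g.l j) 0 ≤ g.next pat j 0 ∨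
      nxt (g.cross pat j) g.inf 0 ≤ g.next pat j 0 ∨
      g.len (g.l j) + g.next pat (g.r j) 0 ≤ g.next pat j 0 := by
    intro h
    have hs := nxt_spec h
    rcases occ_cases hj hk hs.2 with h1 | h1 | ⟨y, h1, h2⟩
    · exact Or.inl (nxt_le_of hs.1 h1)
    · exact Or.inr (Or.inl (nxt_le_of hs.1 h1))
    · right; right
      have : g.next pat (g.r j) 0 ≤ y := nxt_le_of (Nat.zero_le _) h2
      simp only [next] at *
      omega
  omega

theorem next_leaf_of_length (hp : 2 ≤ pat.length) (hj : j < g.n) (hk : g.kind j = 0) (x : ℕ) :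
    g.next pat j x = g.inf := by
  refine nxt_eq_of le_rfl (by omega) fun y _ hy => ?_
  have := hy.le (by rintro rfl; simp at hp)
  have := g.len_leaf hj hk
  omega

theorem not_cross_singleton (a x : ℕ) : ¬ g.cross [a] j x := fun h => by
  have h1 := h.1
  have h2 := h.2.1
  simp at h2
  omega

theorem next_leaf_singleton (a : ℕ) (hj : j < g.n) (hk : g.kind j = 0) :
    g.next [a] j 0 = if g.l j = a then 0 else g.inf := by
  have key : g.occ [a] j 0 ↔ g.l j = a := by
    simp [occ, Occ.At, g.leaf j hj hk]
  split_ifs with h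
  · exact nxt_eq_of (Nat.zero_le _) (fun _ => ⟨le_rfl, key.2 h⟩) fun _ _ _ => Nat.zero_le _
  · refine nxt_eq_of le_rfl (by omega) fun y _ hy => ?_
    have h1 := hy.le (by simp)
    rw [g.len_leaf hj hk] at h1
    simp only [List.length_singleton] at h1
    obtain rfl : y = 0 := by omega
    exact absurd (key.1 hy) h

end Gram

/-! ### Filling one row of the table -/

namespace WordRAM

open Exp

/-- The memories agree outside of the row `i`. -/
def SameOff (n i : ℕ) (m m' : ℕ → ℕ) : Prop :=
  ∀ a, (∀ j < n, ∀ f < 4, a ≠ addr n i j f) → m' a = m a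

theorem SameOff.trans {n i : ℕ} {m m' m'' : ℕ → ℕ} (h : SameOff n i m m')
    (h' : SameOff n i m' m'') : SameOff n i m m'' :=
  fun a ha => (h' a ha).trans (h a ha)

theorem SameOff.addr {n i i' j f : ℕ} {m m' : ℕ → ℕ} (h : SameOff n i m m') (hi : i' ≠ i)
    (hj : j < n) (hf : f < 4) : m' (addr n i' j f) = m (addr n i' j f) :=
  h _ fun _ hj' _ hf' he => hi ((addr_inj hj hj' hf hf').1 he).1

theorem SameOff.input {n i a : ℕ} {m m' : ℕ → ℕ} (h : SameOff n i m m') (ha : a < 3 * n + 1) :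
    m' a = m a :=
  h _ fun _ _ _ _ he => by simp only [WordRAM.addr] at he; omega

theorem EntryOk.congr {g : Gram} {m m' : ℕ → ℕ} {i j : ℕ} {pat : List ℕ}
    (h : EntryOk g m i pat j) (hm : ∀ f < 4, m' (addr g.n i j f) = m (addr g.n i j f)) :
    EntryOk g m' i pat j := by
  refine ⟨fun hk => ?_, ?_, ?_⟩
  · rw [hm 0 (by omega), hm 1 (by omega), hm 2 (by omega)]; exact h.prog hk
  · rw [hm 1 (by omega)]; exact h.diff
  · rw [hm 3 (by omega)]; exact h.first

theorem RowOk.sameOff {g : Gram} {m m' : ℕ → ℕ} {i i' : ℕ} {pat : List ℕ}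
    (h : RowOk g m i' pat) (hm : SameOff g.n i m m') (hi : i' ≠ i) : RowOk g m' i' pat :=
  fun j hj => (h j hj).congr fun _ hf => hm.addr hi hj hf

theorem Holds.sameOff {g : Gram} {m m' : ℕ → ℕ} {i : ℕ}
    (h : Holds g m) (hm : SameOff g.n i m m') (hi : i < g.n + 2) : Holds g m' where
  kind j hj := by rw [hm.input (by omega)]; exact h.kind j hj
  l j hj := by rw [hm.input (by omega)]; exact h.l j hj
  r j hj := by rw [hm.input (by omega)]; exact h.r j hj
  len j hj := by rw [hm.addr (by omega) hj (by omega)]; exact h.len j hj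

/-- Fill the row `R[27]`, where `B` computes the entry `R[24]` into `R[40]`, `R[41]`, `R[42]`,
`R[44]`. -/
def rowLoop (B : Program) : Program :=
  assign 24 0 ;;
  while_ (lt (var 24) (var 0))
    (B ;; write (cellAddr (var 27) (var 24) 0) (var 40) ;;
      write (cellAddr (var 27) (var 24) 1) (var 41) ;;
      write (cellAddr (var 27) (var 24) 2) (var 42) ;;
      write (cellAddr (var 27) (var 24) 3) (var 44) ;;
      assign 24 (var 24 + 1))

/-- A state inside the loop over a row. -/
structure InRow (g : Gram) (i : ℕ) (pat : List ℕ) (H H' : State) : Prop where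
  reg : ∀ r < 30, r ≠ 24 → H'.reg r = H.reg r
  output : H'.output = H.output
  mem : SameOff g.n i H.mem H'.mem
  entries : ∀ j < H'.reg 24, EntryOk g H'.mem i pat j

/-- Entries are filled in increasing order, so the entries of both parts of a pair are complete when
its own is computed. `B` may rely on this through `InRow`. -/
theorem runs_rowLoop {g : Gram} {w i c : ℕ} {pat : List ℕ} {B : Program} {H : State}
    (hc : Ctx g w H) (hi : i < g.n + 2) (h27 : H.reg 27 = i)
    (hB : ∀ H', InRow g i pat H H' → H'.reg 24 < g.n → Runs w B H' fun H'' t => t ≤ c ∧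
      Keeps 30 H' H'' ∧ (g.kind (H'.reg 24) ≠ 0 →
        IsProg (H''.reg 40) (H''.reg 41) (H''.reg 42) (g.cross pat (H'.reg 24))) ∧
      H''.reg 41 ≤ g.inf ∧ H''.reg 44 = g.next pat (H'.reg 24) 0) :
    Runs w (rowLoop B) H fun H' t => t ≤ g.n * (c + 120) + 20 ∧
      (∀ r < 30, r ≠ 24 → H'.reg r = H.reg r) ∧ H'.output = H.output ∧
      SameOff g.n i H.mem H'.mem ∧ RowOk g H'.mem i pat := by
  have hnum := hc.fits.num
  have h40 := hc.fits.two_mul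
  have hmem := hc.fits.mem
  refine Runs.assign_seq (by simp; omega) ?_
  refine (Runs.while_le (fun k H' => InRow g i pat H H' ∧ H'.reg 24 + k = g.n) (c + 110) ?_ ?_ g.n
    ?_).mono ?_
  · rintro k H' -
    simp
    omega
  · rintro k H' ⟨hin, hk⟩ hne
    have hn : H'.reg 0 = g.n := by rw [hin.reg 0 (by omega) (by omega), hc.n]
    have hj : H'.reg 24 < g.n := by
      by_contra hcon
      refine hne (if_neg ?_)
      simpa [hn] using hcon
    refine Runs.seq ((hB H' hin hj).mono ?_)
    rintro H₁ t₁ ⟨ht₁, hk₁, hprog, hdiff, hfirst⟩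
    have v24 := hk₁.1 24 (by omega)
    have v27 : H₁.reg 27 = i := by rw [hk₁.1 27 (by omega), hin.reg 27 (by omega) (by omega), h27]
    have v0 : H₁.reg 0 = g.n := by rw [hk₁.1 0 (by omega), hn]
    obtain ⟨j, ej⟩ : ∃ j, j = H'.reg 24 := ⟨_, rfl⟩
    rw [← ej] at hj v24 hprog hfirst hk
    have ad : ∀ f < 4, addr g.n i j f < cap w := fun f hf => hc.fits.addr (by omega) hj hf
    have ad0 := ad 0 (by omega)
    have ad1 := ad 1 (by omega)
    have ad2 := ad 2 (by omega)
    have ad3 := ad 3 (by omega)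
    refine Runs.seq (Runs.write (by simp [v0, v24, v27]; omega) (by simp) ?_)
    refine Runs.seq (Runs.write (by simp [v0, v24, v27]; omega) (by simp) ?_)
    refine Runs.seq (Runs.write (by simp [v0, v24, v27]; omega) (by simp) ?_)
    refine Runs.seq (Runs.write (by simp [v0, v24, v27]; omega) (by simp) ?_)
    refine Runs.assign (by simp [v24]; omega) ⟨by simp; linarith, k - 1, by omega, ?_, ?_⟩
    · have val : ∀ f f', addr g.n i j f = addr g.n i j f' ↔ f = f' := by simp [addr]
      refine ⟨fun r hr hne => ?_, ?_, ?_, ?_⟩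
      · simp only [State.set_reg, State.put_reg, hne, if_false, hk₁.1 r hr]
        exact hin.reg r hr hne
      · simp only [State.set_output, State.put_output]
        rw [hk₁.2.2, hin.output]
      · refine hin.mem.trans fun a ha => ?_
        simp only [State.set_mem, State.put_mem, State.put_reg, eval_cellAddr, eval_var, v0, v24,
          v27, if_neg (ha j hj 0 (by omega)), if_neg (ha j hj 1 (by omega)),
          if_neg (ha j hj 2 (by omega)), if_neg (ha j hj 3 (by omega)), hk₁.2.1]
      · intro j' hj'
        simp only [State.set_reg, if_true, eval_add, eval_var, State.put_reg, eval_ofNat, v24]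
          at hj'
        rcases Nat.lt_succ_iff_lt_or_eq.1 hj' with hlt | rfl
        · refine (hin.entries j' (by omega)).congr fun f hf => ?_
          have hne : ∀ f' < 4, addr g.n i j' f ≠ addr g.n i j f' := fun f' hf' he =>
            hlt.ne ((addr_inj (by omega) hj hf hf').1 he).2.1
          simp only [State.set_mem, State.put_mem, State.put_reg, eval_cellAddr, eval_var, v0,
            v24, v27, if_neg (hne 0 (by omega)), if_neg (hne 1 (by omega)),
            if_neg (hne 2 (by omega)), if_neg (hne 3 (by omega)), hk₁.2.1]
        · constructor
          · simpa [v0, v24, v27, val] using hprog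
          · simpa [v0, v24, v27, val] using hdiff
          · simpa [v0, v24, v27, val] using hfirst
    · simp [v24]
      omega
  · refine ⟨⟨fun r hr hne => by simp [hne], rfl, fun _ _ => rfl, fun j hj => ?_⟩, by simp⟩
    simp at hj
  · rintro H' t ⟨ht, hz, k, hin, hk⟩
    have hn : H'.reg 0 = g.n := by rw [hin.reg 0 (by omega) (by omega), hc.n]
    have hj : g.n ≤ H'.reg 24 := by
      by_contra hcon
      have hlt : H'.reg 24 < H'.reg 0 := by omega
      exact absurd (hz.symm.trans (if_pos hlt)) zero_ne_one
    refine ⟨?_, hin.reg, hin.output, hin.mem, fun j hj' => hin.entries j (by omega)⟩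
    simp at ht ⊢
    have e : g.n * (c + 110 + 5 + 1) ≤ g.n * (c + 120) := Nat.mul_le_mul_left _ (by omega)
    linarith

/-- The first occurrence in the pair `R[24]`, into `R[44]`, from the first crossing one in
`R[40]`. -/
def foldFirst : Program :=
  assign 44 (var 40) ;; assign 43 (cell (var 27) (leftOf (var 24)) 3) ;; lower 44 43 ;;
  assign 43 (lenOf (leftOf (var 24)) + cell (var 27) (rightOf (var 24)) 3) ;; lower 44 43

theorem runs_foldFirst {g : Gram} {w i j : ℕ} {pat : List ℕ} {H : State}
    (hc : Ctx g w H) (hi : i < g.n + 2) (h27 : H.reg 27 = i) (h24 : H.reg 24 = j)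
    (hj : j < g.n) (hkind : g.kind j ≠ 0) (hp : pat ≠ [])
    (hent : ∀ j' < j, EntryOk g H.mem i pat j')
    (h40 : H.reg 40 = nxt (g.cross pat j) g.inf 0) :
    Runs w foldFirst H fun H' t => t ≤ 150 ∧ Keeps 43 H H' ∧ H'.reg 44 = g.next pat j 0 := by
  obtain ⟨hlj, hrj, -⟩ := g.pair j hj hkind
  have hln : g.l j < g.n := by omega
  have hrn : g.r j < g.n := by omega
  have ad1 := hc.fits.addr (i := i) (j := g.l j) (f := 3) (by omega) hln (by omega)
  have ad2 := hc.fits.addr (i := i) (j := g.r j) (f := 3) (by omega) hrn (by omega)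
  have ad3 := hc.fits.addr (i := g.n + 2) (j := g.l j) (f := 0) (by omega) hln (by omega)
  have ml := hc.holds.l j hj
  have mr := hc.holds.r j hj
  have mlen := hc.holds.len (g.l j) hln
  have ml3 := (hent _ hlj).first
  have mr3 := (hent _ hrj).first
  have hlenN := g.len_le_N hln
  have hN : g.inf = g.N + 1 := rfl
  have hle : g.next pat (g.r j) 0 ≤ g.inf := Gram.next_le
  have hn := hc.n
  have hnum := hc.fits.num
  have hw := hc.fits.two_mul
  have hmem := hc.fits.mem
  refine Runs.assign_seq (by simp) (Runs.assign_seq (by simp [*]; omega)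
    (Runs.seq (runs_lower (by omega) (by omega) (by omega) fun t₁ ht₁ => ?_)))
  refine Runs.assign_seq (by simp [*]; omega)
    (runs_lower (by omega) (by omega) (by omega) fun t₂ ht₂ => ?_)
  refine ⟨by simp; linarith, ?_, ?_⟩
  · exact (((((Keeps.refl _ _).set (by omega)).set (by omega)).set (by omega)).set
      (by omega)).set (by omega)
  · rw [Gram.next_pair_zero hp hj hkind]
    simp [*]

/-- The entry for the concatenation of two patterns. -/
def pairBody : Program :=
  ite (kindOf (var 24)) (entry ;; foldFirst) (assign 41 0 ;; assign 44 (var 1))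

/-- The entry for the letter of the variable `R[27]`. -/
def letterBody : Program :=
  assign 40 (var 1) ;; assign 41 0 ;; assign 42 0 ;;
  ite (kindOf (var 24)) foldFirst
    (ite (eq (leftOf (var 24)) (leftOf (var 27))) (assign 44 0) (assign 44 (var 1)))

/-- A single letter cannot cross a cut: every progression is empty, and only the first occurrences
need work. -/
theorem runs_letterRow {g : Gram} {w i : ℕ} {H : State} (hc : Ctx g w H) (hi : i < g.n)
    (hkind : g.kind i = 0) (h27 : H.reg 27 = i) :
    Runs w (rowLoop letterBody) H fun H' t => t ≤ 400 * g.n ∧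
      (∀ r < 30, r ≠ 24 → H'.reg r = H.reg r) ∧ H'.output = H.output ∧
      SameOff g.n i H.mem H'.mem ∧ RowOk g H'.mem i (g.val i) := by
  have hnum := hc.fits.num
  have hw := hc.fits.two_mul
  have hmem := hc.fits.mem
  have hnpos := g.n_pos
  rw [g.leaf i hi hkind]
  refine (runs_rowLoop (c := 250) (pat := [g.l i]) hc (by omega) h27 ?_).mono ?_
  · intro H' hin hj
    have hc' : Ctx g w H' := ⟨hc.fits, by rw [hin.reg 0 (by omega) (by omega), hc.n],
      by rw [hin.reg 1 (by omega) (by omega), hc.inf], hc.holds.sameOff hin.mem (by omega)⟩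
    have v27 : H'.reg 27 = i := by rw [hin.reg 27 (by omega) (by omega), h27]
    refine Runs.assign_seq (by simp) (Runs.assign_seq (by simp; omega)
      (Runs.assign_seq (by simp; omega) ?_))
    simp only [eval_var, eval_ofNat, hc'.inf]
    set H₀ := State.set _ 42 0 with hH₀
    have k₀ : Keeps 30 H' H₀ := (((Keeps.refl _ _).set (by omega)).set (by omega)).set (by omega)
    have v40 : H₀.reg 40 = g.inf := by simp [hH₀]
    have v41 : H₀.reg 41 = 0 := by simp [hH₀]
    have v42 : H₀.reg 42 = 0 := by simp [hH₀]
    generalize H₀ = H₁ at k₀ v40 v41 v42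
    have hc₁ := hc'.keeps k₀ (by omega)
    have v24 := k₀.1 24 (by omega)
    have v27 : H₁.reg 27 = i := by rw [k₀.1 27 (by omega), v27]
    have hent := hin.entries
    generalize H'.reg 24 = j at *
    have hk := hc₁.holds.kind j hj
    have hl := hc₁.holds.l j hj
    have hl' := hc₁.holds.l i hi
    have hprog : IsProg g.inf 0 0 (g.cross [g.l i] j) :=
      ⟨fun x => by simp [Gram.not_cross_singleton], fun h => by omega⟩
    refine Runs.ite (by simp; omega) (fun hne => ?_) (fun hz => ?_)
    · have hkind' : g.kind j ≠ 0 := by simpa [v24, hk] using hne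
      refine (runs_foldFirst (i := i) (pat := [g.l i]) hc₁ (by omega) v27 v24 hj hkind' (by simp)
        (fun j' hj' => by rw [k₀.2.1]; exact hent j' hj') ?_).mono ?_
      · rw [v40]
        exact (nxt_eq_of le_rfl (by omega) fun y _ hy =>
          absurd hy (Gram.not_cross_singleton _ _)).symm
      · rintro H₂ t ⟨ht, hk₂, e⟩
        refine ⟨by simp; linarith, k₀.trans (hk₂.le (by omega)), fun _ => ?_, ?_, e⟩
        · rw [hk₂.1 40 (by omega), hk₂.1 41 (by omega), hk₂.1 42 (by omega), v40, v41, v42]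
          exact hprog
        · rw [hk₂.1 41 (by omega), v41]
          omega
    · have hkind' : g.kind j = 0 := by simpa [v24, hk] using hz
      have key := Gram.next_leaf_singleton (g.l i) hj hkind'
      refine Runs.ite_eq (by simp; omega) (fun heq => ?_) (fun hne => ?_)
      · simp only [eval_leftOf, eval_var, v24, v27, hl, hl'] at heq
        refine Runs.assign (by simp; omega) ⟨by simp, k₀.set (by omega),
          fun h => absurd hkind' h, by simp [v41], ?_⟩
        simp [key, heq]
      · simp only [eval_leftOf, eval_var, v24, v27, hl, hl'] at hne
        refine Runs.assign (by simp) ⟨by simp, k₀.set (by omega),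
          fun h => absurd hkind' h, by simp [v41], ?_⟩
        simp [key, hne, hc₁.inf]
  · rintro H' t ⟨ht, h⟩
    refine ⟨by linarith, h⟩

/-- The row `R[27]` for the concatenation of the patterns of the rows `R[28]` and `R[29]`, whose
lengths are `R[18]` and `R[19]`. -/
def joinRow : Program :=
  assign 26 (var 18 + var 19) ;;
  ite (lt (var 18) (var 19))
    (assign 20 (var 29) ;; assign 21 (var 18) ;; assign 22 (var 28) ;; assign 23 0 ;;
      assign 25 (var 19))
    (assign 20 (var 28) ;; assign 21 0 ;; assign 22 (var 29) ;; assign 23 (var 18) ;;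
      assign 25 (var 18)) ;;
  rowLoop pairBody

/-- Register `24` is the loop counter and is set when the loop starts; `Setup` is stated with the
value `0` to have a valid variable there. The written row must differ from both rows that are read.
-/
theorem runs_pairRow {g : Gram} {w i ou ov : ℕ} {pu pv pat : List ℕ} {H : State}
    (hs : Setup g w (H.set 24 0) 20 21 22 23 pu pv) (hjn : Joins g pu pv ou ov pat)
    (eo : H.reg 21 = ou) (ep : H.reg 23 = ov) (el : H.reg 25 = pu.length)
    (em : H.reg 26 = pat.length) (huv : pv.length ≤ pu.length) (hul : pu.length ≤ g.inf)
    (hi : i < g.n + 2) (h27 : H.reg 27 = i) (hu : H.reg 20 ≠ i) (hv : H.reg 22 ≠ i) :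
    Runs w (rowLoop pairBody) H fun H' t => t ≤ 41000 * (g.n * g.K) ∧
      (∀ r < 30, r ≠ 24 → H'.reg r = H.reg r) ∧ H'.output = H.output ∧
      SameOff g.n i H.mem H'.mem ∧ RowOk g H'.mem i pat := by
  have hc : Ctx g w H := ⟨hs.ctx.fits, by simpa using hs.ctx.n, by simpa using hs.ctx.inf,
    hs.ctx.holds⟩
  have hnum := hc.fits.num
  have hw := hc.fits.two_mul
  have hmem := hc.fits.mem
  have hnpos := g.n_pos
  have hnK := g.n_le_K
  have hupos := List.length_pos_iff.2 hs.u_ne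
  have hvpos := List.length_pos_iff.2 hs.v_ne
  have hm := hjn.length
  refine (runs_rowLoop (c := 40000 * g.K + 200) (pat := pat) hc hi h27 ?_).mono ?_
  · intro H' hin hj
    have hs' : Setup g w H' 20 21 22 23 pu pv :=
      { ctx := ⟨hc.fits, by rw [hin.reg 0 (by omega) (by omega), hc.n],
          by rw [hin.reg 1 (by omega) (by omega), hc.inf], hc.holds.sameOff hin.mem (by omega)⟩
        rowU := by
          rw [hin.reg 20 (by omega) (by omega)]
          exact RowOk.sameOff (by simpa using hs.rowU) hin.mem hu
        rowV := by
          rw [hin.reg 22 (by omega) (by omega)]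
          exact RowOk.sameOff (by simpa using hs.rowV) hin.mem hv
        u_lt := by rw [hin.reg 20 (by omega) (by omega)]; simpa using hs.u_lt
        v_lt := by rw [hin.reg 22 (by omega) (by omega)]; simpa using hs.v_lt
        u_ne := hs.u_ne
        v_ne := hs.v_ne
        j_lt := hj
        ru_lt := by omega
        ro_lt := by omega
        rv_lt := by omega
        rp_lt := by omega }
    have hk := hs'.ctx.holds.kind _ hj
    refine Runs.ite (by simp; omega) (fun hne => ?_) (fun hz => ?_)
    · have hkind : g.kind (H'.reg 24) ≠ 0 := by simpa [hk] using hne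
      refine Runs.seq ((runs_entry hs' hjn (by rw [hin.reg 21 (by omega) (by omega), eo])
        (by rw [hin.reg 23 (by omega) (by omega), ep]) rfl
        (by rw [hin.reg 25 (by omega) (by omega), el])
        (by rw [hin.reg 26 (by omega) (by omega), em]) huv hul hkind).mono ?_)
      rintro H₁ t₁ ⟨ht₁, hk₁, p1, p2, p3⟩
      refine (runs_foldFirst (i := i) (pat := pat) (hs'.ctx.keeps hk₁ (by omega)) (by omega)
        (by rw [hk₁.1 27 (by omega), hin.reg 27 (by omega) (by omega), h27])
        (hk₁.1 24 (by omega)) hj hkind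
        (by rintro rfl; simp at hm; omega)
        (fun j' hj' => by rw [hk₁.2.1]; exact hin.entries j' hj') p3).mono ?_
      rintro H₂ t₂ ⟨ht₂, hk₂, e⟩
      refine ⟨by simp; linarith, hk₁.trans (hk₂.le (by omega)), fun _ => ?_, ?_, e⟩
      · rw [hk₂.1 40 (by omega), hk₂.1 41 (by omega), hk₂.1 42 (by omega)]
        exact p1
      · rw [hk₂.1 41 (by omega)]
        exact p2
    · have hkind : g.kind (H'.reg 24) = 0 := by simpa [hk] using hz
      refine Runs.assign_seq (by simp; omega) (Runs.assign (by simp) ⟨by simp,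
        ((Keeps.refl _ _).set (by omega)).set (by omega), fun h => absurd hkind h, by simp, ?_⟩)
      -- A concatenation of nonempty patterns has at least two letters and does not occur in a leaf.
      rw [Gram.next_leaf_of_length (by omega) hj hkind]
      simp [hs'.ctx.inf]
  · rintro H' t ⟨ht, h⟩
    refine ⟨?_, h⟩
    have e1 : g.n * 1 ≤ g.n * g.K := Nat.mul_le_mul_left _ (by omega)
    have e2 : g.n * (40000 * g.K + 200 + 120) = 40000 * (g.n * g.K) + 320 * g.n := by ring
    linarith

theorem runs_joinRow {g : Gram} {w i : ℕ} {pa pb : List ℕ} {H : State} (hc : Ctx g w H)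
    (hi : i < g.n + 2) (h27 : H.reg 27 = i)
    (ha : RowOk g H.mem (H.reg 28) pa) (hb : RowOk g H.mem (H.reg 29) pb)
    (ha' : H.reg 28 < g.n + 2) (hb' : H.reg 29 < g.n + 2) (hai : H.reg 28 ≠ i)
    (hbi : H.reg 29 ≠ i) (hpa : pa ≠ []) (hpb : pb ≠ []) (la : H.reg 18 = pa.length)
    (lb : H.reg 19 = pb.length) (la' : pa.length ≤ g.inf) (lb' : pb.length ≤ g.inf) :
    Runs w joinRow H fun H' t => t ≤ 42000 * (g.n * g.K) ∧
      (∀ r < 30, r < 20 ∨ 27 ≤ r → H'.reg r = H.reg r) ∧ H'.output = H.output ∧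
      SameOff g.n i H.mem H'.mem ∧ RowOk g H'.mem i (pa ++ pb) := by
  have hnum := hc.fits.num
  have hw := hc.fits.two_mul
  have hnK := g.n_le_K
  have hnpos := g.n_pos
  have hKK : 1 ≤ g.n * g.K := Nat.mul_pos hnpos (by omega)
  obtain ⟨j1, j2⟩ := Joins.of_append (g := g) (pu := pa) (pv := pb)
  refine Runs.assign_seq (by simp; omega) (Runs.seq (Runs.ite_lt (by simp; omega)
    (fun hlt => ?_) (fun hlt => ?_)))
  · simp only [eval_var, State.set_reg, Nat.reduceEqDiff, if_false, la, lb] at hlt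
    refine Runs.assign_seq (by simp) (Runs.assign_seq (by simp) (Runs.assign_seq (by simp)
      (Runs.assign_seq (by simp; omega) (Runs.assign (by simp) ?_))))
    refine (runs_pairRow (i := i) (pu := pb) (pv := pa) (pat := pa ++ pb) ?_ j2 (by simp [la])
      (by simp) (by simp [lb]) (by simp [la, lb]) hlt.le lb' hi (by simp [h27])
      (by simpa using hbi) (by simpa using hai)).mono ?_
    · exact ⟨⟨hc.fits, by simpa using hc.n, by simpa using hc.inf, hc.holds⟩, by simpa using hb,
        by simpa using ha, by simpa using hb', by simpa using ha', hpb, hpa, by simpa using hnpos,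
        by omega, by omega, by omega, by omega⟩
    · rintro H' t ⟨ht, hr, ho, hm, hrow⟩
      refine ⟨by simp; linarith, fun r hr1 hr2 => ?_, ho, hm, hrow⟩
      rw [hr r hr1 (by omega)]
      simp [show r ≠ 20 by omega, show r ≠ 21 by omega, show r ≠ 22 by omega,
        show r ≠ 23 by omega, show r ≠ 25 by omega, show r ≠ 26 by omega]
  · simp only [eval_var, State.set_reg, Nat.reduceEqDiff, if_false, la, lb] at hlt
    refine Runs.assign_seq (by simp) (Runs.assign_seq (by simp; omega) (Runs.assign_seq (by simp)
      (Runs.assign_seq (by simp) (Runs.assign (by simp) ?_))))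
    refine (runs_pairRow (i := i) (pu := pa) (pv := pb) (pat := pa ++ pb) ?_ j1 (by simp)
      (by simp [la]) (by simp [la]) (by simp [la, lb]) hlt la' hi (by simp [h27])
      (by simpa using hai) (by simpa using hbi)).mono ?_
    · exact ⟨⟨hc.fits, by simpa using hc.n, by simpa using hc.inf, hc.holds⟩, by simpa using ha,
        by simpa using hb, by simpa using ha', by simpa using hb', hpa, hpb, by simpa using hnpos,
        by omega, by omega, by omega, by omega⟩
    · rintro H' t ⟨ht, hr, ho, hm, hrow⟩
      refine ⟨by simp; linarith, fun r hr1 hr2 => ?_, ho, hm, hrow⟩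
      rw [hr r hr1 (by omega)]
      simp [show r ≠ 20 by omega, show r ≠ 21 by omega, show r ≠ 22 by omega,
        show r ≠ 23 by omega, show r ≠ 25 by omega, show r ≠ 26 by omega]

end WordRAM

/-! ### The rows of all variables -/

namespace WordRAM

open Exp

theorem Ctx.of_sameOff {g : Gram} {w i : ℕ} {H H' : State} (hc : Ctx g w H)
    (h0 : H'.reg 0 = H.reg 0) (h1 : H'.reg 1 = H.reg 1) (hm : SameOff g.n i H.mem H'.mem)
    (hi : i < g.n + 2) : Ctx g w H' :=
  ⟨hc.fits, h0.trans hc.n, h1.trans hc.inf, hc.holds.sameOff hm hi⟩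

theorem Ctx.set {g : Gram} {w r x : ℕ} {H : State} (hc : Ctx g w H) (hr : 2 ≤ r) :
    Ctx g w (H.set r x) :=
  hc.keeps ((Keeps.refl 2 H).set hr) le_rfl

/-- The rows of all variables. -/
def allRows : Program :=
  assign 27 0 ;;
  while_ (lt (var 27) (var 0))
    (ite (kindOf (var 27))
      (assign 28 (leftOf (var 27)) ;; assign 29 (rightOf (var 27)) ;;
        assign 18 (lenOf (var 28)) ;; assign 19 (lenOf (var 29)) ;; joinRow)
      (rowLoop letterBody) ;;
    assign 27 (var 27 + 1))

/-- The string of a pair is the concatenation of the strings of two earlier variables, whose rows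
are complete already. -/
theorem runs_varRow {g : Gram} {w i : ℕ} {H : State} (hc : Ctx g w H) (hi : i < g.n)
    (h27 : H.reg 27 = i) (hrows : ∀ i' < i, RowOk g H.mem i' (g.val i')) :
    Runs w (ite (kindOf (var 27))
      (assign 28 (leftOf (var 27)) ;; assign 29 (rightOf (var 27)) ;;
        assign 18 (lenOf (var 28)) ;; assign 19 (lenOf (var 29)) ;; joinRow)
      (rowLoop letterBody)) H fun H' t => t ≤ 42200 * (g.n * g.K) ∧
      (∀ r < 18, H'.reg r = H.reg r) ∧ H'.reg 27 = i ∧ H'.output = H.output ∧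
      SameOff g.n i H.mem H'.mem ∧ RowOk g H'.mem i (g.val i) := by
  have hnum := hc.fits.num
  have hw := hc.fits.two_mul
  have hmem := hc.fits.mem
  have hnK := g.n_le_K
  have hnpos := g.n_pos
  have hn := hc.n
  have hKK : g.n * 1 ≤ g.n * g.K := Nat.mul_le_mul_left _ (by omega)
  have hk := hc.holds.kind i hi
  refine Runs.ite (by simp; omega) (fun hne => ?_) (fun hz => ?_)
  · have hkind : g.kind i ≠ 0 := by simpa [h27, hk] using hne
    obtain ⟨hl, hr, hval⟩ := g.pair i hi hkind
    have hln : g.l i < g.n := by omega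
    have hrn : g.r i < g.n := by omega
    have ml := hc.holds.l i hi
    have mr := hc.holds.r i hi
    have mll := hc.holds.len _ hln
    have mlr := hc.holds.len _ hrn
    have ad1 := hc.fits.addr (i := g.n + 2) (j := g.l i) (f := 0) (by omega) hln (by omega)
    have ad2 := hc.fits.addr (i := g.n + 2) (j := g.r i) (f := 0) (by omega) hrn (by omega)
    have hN : g.inf = g.N + 1 := rfl
    have hl' := g.len_le_N hln
    have hr' := g.len_le_N hrn
    have hlp := g.len_pos hln
    have hrp := g.len_pos hrn
    refine Runs.assign_seq (by simp; omega) (Runs.assign_seq (by simp; omega)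
      (Runs.assign_seq (by simp [h27, hn, ml]; omega)
      (Runs.assign_seq (by simp [h27, hn, mr]; omega) ?_)))
    refine (runs_joinRow (i := i) (pa := g.val (g.l i)) (pb := g.val (g.r i))
      ((((hc.set (by omega)).set (by omega)).set (by omega)).set (by omega)) (by omega)
      (by simpa using h27)
      ?_ ?_ ?_ ?_ ?_ ?_ (List.length_pos_iff.1 hlp) (List.length_pos_iff.1 hrp) ?_ ?_
      (by simp only [Gram.len] at hl'; omega) (by simp only [Gram.len] at hr'; omega)).mono ?_
    · simpa [h27, ml] using hrows _ hl
    · simpa [h27, mr] using hrows _ hr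
    · simp [h27, ml]; omega
    · simp [h27, mr]; omega
    · simp [h27, ml]; omega
    · simp [h27, mr]; omega
    · simp [h27, ml, hn, mll, Gram.len]
    · simp [h27, mr, hn, mlr, Gram.len]
    · rintro H' t ⟨ht, hreg, ho, hm, hrow⟩
      refine ⟨by simp; linarith, fun r hr => ?_, ?_, ho, hm, by rwa [hval]⟩
      · rw [hreg r (by omega) (by omega)]
        simp [show r ≠ 18 by omega, show r ≠ 19 by omega, show r ≠ 28 by omega,
          show r ≠ 29 by omega]
      · rw [hreg 27 (by omega) (by omega)]
        simpa using h27
  · have hkind : g.kind i = 0 := by simpa [h27, hk] using hz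
    refine (runs_letterRow hc hi hkind h27).mono ?_
    rintro H' t ⟨ht, hreg, ho, hm, hrow⟩
    refine ⟨by simp; linarith, fun r hr => hreg r (by omega) (by omega), ?_, ho, hm, hrow⟩
    rw [hreg 27 (by omega) (by omega), h27]

theorem runs_allRows {g : Gram} {w : ℕ} {H : State} (hc : Ctx g w H) :
    Runs w allRows H fun H' t => t ≤ 43000 * (g.n * (g.n * g.K)) ∧
      (∀ r < 18, H'.reg r = H.reg r) ∧ H'.output = H.output ∧ Ctx g w H' ∧
      ∀ i < g.n, RowOk g H'.mem i (g.val i) := by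
  have hnum := hc.fits.num
  have hw := hc.fits.two_mul
  have hmem := hc.fits.mem
  have hnK := g.n_le_K
  have hnpos := g.n_pos
  have hKK : g.n * 1 ≤ g.n * g.K := Nat.mul_le_mul_left _ (by omega)
  refine Runs.assign_seq (by simp; omega) ?_
  refine (Runs.while_le (fun k H' => H'.reg 27 + k = g.n ∧ (∀ r < 18, H'.reg r = H.reg r) ∧
    H'.output = H.output ∧ Ctx g w H' ∧ ∀ i < H'.reg 27, RowOk g H'.mem i (g.val i))
    (42200 * (g.n * g.K) + 10) ?_ ?_ g.n ?_).mono ?_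
  · rintro k H' -
    simp
    omega
  · rintro k H' ⟨hk, hreg, ho, hc', hrows⟩ hne
    have hj : H'.reg 27 < g.n := by
      by_contra hcon
      refine hne (if_neg ?_)
      simpa [hc'.n] using hcon
    refine Runs.seq ((runs_varRow hc' hj rfl hrows).mono ?_)
    rintro H₁ t₁ ⟨ht₁, hreg₁, h27, ho₁, hm, hrow⟩
    refine Runs.assign (by simp; omega) ⟨by simp; linarith, k - 1, by omega, ?_, fun r hr => ?_,
      ?_, ?_, ?_⟩
    · simp; omega
    · simp [show r ≠ 27 by omega, hreg₁ r hr, hreg r hr]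
    · simp [ho₁, ho]
    · exact (hc'.of_sameOff (hreg₁ 0 (by omega)) (hreg₁ 1 (by omega)) hm (by omega)).set
        (by omega)
    · intro i hi
      simp only [State.set_reg, if_true, eval_add, eval_var, eval_ofNat, h27] at hi
      rcases Nat.lt_succ_iff_lt_or_eq.1 hi with hlt | rfl
      · exact (hrows i hlt).sameOff hm hlt.ne
      · exact hrow
  · refine ⟨by simp, fun r hr => by simp [show r ≠ 27 by omega], rfl,
      hc.set (by omega), fun i hi => ?_⟩
    simp at hi
  · rintro H' t ⟨ht, hz, k, hk, hreg, ho, hc', hrows⟩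
    have hj : g.n ≤ H'.reg 27 := by
      by_contra hcon
      have hlt : H'.reg 27 < H'.reg 0 := by rw [hc'.n]; omega
      exact absurd (hz.symm.trans (if_pos hlt)) zero_ne_one
    refine ⟨?_, hreg, ho, hc', fun i hi => hrows i (by omega)⟩
    simp at ht ⊢
    have e1 : g.n * (42200 * (g.n * g.K) + 10 + 5 + 1)
      = 42200 * (g.n * (g.n * g.K)) + 16 * g.n := by ring
    have e2 : g.n * g.n ≤ g.n * (g.n * g.K) := Nat.mul_le_mul_left _ (by omega)
    have e3 : g.n * 1 ≤ g.n * g.n := Nat.mul_le_mul_left _ (by omega)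
    linarith

end WordRAM

/-! ### Earlier occurrences of substrings of the text -/

namespace Gram

/-- The substring of the text of length `L` at the position `p`. -/
def piece (g : Gram) (p L : ℕ) : List ℕ := ((g.val (g.n - 1)).drop p).take L

/-- The earlier occurrence of a factor of length `L` at `p` may start at `q`. -/
def Near (sr : Bool) (p q L : ℕ) : Prop := if sr then q < p else q + L ≤ p

/-- The substring of length `L` at `p` has an earlier occurrence. -/
def Earlier (g : Gram) (sr : Bool) (p L : ℕ) : Prop :=
  ∃ q, g.occ (g.piece p L) (g.n - 1) q ∧ Near sr p q L

/-- The concatenation of the strings of some variables. -/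
def concat (g : Gram) (zs : List ℕ) : List ℕ := (zs.map g.val).flatten

variable {g : Gram} {sr : Bool} {p q L : ℕ}

theorem length_piece (h : p + L ≤ g.N) : (g.piece p L).length = L := by
  simp only [N, len] at h
  simp [piece]
  omega

theorem Near.mono {q' L' : ℕ} (h : Near sr p q L) (hq : q' ≤ q) (hL : L' ≤ L) :
    Near sr p q' L' := by
  unfold Near at *
  split_ifs at * <;> omega

/-- A prefix of an occurrence is an occurrence of the prefix, and shortening preserves `Near`. This
is what makes greedy extension correct. -/
theorem Earlier.mono {L' : ℕ} (h : g.Earlier sr p L) (hL : L' ≤ L) : g.Earlier sr p L' := by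
  obtain ⟨q, hq, hn⟩ := h
  refine ⟨q, fun k hk => ?_, hn.mono le_rfl hL⟩
  have hk' : k < L' ∧ k < (g.val (g.n - 1)).length - p := by simpa [piece] using hk
  have := hq k (by simp [piece]; omega)
  simp only [piece] at this ⊢
  rw [List.getElem?_take_of_lt (by omega)] at this ⊢
  exact this

/-- `Near` is preserved when the position decreases, so only the first occurrence in the whole text
has to be inspected. The value `inf` is never near. -/
theorem near_next_iff (hL : 0 < L) (h : p + L ≤ g.N) :
    Near sr p (g.next (g.piece p L) (g.n - 1) 0) L ↔ g.Earlier sr p L := by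
  constructor
  · intro hn
    refine ⟨_, (nxt_spec (P := g.occ (g.piece p L) (g.n - 1)) ?_).2, hn⟩
    have hi : g.inf = g.N + 1 := rfl
    unfold Near next at *
    split_ifs at * <;> omega
  · rintro ⟨q, hq, hn⟩
    exact hn.mono (nxt_le_of (Nat.zero_le _) hq) le_rfl

theorem occ_next_of_near (hL : 0 < L) (h : p + L ≤ g.N)
    (hn : Near sr p (g.next (g.piece p L) (g.n - 1) 0) L) :
    g.occ (g.piece p L) (g.n - 1) (g.next (g.piece p L) (g.n - 1) 0) := by
  refine (nxt_spec (P := g.occ (g.piece p L) (g.n - 1)) ?_).2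
  have hi : g.inf = g.N + 1 := rfl
  unfold Near next at *
  split_ifs at * <;> omega

theorem piece_append {z : ℕ} {rest : List ℕ} (hd : (g.val (g.n - 1)).drop (p + L) = g.val z ++ rest) :
    g.piece p L ++ g.val z = g.piece p (L + g.len z) := by
  rw [piece, piece, List.take_add, List.drop_drop, hd, len, List.take_left]

end Gram

/-! ### The search for one factor -/

namespace WordRAM

open Exp

/-- The stack holds the variables `zs`, its top first. -/
def Stack (g : Gram) (mem : ℕ → ℕ) : List ℕ → Prop
  | [] => True
  | z :: zs => mem (addr g.n (g.n + 2) zs.length 2) = z ∧ z < g.n ∧ Stack g mem zs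

theorem Stack.congr {g : Gram} {m m' : ℕ → ℕ} {zs : List ℕ} (h : Stack g m zs)
    (hm : ∀ k < zs.length, m' (addr g.n (g.n + 2) k 2) = m (addr g.n (g.n + 2) k 2)) :
    Stack g m' zs := by
  induction zs with
  | nil => trivial
  | cons z zs ih =>
    refine ⟨(hm _ (by simp)).trans h.1, h.2.1, ih h.2.2 fun k hk => hm k ?_⟩
    simp only [List.length_cons]
    omega

theorem Stack.put {g : Gram} {H : State} {k x : ℕ} {zs : List ℕ} (h : Stack g H.mem zs)
    (hk : zs.length ≤ k) (hkn : k < g.n) :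
    Stack g (H.put (addr g.n (g.n + 2) k 2) x).mem zs := by
  refine h.congr fun k' hk' => ?_
  rw [State.put_mem, if_neg]
  rw [addr_inj (by omega) hkn (by omega) (by omega)]
  omega

/-- All rows of variables are available; the next factor starts at `p`. -/
structure Ready (g : Gram) (w p : ℕ) (out : List ℕ) (H : State) : Prop where
  ctx : Ctx g w H
  rows : ∀ i < g.n, RowOk g H.mem i (g.val i)
  pos : H.reg 4 = p
  output : H.output = out

theorem Ready.set {g : Gram} {w p r x : ℕ} {out : List ℕ} {H : State} (h : Ready g w p out H)
    (hr : 5 ≤ r) : Ready g w p out (H.set r x) :=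
  ⟨h.ctx.set (by omega), h.rows, by simp [show 4 ≠ r by omega, h.pos], h.output⟩

theorem Holds.put {g : Gram} {H : State} {k x : ℕ} (h : Holds g H.mem) (hk : k < g.n) :
    Holds g (H.put (addr g.n (g.n + 2) k 2) x).mem where
  kind j hj := by
    rw [State.put_mem, if_neg (by simp only [addr]; omega)]; exact h.kind j hj
  l j hj := by
    rw [State.put_mem, if_neg (by simp only [addr]; omega)]; exact h.l j hj
  r j hj := by
    rw [State.put_mem, if_neg (by simp only [addr]; omega)]; exact h.r j hj
  len j hj := by
    rw [State.put_mem, if_neg]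
    · exact h.len j hj
    · rw [addr_inj hj hk (by omega) (by omega)]; omega

theorem RowOk.put {g : Gram} {H : State} {i k x : ℕ} {pat : List ℕ} (h : RowOk g H.mem i pat)
    (hi : i < g.n + 2) (hk : k < g.n) :
    RowOk g (H.put (addr g.n (g.n + 2) k 2) x).mem i pat := by
  refine fun j hj => (h j hj).congr fun f hf => ?_
  rw [State.put_mem, if_neg]
  rw [addr_inj hj hk (by omega) (by omega)]
  omega

theorem Ready.put {g : Gram} {w p k x : ℕ} {out : List ℕ} {H : State} (h : Ready g w p out H)
    (hk : k < g.n) : Ready g w p out (H.put (addr g.n (g.n + 2) k 2) x) :=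
  ⟨⟨h.ctx.fits, h.ctx.n, h.ctx.inf, h.ctx.holds.put hk⟩,
    fun i hi => (h.rows i hi).put (by omega) hk, h.pos, h.output⟩

/-- Find the leaf `R[5]` at the position `R[4]`, and stack the variables to the right of the path;
`R[7]` is the height of the stack. -/
def descend : Program :=
  assign 5 (var 0 - 1) ;; assign 6 (var 4) ;; assign 7 0 ;;
  while_ (kindOf (var 5))
    (assign 15 (leftOf (var 5)) ;; assign 16 (lenOf (var 15)) ;;
      ite (lt (var 6) (var 16))
        (write (cellAddr (var 0 + 2) (var 7) 2) (rightOf (var 5)) ;;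
          assign 7 (var 7 + 1) ;; assign 5 (var 15))
        (assign 6 (var 6 - var 16) ;; assign 5 (rightOf (var 5))))

/-- Every step to the left stacks the right part; in the end the text from `p` on is spelled by the
leaf and the stack. -/
theorem runs_descend {g : Gram} {w p : ℕ} {out : List ℕ} {H : State} (hr : Ready g w p out H)
    (hp : p < g.N) :
    Runs w descend H fun H' t => t ≤ 200 * g.n ∧ Ready g w p out H' ∧ H'.reg 5 < g.n ∧
      g.kind (H'.reg 5) = 0 ∧ ∃ zs, H'.reg 7 = zs.length ∧ Stack g H'.mem zs ∧ zs.length ≤ g.n ∧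
      (g.val (g.n - 1)).drop p = g.val (H'.reg 5) ++ g.concat zs := by
  have hnum := hr.ctx.fits.num
  have hw := hr.ctx.fits.two_mul
  have hmem := hr.ctx.fits.mem
  have hnpos := g.n_pos
  refine Runs.assign_seq (by simp; omega) (Runs.assign_seq (by simp) (Runs.assign_seq
    (by simp; omega) ?_))
  -- `k + zs.length + 1 ≤ g.n` holds because each push comes with a smaller variable; so the stack
  -- fits into one row.
  refine (Runs.while_le (fun k H' => H'.reg 5 = k ∧ Ready g w p out H' ∧ H'.reg 6 < g.len k ∧
    ∃ zs, H'.reg 7 = zs.length ∧ Stack g H'.mem zs ∧ k + zs.length + 1 ≤ g.n ∧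
      (g.val (g.n - 1)).drop p = (g.val k).drop (H'.reg 6) ++ g.concat zs)
    150 ?_ ?_ (g.n - 1) ?_).mono ?_
  · rintro k H' ⟨hk, hr', -, zs, -, -, hkn, -⟩
    simp [hk]
    omega
  · rintro k H' ⟨hk, hr', hx, zs, h7, hst, hkn, hd⟩ hne
    have hc := hr'.ctx
    have hn := hc.n
    have mk := hc.holds.kind k (by omega)
    have ml := hc.holds.l k (by omega)
    have mr := hc.holds.r k (by omega)
    have hkind : g.kind k ≠ 0 := by simpa [hk, mk] using hne
    obtain ⟨hl, hrk, hval⟩ := g.pair k (by omega) hkind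
    have mll := hc.holds.len (g.l k) (by omega)
    have hlen := g.len_pair (by omega) hkind
    have ad1 := hc.fits.addr (i := g.n + 2) (j := g.l k) (f := 0) (by omega) (by omega) (by omega)
    have ad2 := hc.fits.addr (i := g.n + 2) (j := zs.length) (f := 2) (by omega) (by omega)
      (by omega)
    refine Runs.assign_seq (by simp; omega) (Runs.assign_seq (by simp [hk, ml, hn]; omega) ?_)
    simp only [eval_leftOf, eval_lenOf, eval_var, State.set_reg, State.set_mem, Nat.reduceEqDiff,
      if_false, if_true, hk, hn, ml, mll]
    refine Runs.ite_lt (by simp; omega) (fun hlt => ?_) (fun hlt => ?_)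
    · replace hlt : H'.reg 6 < g.len (g.l k) := by simpa using hlt
      refine Runs.seq (Runs.write (by simp [h7, hn]; omega) (by simp [hk]; omega) ?_)
      refine Runs.assign_seq (by simp; omega) (Runs.assign (by simp)
        ⟨by simp, g.l k, hl, ?_, ?_, ?_, g.r k :: zs, ?_, ?_, ?_, ?_⟩)
      · simp
      · simp only [eval_cellAddr, eval_add, eval_var, eval_ofNat, State.set_reg, Nat.reduceEqDiff,
          if_false, hn, h7]
        exact ((((hr'.set (by omega)).set (by omega)).put (by omega)).set (by omega)).set
          (by omega)
      · simpa using hlt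
      · simp [h7]
      · refine ⟨?_, by omega, ?_⟩
        · simp [hn, h7, hk, mr]
        · simp only [eval_cellAddr, eval_add, eval_var, eval_ofNat, State.set_reg,
            Nat.reduceEqDiff, if_false, hn, h7]
          exact Stack.put (H := (H'.set 15 (g.l k)).set 16 (g.len (g.l k))) hst le_rfl (by omega)
      · simp only [List.length_cons]
        omega
      · rw [hd, hval, List.drop_append_of_le_length (by simp only [Gram.len] at hlt; omega)]
        simp [Gram.concat]
    · replace hlt : g.len (g.l k) ≤ H'.reg 6 := by simpa using hlt
      refine Runs.assign_seq (by simp) (Runs.assign (by simp [hk]; omega)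
        ⟨by simp, g.r k, hrk, ?_, ?_, ?_, zs, ?_, hst, by omega, ?_⟩)
      · simp [hk, mr]
      · exact (((hr'.set (by omega)).set (by omega)).set (by omega)).set (by omega)
      · simp
        omega
      · simpa using h7
      · rw [hd, hval, List.drop_append, List.drop_eq_nil_of_le (by simpa [Gram.len] using hlt)]
        simp [Gram.len]
  · refine ⟨by simp [hr.ctx.n], ((hr.set (by omega)).set (by omega)).set (by omega), ?_, [],
      by simp, trivial, by simp; omega, ?_⟩
    · simpa [hr.pos, Gram.N] using hp
    · simp [hr.pos, Gram.concat]
  · rintro H' t ⟨ht, hz, k, hk, hr', hx, zs, h7, hst, hkn, hd⟩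
    have mk := hr'.ctx.holds.kind k (by omega)
    have hkind : g.kind k = 0 := by simpa [hk, mk] using hz
    rw [g.len_leaf (by omega) hkind] at hx
    obtain hx : H'.reg 6 = 0 := by omega
    refine ⟨?_, hr', by omega, by rwa [hk], zs, h7, hst, by omega, by simpa [hx, hk] using hd⟩
    simp at ht ⊢
    omega

/-- May the occurrence at `R[13]` of a factor of length `R[14]` be used? -/
def nearTest : Bool → Exp
  | true => lt (var 13) (var 4)
  | false => lt (var 13 + var 14) (var 4 + 1)

/-- Try to extend the factor, of length `R[10]` with the row `R[8]`, by the variable on top of the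
stack. After a failure, go on with the parts of this variable. -/
def tryExtend (sr : Bool) : Program :=
  assign 7 (var 7 - 1) ;; assign 12 (cell (var 0 + 2) (var 7) 2) ;;
  assign 27 (var 9) ;; assign 28 (var 8) ;; assign 29 (var 12) ;;
  assign 18 (var 10) ;; assign 19 (lenOf (var 12)) ;;
  joinRow ;;
  assign 13 (cell (var 9) (var 0 - 1) 3) ;; assign 14 (var 10 + var 19) ;;
  ite (nearTest sr)
    (assign 8 (var 9) ;; assign 9 (2 * var 0 + 1 - var 9) ;; assign 10 (var 14) ;;
      assign 11 (var 13))
    (ite (kindOf (var 12))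
      (write (cellAddr (var 0 + 2) 0 2) (rightOf (var 12)) ;;
        write (cellAddr (var 0 + 2) 1 2) (leftOf (var 12)) ;; assign 7 2)
      (assign 7 0))

/-- The state during the extension of the factor at `p`, with the stack `zs`. -/
structure Extending (g : Gram) (sr : Bool) (w p c : ℕ) (out zs : List ℕ) (H : State) : Prop where
  ready : Ready g w p out H
  leafVar : H.reg 5 = c
  height : H.reg 7 = zs.length
  stack : Stack g H.mem zs
  height_le : zs.length ≤ g.n
  row_lt : H.reg 8 < g.n + 2
  free : H.reg 9 = g.n ∨ H.reg 9 = g.n + 1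
  row_ne : H.reg 8 ≠ H.reg 9
  len_pos : 1 ≤ H.reg 10
  len_le : p + H.reg 10 ≤ g.N
  row : RowOk g H.mem (H.reg 8) (g.piece p (H.reg 10))
  found : H.reg 10 = 1 ∨ g.occ (g.piece p (H.reg 10)) (g.n - 1) (H.reg 11) ∧
    Gram.Near sr p (H.reg 11) (H.reg 10)
  rest : ∃ tail, (g.val (g.n - 1)).drop (p + H.reg 10) = g.concat zs ++ tail ∧
    (tail = [] ∨ ¬ g.Earlier sr p (H.reg 10 + (g.concat zs).length) ∨
      zs = [] ∧ ¬ g.Earlier sr p (H.reg 10 + 1))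

theorem runs_nearTest {w p : ℕ} {sr : Bool} {H : State} {P Q : Program}
    {Φ : State → ℕ → Prop} (h4 : H.reg 4 = p) (hw : 1 < cap w) (hp : p + 1 < cap w)
    (hq : H.reg 13 + H.reg 14 < cap w)
    (hP : Gram.Near sr p (H.reg 13) (H.reg 14) → ∀ t₀ ≤ 11, Runs w P H fun H' t => Φ H' (t₀ + t))
    (hQ : ¬ Gram.Near sr p (H.reg 13) (H.reg 14) → ∀ t₀ ≤ 11,
      Runs w Q H fun H' t => Φ H' (t₀ + t)) :
    Runs w (ite (nearTest sr) P Q) H Φ := by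
  cases sr
  · refine Runs.ite_lt (by simp; omega) (fun hlt => ?_) (fun hlt => ?_)
    · refine hP ?_ _ (by simp)
      simp [Gram.Near] at hlt ⊢
      omega
    · refine hQ ?_ _ (by simp)
      simp [Gram.Near] at hlt ⊢
      omega
  · refine Runs.ite_lt (by simp; omega) (fun hlt => ?_) (fun hlt => ?_)
    · refine hP ?_ _ (by simp)
      simp [Gram.Near] at hlt ⊢
      omega
    · refine hQ ?_ _ (by simp)
      simp [Gram.Near] at hlt ⊢
      omega

/-- After a failure with `z`, no extension reaching beyond `z` can succeed, by `Earlier.mono`. The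
older stack is therefore forgotten, and the failure is recorded in `rest` for the two parts of `z`,
which spell the same string. The alternative for `zs'` is what the count of trials needs. -/
theorem runs_tryExtend {g : Gram} {sr : Bool} {w p c z : ℕ} {out zs : List ℕ} {H : State}
    (he : Extending g sr w p c out (z :: zs) H) :
    Runs w (tryExtend sr) H fun H' t => t ≤ 43000 * (g.n * g.K) ∧
      ∃ zs', Extending g sr w p c out zs' H' ∧
        (zs' = zs ∨ zs'.length ≤ 2 ∧ ∀ y ∈ zs', y < z) := by
  have hc := he.ready.ctx
  have hnum := hc.fits.num
  have hw := hc.fits.two_mul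
  have hmem := hc.fits.mem
  have hnK := g.n_le_K
  have hnpos := g.n_pos
  have hKK : 1 ≤ g.n * g.K := Nat.mul_pos hnpos (by omega)
  have hn := hc.n
  obtain ⟨mz, hz, hst⟩ := he.stack
  have h7 := he.height
  have hzn := he.height_le
  simp only [List.length_cons] at h7 hzn
  obtain ⟨tail, hd, hcases⟩ := he.rest
  have hconcat : g.concat (z :: zs) = g.val z ++ g.concat zs := by simp [Gram.concat]
  rw [hconcat, List.append_assoc] at hd
  have hL := he.len_pos
  have hpL := he.len_le
  have hzpos := g.len_pos hz
  have hsum : p + (H.reg 10 + g.len z) ≤ g.N := by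
    have := congrArg List.length hd
    simp only [List.length_drop, List.length_append] at this
    simp only [Gram.N, Gram.len] at *
    omega
  have hpiece := Gram.piece_append hd
  have hlenV := Gram.length_piece hpL
  have hN : g.inf = g.N + 1 := rfl
  have mlz := hc.holds.len z hz
  have ad1 := hc.fits.addr (i := g.n + 2) (j := zs.length) (f := 2) (by omega) (by omega)
    (by omega)
  have ad2 := hc.fits.addr (i := g.n + 2) (j := z) (f := 0) (by omega) hz (by omega)
  refine Runs.assign_seq (by simp; omega) (Runs.assign_seq (by simp [h7, hn]; omega)
    (Runs.assign_seq (by simp) (Runs.assign_seq (by simp) (Runs.assign_seq (by simp)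
    (Runs.assign_seq (by simp) (Runs.assign_seq (by simp [h7, hn, mz]; omega) ?_))))))
  simp only [eval_cell, eval_sub, eval_add, eval_lenOf, eval_var, eval_ofNat, State.set_reg,
    State.set_mem, Nat.reduceEqDiff, if_false, if_true, hn, h7, Nat.add_sub_cancel, mz, mlz]
  set H₀ := State.set _ 19 (g.len z) with hH₀
  have hr₀ : Ready g w p out H₀ := ((((((he.ready.set (by omega)).set (by omega)).set
    (by omega)).set (by omega)).set (by omega)).set (by omega)).set (by omega)
  have hm₀ : H₀.mem = H.mem := rfl
  have r5 : H₀.reg 5 = c := by simp [hH₀, he.leafVar]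
  have r7 : H₀.reg 7 = zs.length := by simp [hH₀]
  have r8 : H₀.reg 8 = H.reg 8 := by simp [hH₀]
  have r9 : H₀.reg 9 = H.reg 9 := by simp [hH₀]
  have r10 : H₀.reg 10 = H.reg 10 := by simp [hH₀]
  have r11 : H₀.reg 11 = H.reg 11 := by simp [hH₀]
  have r12 : H₀.reg 12 = z := by simp [hH₀]
  have r18 : H₀.reg 18 = H.reg 10 := by simp [hH₀]
  have r19 : H₀.reg 19 = g.len z := by simp [hH₀]
  have r27 : H₀.reg 27 = H.reg 9 := by simp [hH₀]
  have r28 : H₀.reg 28 = H.reg 8 := by simp [hH₀]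
  have r29 : H₀.reg 29 = z := by simp [hH₀]
  generalize H₀ = H₁ at hr₀ hm₀ r5 r7 r8 r9 r10 r11 r12 r18 r19 r27 r28 r29
  have hfree := he.free
  have hrow := he.row
  refine Runs.seq ((runs_joinRow (i := H.reg 9) (pa := g.piece p (H.reg 10)) (pb := g.val z)
    hr₀.ctx (by omega) r27 (by rw [hm₀, r28]; exact hrow) (by rw [r29]; exact hr₀.rows z hz)
    (by rw [r28]; exact he.row_lt) (by omega) (by rw [r28]; exact he.row_ne) (by omega)
    (List.length_pos_iff.1 (by omega)) (List.length_pos_iff.1 hzpos) (by omega) r19 (by omega)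
    (by have := g.len_le_N hz; simp only [Gram.len] at this; omega)).mono ?_)
  rintro H₂ t₂ ⟨ht₂, hreg, ho, hoff, hrow₂⟩
  rw [hpiece] at hrow₂
  have hr₂ : Ready g w p out H₂ :=
    ⟨hr₀.ctx.of_sameOff (hreg 0 (by omega) (by omega)) (hreg 1 (by omega) (by omega)) hoff
      (by omega), fun i hi => (hr₀.rows i hi).sameOff hoff (by omega),
      (hreg 4 (by omega) (by omega)).trans hr₀.pos, ho.trans hr₀.output⟩
  have hst₂ : Stack g H₂.mem zs := hst.congr fun k hk => by
    rw [hoff.addr (by omega) (by omega) (by omega), hm₀]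
  have hrowV : RowOk g H₂.mem (H.reg 8) (g.piece p (H.reg 10)) :=
    RowOk.sameOff (by rwa [hm₀]) hoff he.row_ne
  rw [← hreg 5 (by omega) (by omega)] at r5
  rw [← hreg 7 (by omega) (by omega)] at r7
  rw [← hreg 8 (by omega) (by omega)] at r8
  rw [← hreg 9 (by omega) (by omega)] at r9
  rw [← hreg 10 (by omega) (by omega)] at r10
  rw [← hreg 11 (by omega) (by omega)] at r11
  rw [← hreg 12 (by omega) (by omega)] at r12
  rw [← hreg 19 (by omega) (by omega)] at r19
  clear hreg ho hoff r18 r27 r28 r29 hm₀ hr₀ H₁ hst mlz mz h7 hn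
  have hn := hr₂.ctx.n
  have mfirst := (hrow₂ (g.n - 1) (by omega)).first
  have ad3 := hc.fits.addr (i := H.reg 9) (j := g.n - 1) (f := 3) (by omega) (by omega) (by omega)
  have ad4 := hc.fits.addr (i := g.n + 2) (j := 0) (f := 2) (by omega) (by omega) (by omega)
  refine Runs.assign_seq (by simp [r9, hn]; omega) (Runs.assign_seq (by simp; omega) ?_)
  simp only [eval_cell, eval_add, eval_sub, eval_var, eval_ofNat, State.set_reg,
    Nat.reduceEqDiff, if_false, hn, r9, r10, r19, mfirst]
  have hqle : g.next (g.piece p (H.reg 10 + g.len z)) (g.n - 1) 0 ≤ g.inf := Gram.next_le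
  generalize hq : g.next (g.piece p (H.reg 10 + g.len z)) (g.n - 1) 0 = q at hqle
  refine runs_nearTest (p := p) (by simpa using hr₂.pos) (by omega) (by omega)
    (by simp; omega) (fun hnear t₀ ht₀ => ?_) (fun hnear t₀ ht₀ => ?_)
  · replace hnear : Gram.Near sr p q (H.reg 10 + g.len z) := by simpa using hnear
    -- `2n + 1 - R[9]` exchanges the work rows `n` and `n + 1`. The rows of variables are never
    -- overwritten, not even the leaf's row, with which the factor starts.
    refine Runs.assign_seq (by simp) (Runs.assign_seq (by simp [hn]; omega)
      (Runs.assign_seq (by simp) (Runs.assign (by simp) ⟨by simp; linarith, zs, ?_, Or.inl rfl⟩)))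
    constructor
    · exact (((((hr₂.set (by omega)).set (by omega)).set (by omega)).set (by omega)).set
        (by omega)).set (by omega)
    · simpa using r5
    · simpa using r7
    · exact hst₂
    · omega
    · simp [r9]; omega
    · simp [r9, hn]; omega
    · simp [r9, hn]; omega
    · simp; omega
    · simpa using hsum
    · simpa [r9] using hrow₂
    · right
      subst hq
      simpa using ⟨Gram.occ_next_of_near (by omega) hsum hnear, hnear⟩
    · refine ⟨tail, ?_, ?_⟩
      · have := congrArg (List.drop (g.len z)) hd
        rw [List.drop_drop, Gram.len, List.drop_left] at this
        simp only [eval_var, State.set_reg, Nat.reduceEqDiff, if_false, if_true]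
        rw [← this]
        congr 1
        simp only [Gram.len]
        omega
      · simp only [eval_var, State.set_reg, Nat.reduceEqDiff, if_false, if_true]
        rcases hcases with h | h | h
        · exact Or.inl h
        · right; left
          rw [hconcat, List.length_append] at h
          rwa [Nat.add_assoc]
        · simp at h
  · replace hnear : ¬ Gram.Near sr p q (H.reg 10 + g.len z) := by simpa using hnear
    have hno : ¬ g.Earlier sr p (H.reg 10 + g.len z) := by
      rwa [← Gram.near_next_iff (by omega) hsum, hq]
    have mk := hr₂.ctx.holds.kind z hz
    have ml := hr₂.ctx.holds.l z hz
    have mr := hr₂.ctx.holds.r z hz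
    refine Runs.ite (by simp; omega) (fun hne => ?_) (fun hze => ?_)
    · have hkind : g.kind z ≠ 0 := by simpa [r12, mk] using hne
      obtain ⟨hl, hr, hval⟩ := g.pair z hz hkind
      have ad5 := hc.fits.addr (i := g.n + 2) (j := 1) (f := 2) (by omega) (by omega) (by omega)
      have i1 : 2 + 3 * z ≠ addr g.n (g.n + 2) 0 2 := by simp only [addr]; omega
      have i2 : addr g.n (g.n + 2) 0 2 ≠ addr g.n (g.n + 2) 1 2 := by simp only [addr]; omega
      refine Runs.seq (Runs.write (by simp [hn]; omega) (by simp [r12]; omega) ?_)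
      refine Runs.seq (Runs.write (by simp [hn]; omega) (by simp [r12]; omega) ?_)
      simp only [eval_cellAddr, eval_add, eval_var, eval_ofNat, eval_rightOf, eval_leftOf,
        State.set_reg, State.set_mem, State.put_reg, State.put_mem, Nat.reduceEqDiff, if_false,
        hn, r12, mr, ml, if_neg i1]
      refine Runs.assign (by simp; omega) ⟨by simp; linarith, [g.l z, g.r z], ?_,
        Or.inr ⟨by simp, by simp [hl, hr]⟩⟩
      have hcat : g.concat [g.l z, g.r z] = g.val z := by simp [Gram.concat, hval]
      constructor
      · exact ((((hr₂.set (by omega)).set (by omega)).put (by omega)).put (by omega)).set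
          (by omega)
      · simpa using r5
      · simp
      · exact ⟨by simp, by omega, by simp [i2], by omega, trivial⟩
      · simp; omega
      · simp [r8]; exact he.row_lt
      · simpa [r9] using hfree
      · simp [r8, r9]; exact he.row_ne
      · simpa [r10] using hL
      · simpa [r10] using hpL
      · simp only [State.set_reg, State.set_mem, State.put_reg, Nat.reduceEqDiff, if_false, r8,
          r10]
        exact RowOk.put (RowOk.put (H := (H₂.set 13 q).set 14 (H.reg 10 + g.len z)) hrowV
          he.row_lt (by omega)) he.row_lt (by omega)
      · simpa [r10, r11] using he.found
      · refine ⟨g.concat zs ++ tail, ?_, Or.inr (Or.inl ?_)⟩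
        · simpa [r10, hcat] using hd
        · simpa [r10, hcat, Gram.len] using hno
    -- A failure with a leaf means that the factor cannot be extended by even one letter.
    · have hkind : g.kind z = 0 := by simpa [r12, mk] using hze
      rw [g.len_leaf hz hkind] at hno
      refine Runs.assign (by simp; omega) ⟨by simp; linarith, [], ?_,
        Or.inr ⟨by simp, by simp⟩⟩
      constructor
      · exact ((hr₂.set (by omega)).set (by omega)).set (by omega)
      · simpa using r5
      · simp
      · trivial
      · simp
      · simp [r8]; exact he.row_lt
      · simpa [r9] using hfree
      · simp [r8, r9]; exact he.row_ne
      · simpa [r10] using hL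
      · simpa [r10] using hpL
      · simpa [r8, r10] using hrowV
      · simpa [r10, r11] using he.found
      · refine ⟨g.val z ++ (g.concat zs ++ tail), ?_, Or.inr (Or.inr ⟨rfl, ?_⟩)⟩
        · simpa [r10, Gram.concat] using hd
        · simpa [r10] using hno

end WordRAM

/-! ### The sequence of factors -/

namespace Gram

/-- The output for the factor of length `L` at `p`, with an earlier occurrence at `q`. -/
def token (g : Gram) (p q L : ℕ) : List ℕ := if 1 < L then [1, q, L] else 0 :: g.piece p 1

/-- There is a factor of length `L` at `p`, with an earlier occurrence at `q` unless `L` is `1`. -/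
structure Factor (g : Gram) (sr : Bool) (p q L : ℕ) : Prop where
  pos : 1 ≤ L
  le : p + L ≤ g.N
  found : L = 1 ∨ g.occ (g.piece p L) (g.n - 1) q ∧ Near sr p q L
  longest : p + L = g.N ∨ ¬ g.Earlier sr p (L + 1)

/-- The factors given by `ls` end at the position `p` and are output as `out`. -/
inductive Parse (g : Gram) (sr : Bool) : List (ℕ × ℕ) → ℕ → List ℕ → Prop
  | nil : Parse g sr [] 0 []
  | snoc {ls : List (ℕ × ℕ)} {p q L : ℕ} {out : List ℕ} : Parse g sr ls p out →
      g.Factor sr p q L → Parse g sr (ls ++ [(q, L)]) (p + L) (out ++ g.token p q L)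

theorem Parse.length_pos {g : Gram} {sr : Bool} {ls : List (ℕ × ℕ)} {p : ℕ} {out : List ℕ}
    (h : g.Parse sr ls p out) (hp : 0 < p) : 0 < ls.length := by
  cases h
  · omega
  · simp

end Gram

namespace WordRAM

open Exp

/-- The potential is `zs.length + 2 * m`, where `m` exceeds all stacked variables. A success pops
one variable. A failure with `z < m` leaves at most two variables below `z`, of potential at most `2
+ 2 * z ≤ 2 * m`, which is less than before. The start is at most `3 * g.n`. -/
theorem runs_extend {g : Gram} {sr : Bool} {w p c : ℕ} {out zs : List ℕ} {H : State}
    (he : Extending g sr w p c out zs H) (hzs : ∀ z ∈ zs, z < g.n) :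
    Runs w (while_ (var 7) (tryExtend sr)) H fun H' t => t ≤ 130000 * (g.n * (g.n * g.K)) ∧
      Extending g sr w p c out [] H' := by
  have hnK := g.n_le_K
  have hnpos := g.n_pos
  have hKK : 1 ≤ g.n * g.K := Nat.mul_pos hnpos (by omega)
  refine (Runs.while_le (fun k H' => ∃ zs m, Extending g sr w p c out zs H' ∧ (∀ z ∈ zs, z < m) ∧
    zs.length + 2 * m ≤ k) (43000 * (g.n * g.K)) ?_ ?_ (3 * g.n) ?_).mono ?_
  · rintro k H' -
    simp
  · rintro k H' ⟨zs, m, he', hm, hk⟩ hne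
    have h7 : H'.reg 7 ≠ 0 := hne
    rw [he'.height] at h7
    obtain ⟨z, zs, rfl⟩ := List.exists_cons_of_length_pos (Nat.pos_of_ne_zero h7)
    refine (runs_tryExtend he').mono ?_
    rintro H₁ t ⟨ht, zs', he₁, h⟩
    refine ⟨ht, k - 1, ?_, ?_⟩
    · simp only [List.length_cons] at hk
      omega
    · rcases h with rfl | ⟨h1, h2⟩
      · refine ⟨_, m, he₁, fun z hz => hm z (List.mem_cons_of_mem _ hz), ?_⟩
        simp only [List.length_cons] at hk
        omega
      · have := hm z List.mem_cons_self
        refine ⟨_, z, he₁, h2, ?_⟩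
        simp only [List.length_cons] at hk
        omega
  · have := he.height_le
    exact ⟨zs, g.n, he, hzs, by omega⟩
  · rintro H' t ⟨ht, hz, k, zs, m, he', -⟩
    have h7 : H'.reg 7 = 0 := hz
    rw [he'.height] at h7
    obtain rfl := List.length_eq_zero_iff.1 h7
    refine ⟨?_, he'⟩
    simp at ht
    have e1 : 3 * g.n * (43000 * (g.n * g.K) + 2 + 1)
      = 129000 * (g.n * (g.n * g.K)) + 9 * g.n := by ring
    have e2 : g.n * 1 ≤ g.n * (g.n * g.K) := Nat.mul_le_mul_left _ hKK
    linarith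

theorem Stack.lt {g : Gram} {m : ℕ → ℕ} {zs : List ℕ} (h : Stack g m zs) : ∀ z ∈ zs, z < g.n := by
  induction zs with
  | nil => simp
  | cons z zs ih =>
    intro y hy
    rcases List.mem_cons.1 hy with rfl | hy
    · exact h.2.1
    · exact ih h.2.2 y hy

/-- Output the factor at the position `R[4]`, and advance. -/
def factor (sr : Bool) : Program :=
  descend ;; assign 8 (var 5) ;; assign 9 (var 0) ;; assign 10 1 ;; assign 11 0 ;;
  while_ (var 7) (tryExtend sr) ;;
  ite (lt 1 (var 10)) (emit 1 ;; emit (var 11) ;; emit (var 10))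
    (emit 0 ;; emit (leftOf (var 5))) ;;
  assign 4 (var 4 + var 10)

theorem runs_factor {g : Gram} {sr : Bool} {w p : ℕ} {out : List ℕ} {H : State}
    (hr : Ready g w p out H) (hp : p < g.N) :
    Runs w (factor sr) H fun H' t => t ≤ 131000 * (g.n * (g.n * g.K)) ∧
      ∃ q L, g.Factor sr p q L ∧ Ready g w (p + L) (out ++ g.token p q L) H' := by
  have hnum := hr.ctx.fits.num
  have hw := hr.ctx.fits.two_mul
  have hmem := hr.ctx.fits.mem
  have hnK := g.n_le_K
  have hnpos := g.n_pos
  have hKK : 1 ≤ g.n * g.K := Nat.mul_pos hnpos (by omega)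
  have hKK' : g.n * 1 ≤ g.n * (g.n * g.K) := Nat.mul_le_mul_left _ hKK
  have hN : g.inf = g.N + 1 := rfl
  refine Runs.seq ((runs_descend hr hp).mono ?_)
  rintro H₁ t₁ ⟨ht₁, hr₁, h5, hkind, zs, h7, hst, hzn, hd⟩
  have hleaf := g.leaf _ h5 hkind
  refine Runs.assign_seq (by simp) (Runs.assign_seq (by simp) (Runs.assign_seq (by simp; omega)
    (Runs.assign_seq (by simp; omega) (Runs.seq ?_))))
  have hpiece : g.piece p 1 = g.val (H₁.reg 5) := by
    rw [Gram.piece, hd, hleaf]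
    rfl
  refine (runs_extend (p := p) (c := H₁.reg 5) (out := out) (zs := zs) ⟨?_, ?_, ?_, ?_, hzn, ?_,
    ?_, ?_, ?_, ?_, ?_, ?_, ?_⟩ hst.lt).mono ?_
  · exact (((hr₁.set (by omega)).set (by omega)).set (by omega)).set (by omega)
  · simp
  · simpa using h7
  · exact hst
  · simp; omega
  · simp [hr₁.ctx.n]
  · simp [hr₁.ctx.n]; omega
  · simp
  · simp; omega
  · simpa [hpiece] using hr₁.rows _ h5
  · simp
  -- Leaf and stack spell the whole remaining text, so no tail is left over.
  · refine ⟨[], ?_, Or.inl rfl⟩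
    have := congrArg (List.drop 1) hd
    rw [List.drop_drop, hleaf] at this
    simpa using this
  · rintro H₂ t₂ ⟨ht₂, he⟩
    obtain ⟨tail, hd₂, hcases⟩ := he.rest
    have hf : g.Factor sr p (H₂.reg 11) (H₂.reg 10) := by
      refine ⟨he.len_pos, he.len_le, he.found, ?_⟩
      -- With an empty stack, the factor ends the text, or its own length or the next one admits no
      -- earlier occurrence; either of the latter excludes length `L + 1`.
      rcases hcases with rfl | h | ⟨-, h⟩
      · left
        have := congrArg List.length hd₂
        simp only [Gram.concat, List.map_nil, List.flatten_nil, List.append_nil, List.length_nil,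
          List.length_drop] at this
        have := he.len_le
        simp only [Gram.N, Gram.len] at *
        omega
      · right
        intro h'
        exact h (h'.mono (by simp [Gram.concat]))
      · exact Or.inr h
    have hle := he.len_le
    have ml := he.ready.ctx.holds.l _ h5
    have hpos := he.ready.pos
    refine Runs.seq (Runs.mono (Q := fun H₃ t => t ≤ 50 ∧ H₃.reg = H₂.reg ∧ H₃.mem = H₂.mem ∧
      H₃.output = out ++ g.token p (H₂.reg 11) (H₂.reg 10)) ?_ ?_)
    · refine Runs.ite_lt (by simp; omega) (fun hlt => ?_) (fun hlt => ?_)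
      · replace hlt : 1 < H₂.reg 10 := hlt
        refine Runs.seq (Runs.emit (by simp; omega) (Runs.seq (Runs.emit (by simp)
          (Runs.emit (by simp) ⟨by simp, rfl, rfl, ?_⟩))))
        simp [Gram.token, hlt, he.ready.output]
      · replace hlt : H₂.reg 10 ≤ 1 := hlt
        refine Runs.seq (Runs.emit (by simp; omega) (Runs.emit (by simp [he.leafVar]; omega)
          ⟨by simp, rfl, rfl, ?_⟩))
        simp [Gram.token, Nat.not_lt.2 hlt, he.ready.output, hpiece, hleaf, he.leafVar, ml]
    · rintro H₃ t₃ ⟨ht₃, hreg, hm, ho⟩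
      refine Runs.assign (by simp [hreg]; omega) ⟨by simp; linarith, _, _, hf, ?_⟩
      refine ⟨⟨he.ready.ctx.fits, ?_, ?_, ?_⟩, ?_, ?_, ?_⟩
      · simpa [hreg] using he.ready.ctx.n
      · simpa [hreg] using he.ready.ctx.inf
      · simpa [hm] using he.ready.ctx.holds
      · simpa [hm] using he.ready.rows
      · simp [hreg, hpos]
      · simpa using ho

/-- All factors, from the rows of the variables. -/
def allFactors (sr : Bool) : Program :=
  assign 4 0 ;; while_ (lt (var 4 + 1) (var 1)) (factor sr)

theorem runs_allFactors {g : Gram} {sr : Bool} {w : ℕ} {H : State} (hc : Ctx g w H)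
    (hrows : ∀ i < g.n, RowOk g H.mem i (g.val i)) (ho : H.output = []) :
    Runs w (allFactors sr) H fun H' t => ∃ ls, g.Parse sr ls g.N H'.output ∧
      t ≤ 132000 * (g.n * (g.n * g.K)) * ls.length := by
  have hnum := hc.fits.num
  have hw := hc.fits.two_mul
  have hnK := g.n_le_K
  have hnpos := g.n_pos
  have hKK : 1 ≤ g.n * (g.n * g.K) := Nat.mul_pos hnpos (Nat.mul_pos hnpos (by omega))
  have hN : g.inf = g.N + 1 := rfl
  have hNpos : 0 < g.N := g.len_pos (by omega)
  refine Runs.assign_seq (by simp; omega) ?_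
  -- The variant `N - p` may be exponential in the size of the grammar, so the time is charged to
  -- the factors found so far instead.
  refine (Runs.while_time (fun k H' t => ∃ ls p out, p + k = g.N ∧ g.Parse sr ls p out ∧
    Ready g w p out H' ∧ t ≤ ls.length * (131000 * (g.n * (g.n * g.K)) + 8) + 8) ?_ ?_ g.N ?_).mono
    ?_
  · rintro k H' t ⟨ls, p, out, hk, -, hr, -⟩
    have := hr.pos
    simp
    omega
  · rintro k H' t ⟨ls, p, out, hk, hparse, hr, ht⟩ hne
    have hp : p < g.N := by
      by_contra hcon
      refine hne (if_neg ?_)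
      simp [hr.pos, hr.ctx.inf]
      omega
    refine (runs_factor hr hp).mono ?_
    rintro H₁ t₁ ⟨ht₁, q, L, hf, hr₁⟩
    have h1 := hf.pos
    have h2 := hf.le
    refine ⟨k - L, by omega, _, _, _, by omega, hparse.snoc hf, hr₁, ?_⟩
    simp only [List.length_append, List.length_singleton, cost_lt, cost_add, cost_var, cost_ofNat]
    rw [Nat.add_mul]
    linarith
  · refine ⟨[], 0, [], by simp, .nil, ⟨hc.set (by omega), hrows, by simp, by simpa using ho⟩, ?_⟩
    simp
  · rintro H' t ⟨hz, k, ls, p, out, hk, hparse, hr, ht⟩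
    have hp : g.N ≤ p := by
      by_contra hcon
      have hlt : H'.reg 4 + 1 < H'.reg 1 := by rw [hr.pos, hr.ctx.inf]; omega
      exact absurd (hz.symm.trans (if_pos hlt)) zero_ne_one
    obtain rfl : p = g.N := by omega
    refine ⟨ls, by rwa [hr.output], ?_⟩
    have hls : 1 ≤ ls.length := hparse.length_pos hNpos
    have e1 : ls.length * (131000 * (g.n * (g.n * g.K)) + 8)
      = 131000 * (g.n * (g.n * g.K) * ls.length) + 8 * ls.length := by ring
    have e2 : 1 * ls.length ≤ g.n * (g.n * g.K) * ls.length := Nat.mul_le_mul_right _ hKK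
    simp
    linarith

end WordRAM

/-! ## Factors and substrings -/

namespace LZ77

variable {α : Type} {S : List α} {sr : Bool} {p q L : ℕ}

/-- The substring of length `L` at `p`. -/
def slice (S : List α) (p L : ℕ) : List α := (S.drop p).take L

theorem length_slice (h : p + L ≤ S.length) : (slice S p L).length = L := by
  simp [slice]
  omega

theorem slice_take {k : ℕ} (h : q + L ≤ k) : slice (S.take k) q L = slice S q L := by
  rw [slice, slice, List.drop_take, List.take_take, Nat.min_eq_left (by omega)]

theorem isInfix_take_iff {k : ℕ} {f : List α} (hk : k ≤ S.length) :
    f <:+: S.take k ↔ ∃ q, q + f.length ≤ k ∧ slice S q f.length = f := by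
  constructor
  · rintro ⟨a, b, h⟩
    have hlen := congrArg List.length h
    simp only [List.length_append, List.length_take, Nat.min_eq_left hk] at hlen
    refine ⟨a.length, by omega, ?_⟩
    rw [← slice_take (k := k) (by omega), ← h, slice, List.append_assoc, List.drop_left,
      List.take_left]
  · rintro ⟨q, hq, h⟩
    rw [← slice_take hq] at h
    conv_lhs => rw [← h]
    exact (List.take_prefix _ _).isInfix.trans (List.drop_suffix _ _).isInfix

/-- The end of the window for a factor of length `L` at `p`. -/
def windowEnd (sr : Bool) (p L : ℕ) : ℕ := if sr then p + (L - 1) else p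

/-- With self-references the window is a prefix of the text as well, longer by `L - 1` letters; both
variants can then be treated alike. -/
theorem window_slice (h : p + L ≤ S.length) :
    window sr (S.take p) (slice S p L) = S.take (windowEnd sr p L) := by
  cases sr
  · rfl
  · simp only [window, windowEnd, if_true]
    rw [List.take_add, List.dropLast_eq_take, length_slice h, slice, List.take_take,
      Nat.min_eq_left (by omega)]

theorem windowEnd_le (h : p + L ≤ S.length) : windowEnd sr p L ≤ S.length := by
  unfold windowEnd
  split_ifs <;> omega

theorem near_iff (hL : 1 ≤ L) : Gram.Near sr p q L ↔ q + L ≤ windowEnd sr p L := by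
  unfold Gram.Near windowEnd
  split_ifs <;> omega

theorem isInfix_window_iff (hL : 1 ≤ L) (h : p + L ≤ S.length) :
    slice S p L <:+: window sr (S.take p) (slice S p L) ↔
      ∃ q, slice S q L = slice S p L ∧ Gram.Near sr p q L := by
  rw [window_slice h, isInfix_take_iff (windowEnd_le h), length_slice h]
  refine exists_congr fun q => ?_
  rw [near_iff hL, and_comm]

/-- A factor, the longest one possible, and a token for it, where `u` is the preceding text. -/
structure GoodFactor (sr : Bool) (S u f : List α) (t : Token α) : Prop where
  ne_nil : f ≠ []
  admissible : Admissible sr u f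
  longest : ∀ h, h <+: S.drop u.length → Admissible sr u h → h.length ≤ f.length
  describes : t.Describes sr u f

theorem isFactorization_and_isEncoding {fs : List (List α)} {ts : List (Token α)} (hS : fs.flatten = S)
    (hlen : ts.length = fs.length)
    (h : ∀ (i : ℕ) (hf : i < fs.length) (ht : i < ts.length),
      GoodFactor sr S (fs.take i).flatten fs[i] ts[i]) :
    IsFactorization sr S fs ∧ IsEncoding sr fs ts := by
  refine ⟨⟨hS, fun i hi => ?_⟩, hlen, fun i hf ht => (h i hf ht).describes⟩
  have hg := h i hi (by omega)
  refine ⟨hg.ne_nil, hg.admissible, fun f hf => hg.longest f ?_⟩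
  have : S = (fs.take i).flatten ++ (fs.drop i).flatten := by
    rw [← List.flatten_append, List.take_append_drop, hS]
  rwa [this, List.drop_left]

end LZ77

namespace Gram

open LZ77

theorem occ_iff {g : Gram} {pat : List ℕ} {j x : ℕ} :
    g.occ pat j x ↔ slice (g.val j) x pat.length = pat := by
  constructor
  · intro h
    refine List.ext_getElem? fun k => ?_
    rw [slice, List.getElem?_take]
    split_ifs with hk
    · rw [List.getElem?_drop]
      exact h k hk
    · rw [List.getElem?_eq_none (by omega)]
  · intro h k hk
    have := congrArg (fun l => l[k]?) h
    simpa [slice, List.getElem?_take, hk] using this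

variable {g : Gram} {sr : Bool} {σ : ℕ} {S : List (Fin σ)}

theorem occ_piece_iff (hS : g.val (g.n - 1) = S.map Fin.val) {p q L : ℕ} (h : p + L ≤ S.length) :
    g.occ (g.piece p L) (g.n - 1) q ↔ slice S q L = slice S p L := by
  have hmap : ∀ x, slice (S.map Fin.val) x L = (slice S x L).map Fin.val := by simp [slice]
  have hp : g.piece p L = (slice S p L).map Fin.val := by rw [piece, hS]; exact hmap p
  rw [occ_iff, hp, hS, List.length_map, length_slice h, hmap]
  exact (List.map_injective_iff.2 Fin.val_injective).eq_iff

theorem earlier_iff (hS : g.val (g.n - 1) = S.map Fin.val) {p L : ℕ} (h : p + L ≤ S.length) :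
    g.Earlier sr p L ↔ ∃ q, slice S q L = slice S p L ∧ Near sr p q L := by
  simp only [Earlier, occ_piece_iff hS h]

/-- A longer admissible prefix has at least two letters, so it is a substring of its window and has
an earlier occurrence. Its prefix of length `L + 1` then has one too, against the maximality in
`Factor`. -/
theorem Factor.good (hS : g.val (g.n - 1) = S.map Fin.val) {p q L : ℕ} (hf : g.Factor sr p q L) :
    ∃ t, GoodFactor sr S (S.take p) (slice S p L) t ∧ g.token p q L = t.encode := by
  have hN : g.N = S.length := by simp [N, len, hS]
  have hle := hf.le
  have hpos := hf.pos
  rw [hN] at hle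
  have hlen := length_slice hle
  have hlongest : ∀ h, h <+: S.drop (S.take p).length → Admissible sr (S.take p) h →
      h.length ≤ (slice S p L).length := by
    intro h hpre hadm
    rw [List.length_take, Nat.min_eq_left (by omega)] at hpre
    rw [hlen]
    by_contra hcon
    have hh : h = slice S p h.length := List.prefix_iff_eq_take.1 hpre
    have hle' : p + h.length ≤ S.length := by
      have := hpre.length_le
      simp only [List.length_drop] at this
      omega
    have hear : g.Earlier sr p h.length := by
      rcases hadm with ⟨a, rfl⟩ | hinf
      · simp at hcon
        omega
      · rw [earlier_iff hS hle', ← isInfix_window_iff (by omega) hle', ← hh]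
        exact hinf
    rcases hf.longest with h1 | h1
    · omega
    · exact h1 (hear.mono (by omega))
  have hne : slice S p L ≠ [] := List.length_pos_iff.1 (by omega)
  by_cases hL : 1 < L
  · obtain ⟨hocc, hnear⟩ := hf.found.resolve_left (by omega)
    rw [occ_piece_iff hS hle] at hocc
    refine ⟨.ref q L, ⟨hne, Or.inr ((isInfix_window_iff hpos hle).2 ⟨q, hocc, hnear⟩), hlongest,
      hlen, ?_⟩, by simp [token, hL, Token.encode]⟩
    have hq := (near_iff hpos).1 hnear
    rw [window_slice hle]
    refine ⟨?_, ?_⟩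
    · rw [List.length_take, Nat.min_eq_left (windowEnd_le hle)]
      exact hq
    · exact (slice_take hq).trans hocc
  · obtain rfl : L = 1 := by omega
    obtain ⟨a, ha⟩ := List.length_eq_one_iff.1 hlen
    refine ⟨.letter a, ⟨hne, Or.inl ⟨a, ha⟩, hlongest, ha⟩, ?_⟩
    have : g.piece p 1 = (slice S p 1).map Fin.val := by simp [piece, slice, hS]
    simp [token, this, ha, Token.encode]

theorem Parse.exists_isEncoding (hS : g.val (g.n - 1) = S.map Fin.val) {ls : List (ℕ × ℕ)}
    {out : List ℕ} (h : g.Parse sr ls g.N out) :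
    ∃ fs ts, IsFactorization sr S fs ∧ IsEncoding sr fs ts ∧
      out = (ts.map Token.encode).flatten ∧ fs.length = ls.length := by
  have hN : g.N = S.length := by simp [N, len, hS]
  have key : ∀ ls p out, g.Parse sr ls p out → ∃ (fs : List (List (Fin σ))) (ts : List _),
      fs.flatten = S.take p ∧ ts.length = fs.length ∧ fs.length = ls.length ∧
      out = (ts.map Token.encode).flatten ∧ ∀ (i : ℕ) (hf : i < fs.length) (ht : i < ts.length),
        GoodFactor sr S (fs.take i).flatten fs[i] ts[i] := by
    intro ls p out h
    induction h with
    | nil => exact ⟨[], [], by simp⟩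
    | @snoc ls p q L out _ hf ih =>
      obtain ⟨fs, ts, h1, h2, h3, h4, h5⟩ := ih
      obtain ⟨t, ht, he⟩ := hf.good hS
      refine ⟨fs ++ [slice S p L], ts ++ [t], ?_, by simp [h2], by simp [h3], by simp [h4, he],
        fun i hi hi' => ?_⟩
      · simp [h1, List.take_add, slice]
      · simp only [List.length_append, List.length_singleton] at hi hi'
        rcases Nat.lt_succ_iff_lt_or_eq.1 hi with hlt | rfl
        · rw [List.getElem_append_left hlt, List.getElem_append_left (by omega),
            List.take_append_of_le_length hlt.le]
          exact h5 i hlt (by omega)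
        · rw [List.take_left, h1]
          simpa [← h2] using ht
  obtain ⟨fs, ts, h1, h2, h3, h4, h5⟩ := key _ _ _ h
  rw [hN, List.take_length] at h1
  obtain ⟨h6, h7⟩ := LZ77.isFactorization_and_isEncoding h1 h2 h5
  exact ⟨fs, ts, h6, h7, h4, h3⟩

end Gram

/-! ## Preparation of the grammar -/

/-- A straight line program with words as letters. The field `l` holds the letter if `kind`
is `0`. -/
structure Rules where
  n : ℕ
  n_pos : 0 < n
  kind : ℕ → ℕ
  l : ℕ → ℕ
  r : ℕ → ℕ
  val : ℕ → List ℕ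
  pair : ∀ j < n, kind j ≠ 0 → l j < j ∧ r j < j ∧ val j = val (l j) ++ val (r j)
  leaf : ∀ j < n, kind j = 0 → val j = [l j]

/-- The memory holds the rules. -/
structure Rules.In (R : Rules) (j : ℕ) (mem : ℕ → ℕ) : Prop where
  kind : mem (1 + 3 * j) = R.kind j
  l : mem (2 + 3 * j) = R.l j
  r : mem (3 + 3 * j) = R.r j

theorem Rules.length_pos (R : Rules) {j : ℕ} (hj : j < R.n) : 0 < (R.val j).length := by
  induction j using Nat.strong_induction_on with
  | _ j ih =>
    by_cases hk : R.kind j = 0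
    · simp [R.leaf j hj hk]
    · obtain ⟨h1, h2, h3⟩ := R.pair j hj hk
      rw [h3, List.length_append]
      have := ih _ h1 (by omega)
      omega

namespace WordRAM

open Exp

/-- Mark the variables that the last one depends on, and replace all others by letters. -/
def prune : Program :=
  write (cellAddr (var 0 + 2) (var 0 - 1) 1) 1 ;; assign 5 (var 0) ;;
  while_ (var 5)
    (assign 5 (var 5 - 1) ;;
      ite (cell (var 0 + 2) (var 5) 1)
        (ite (kindOf (var 5))
          (write (cellAddr (var 0 + 2) (leftOf (var 5)) 1) 1 ;;
            write (cellAddr (var 0 + 2) (rightOf (var 5)) 1) 1)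
          .skip)
        (write (1 + 3 * var 5) 0 ;; write (2 + 3 * var 5) 0))

/-- The marks during `prune`, when the variables from `i` on have been treated. -/
structure Pruned (R : Rules) (i : ℕ) (H : State) : Prop where
  size : H.reg 0 = R.n
  index : H.reg 5 = i
  le : i ≤ R.n
  output : H.output = []
  root : H.mem (addr R.n (R.n + 2) (R.n - 1) 1) ≠ 0
  short : ∀ j < R.n, H.mem (addr R.n (R.n + 2) j 1) ≠ 0 →
    (R.val j).length ≤ (R.val (R.n - 1)).length
  rules : ∀ j < R.n, j < i ∨ H.mem (addr R.n (R.n + 2) j 1) ≠ 0 → R.In j H.mem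
  child : ∀ j < R.n, i ≤ j → H.mem (addr R.n (R.n + 2) j 1) ≠ 0 → R.kind j ≠ 0 →
    H.mem (addr R.n (R.n + 2) (R.l j) 1) ≠ 0 ∧ H.mem (addr R.n (R.n + 2) (R.r j) 1) ≠ 0
  cleared : ∀ j < R.n, i ≤ j → H.mem (addr R.n (R.n + 2) j 1) = 0 →
    H.mem (1 + 3 * j) = 0 ∧ H.mem (2 + 3 * j) = 0

theorem addr_size_lt {n w i j f : ℕ} (h : 3 * n + 1 + (n + 3) * n * 4 ≤ cap w) (hi : i < n + 3)
    (hj : j < n) (hf : f < 4) : addr n i j f < cap w := (addr_lt hi hj hf).trans_le h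

/-- Parts have smaller indices than their pair, so one downward sweep marks everything the last
variable depends on. A marked variable is part of a marked one, hence no longer than the text. -/
theorem runs_prune {R : Rules} {w : ℕ} {H : State} (hw : 40 ≤ cap w)
    (hmem : 3 * R.n + 1 + (R.n + 3) * R.n * 4 ≤ cap w) (h0 : H.reg 0 = R.n)
    (ho : H.output = []) (hin : ∀ j < R.n, R.In j H.mem)
    (hzero : ∀ j < R.n, H.mem (addr R.n (R.n + 2) j 1) = 0) :
    Runs w prune H fun H' t => t ≤ 200 * R.n ∧ Pruned R 0 H' := by
  have hnpos := R.n_pos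
  have hinj : ∀ {j j'}, j < R.n → j' < R.n →
      (addr R.n (R.n + 2) j 1 = addr R.n (R.n + 2) j' 1 ↔ j = j') := fun hj hj' => by
    rw [addr_inj hj hj' (by omega) (by omega)]
    simp
  have hbig : ∀ a j, a < 3 * R.n + 1 → a ≠ addr R.n (R.n + 2) j 1 := fun a j ha => by
    simp only [addr]; omega
  have ad : ∀ j < R.n, addr R.n (R.n + 2) j 1 < cap w := fun j hj =>
    addr_size_lt hmem (by omega) hj (by omega)
  have ad0 := ad (R.n - 1) (by omega)
  refine Runs.seq (Runs.write (by simp [h0]; omega) (by simp; omega) ?_)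
  refine Runs.assign_seq (by simp) ?_
  refine (Runs.while_le (fun k H' => Pruned R k H') 150 ?_ ?_ R.n ?_).mono ?_
  · rintro k H' -
    simp
  · rintro k H' hP hne
    have h5 : H'.reg 5 ≠ 0 := hne
    rw [hP.index] at h5
    have hsize := hP.size
    have hkn := hP.le
    obtain ⟨i, rfl⟩ : ∃ i, k = i + 1 := ⟨k - 1, by omega⟩
    have adi := ad i (by omega)
    have hidx := hP.index
    refine Runs.assign_seq (by simp; omega) ?_
    simp only [eval_sub, eval_var, eval_ofNat, hidx, Nat.add_sub_cancel]
    refine Runs.ite (by simp [hsize]; omega) (fun hne => ?_) (fun hz => ?_)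
    · replace hne : H'.mem (addr R.n (R.n + 2) i 1) ≠ 0 := by simpa [hsize] using hne
      have hi := hP.rules i (by omega) (Or.inr hne)
      refine Runs.ite (by simp; omega) (fun hk => ?_) (fun hk => ?_)
      · replace hk : R.kind i ≠ 0 := by simpa [hi.kind] using hk
        obtain ⟨hl, hr, hval⟩ := R.pair i (by omega) hk
        have hlen := congrArg List.length hval
        rw [List.length_append] at hlen
        have adl := ad (R.l i) (by omega)
        have adr := ad (R.r i) (by omega)
        refine Runs.seq (Runs.write (by simp [hi.l, hsize]; omega) (by simp; omega) ?_)
        refine Runs.write (by simp [hi.l, hi.r, hsize, hbig (3 + 3 * i) _ (by omega)]; omega)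
          (by simp; omega) ⟨by simp, i, by omega, ?_⟩
        simp only [eval_cellAddr, eval_add, eval_var, eval_ofNat, eval_rightOf, eval_leftOf,
          State.set_reg, State.set_mem, State.put_reg, State.put_mem, Nat.reduceEqDiff, if_false,
          if_true, hsize, hi.l, hi.r, hbig (3 + 3 * i) _ (by omega)]
        set H₁ := State.put (State.put _ _ 1) (addr R.n (R.n + 2) (R.r i) 1) 1 with hH₁
        have hm : ∀ j < R.n, H₁.mem (addr R.n (R.n + 2) j 1) =
            if j = R.r i then 1 else if j = R.l i then 1 else
              H'.mem (addr R.n (R.n + 2) j 1) := fun j hj => by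
          simp [hH₁, hinj hj (show R.r i < R.n by omega), hinj hj (show R.l i < R.n by omega)]
        have hm' : ∀ a, a < 3 * R.n + 1 → H₁.mem a = H'.mem a := fun a ha => by
          simp [hH₁, hbig a _ ha]
        have hreg : H₁.reg = (H'.set 5 i).reg := rfl
        have hout : H₁.output = [] := hP.output
        have hmono : ∀ j < R.n, H'.mem (addr R.n (R.n + 2) j 1) ≠ 0 →
            H₁.mem (addr R.n (R.n + 2) j 1) ≠ 0 := fun j hj h => by
          rw [hm j hj]
          split_ifs <;> omega
        generalize H₁ = H₂ at *
        have hshort : ∀ j < R.n, H₂.mem (addr R.n (R.n + 2) j 1) ≠ 0 →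
            (R.val j).length ≤ (R.val (R.n - 1)).length := by
          intro j hj hne'
          have hsi := hP.short i (by omega) hne
          rw [hm j hj] at hne'
          split_ifs at hne' with h1 h2
          · subst h1
            omega
          · subst h2
            omega
          · exact hP.short j hj hne'
        refine ⟨by simp [hreg, hsize], by simp [hreg], by omega, hout,
          hmono _ (by omega) hP.root, hshort, fun j hj h => ?_, fun j hj hij h hkj => ?_,
          fun j hj hij h => ?_⟩
        · have hin' : R.In j H'.mem := by
            rcases h with h | h
            · exact hP.rules j hj (Or.inl (by omega))
            · rw [hm j hj] at h
              split_ifs at h with h1 h2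
              · exact hP.rules j hj (Or.inl (by omega))
              · exact hP.rules j hj (Or.inl (by omega))
              · exact hP.rules j hj (Or.inr h)
          exact ⟨(hm' _ (by omega)).trans hin'.kind, (hm' _ (by omega)).trans hin'.l,
            (hm' _ (by omega)).trans hin'.r⟩
        · rcases Nat.eq_or_lt_of_le hij with rfl | hlt
          · rw [hm _ (show R.l i < R.n by omega), hm _ (show R.r i < R.n by omega)]
            simp
          · obtain ⟨hlj, hrj, -⟩ := R.pair j hj hkj
            rw [hm j hj, if_neg (by omega), if_neg (by omega)] at h
            obtain ⟨c1, c2⟩ := hP.child j hj hlt h hkj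
            exact ⟨hmono _ (by omega) c1, hmono _ (by omega) c2⟩
        · have h' : H'.mem (addr R.n (R.n + 2) j 1) = 0 := by
            by_contra hcon
            exact hmono j hj hcon h
          have hne' : j ≠ i := by rintro rfl; exact hne h'
          obtain ⟨c1, c2⟩ := hP.cleared j hj (by omega) h'
          exact ⟨(hm' _ (by omega)).trans c1, (hm' _ (by omega)).trans c2⟩
      · replace hk : R.kind i = 0 := by simpa [hi.kind] using hk
        refine Runs.skip ⟨by simp, i, by omega, by simp [hsize], by simp, by omega, hP.output,
          hP.root, hP.short, fun j hj h => hP.rules j hj (h.imp (fun h => by omega) id),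
          fun j hj hij h hkj => ?_, fun j hj hij h => ?_⟩
        · rcases Nat.eq_or_lt_of_le hij with rfl | hlt
          · exact absurd hk hkj
          · exact hP.child j hj hlt h hkj
        · rcases Nat.eq_or_lt_of_le hij with rfl | hlt
          · exact absurd h hne
          · exact hP.cleared j hj hlt h
    · replace hz : H'.mem (addr R.n (R.n + 2) i 1) = 0 := by simpa [hsize] using hz
      refine Runs.seq (Runs.write (by simp; omega) (by simp; omega) ?_)
      refine Runs.write (by simp; omega) (by simp; omega) ⟨by simp, i, by omega, ?_⟩
      simp only [eval_add, eval_mul, eval_var, eval_ofNat, State.set_reg, State.put_reg, if_true]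
      set H₁ := State.put (State.put _ _ 0) (2 + 3 * i) 0 with hH₁
      have hm : ∀ j, H₁.mem (addr R.n (R.n + 2) j 1) = H'.mem (addr R.n (R.n + 2) j 1) :=
        fun j => by
          simp [hH₁, (hbig (2 + 3 * i) j (by omega)).symm, (hbig (1 + 3 * i) j (by omega)).symm]
      have hm' : ∀ a, a ≠ 1 + 3 * i → a ≠ 2 + 3 * i → H₁.mem a = H'.mem a := fun a h1 h2 => by
        simp [hH₁, h1, h2]
      have h1 : H₁.mem (1 + 3 * i) = 0 := by simp [hH₁]
      have h2 : H₁.mem (2 + 3 * i) = 0 := by simp [hH₁]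
      have hreg : H₁.reg = (H'.set 5 i).reg := rfl
      have hout : H₁.output = [] := hP.output
      generalize H₁ = H₂ at *
      refine ⟨by simp [hreg, hsize], by simp [hreg], by omega, hout, by rw [hm]; exact hP.root,
        fun j hj h => hP.short j hj (by rwa [hm] at h), fun j hj h => ?_,
        fun j hj hij h hkj => ?_, fun j hj hij h => ?_⟩
      · rw [hm] at h
        have hne' : j ≠ i := by rintro rfl; omega
        have hin' := hP.rules j hj (h.imp (fun h => by omega) id)
        exact ⟨(hm' _ (by omega) (by omega)).trans hin'.kind,
          (hm' _ (by omega) (by omega)).trans hin'.l, (hm' _ (by omega) (by omega)).trans hin'.r⟩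
      · rw [hm] at h
        have hne' : j ≠ i := by rintro rfl; omega
        rw [hm, hm]
        exact hP.child j hj (by omega) h hkj
      · rw [hm] at h
        by_cases hji : j = i
        · subst hji
          exact ⟨h1, h2⟩
        · rw [hm' _ (by omega) (by omega), hm' _ (by omega) (by omega)]
          exact hP.cleared j hj (by omega) h
  · simp only [eval_cellAddr, eval_add, eval_sub, eval_var, eval_ofNat, State.put_reg, h0]
    set H₁ := State.set (State.put _ _ 1) 5 R.n with hH₁
    have hm : ∀ j < R.n, H₁.mem (addr R.n (R.n + 2) j 1) = if j = R.n - 1 then 1 else 0 :=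
      fun j hj => by
        simp [hH₁, hinj hj (show R.n - 1 < R.n by omega), hzero j hj]
    have hm' : ∀ a, a < 3 * R.n + 1 → H₁.mem a = H.mem a := fun a ha => by
      simp [hH₁, hbig a _ ha]
    refine ⟨by simp [hH₁, h0], by simp [hH₁], le_rfl, ho, ?_, fun j hj h => ?_, fun j hj _ => ?_,
      fun j hj hij => by omega, fun j hj hij => by omega⟩
    · rw [hm _ (by omega)]
      simp
    · rw [hm j hj] at h
      split_ifs at h with h1
      · rw [h1]
      · omega
    · exact ⟨(hm' _ (by omega)).trans (hin j hj).kind, (hm' _ (by omega)).trans (hin j hj).l,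
        (hm' _ (by omega)).trans (hin j hj).r⟩
  · rintro H' t ⟨ht, hz, k, hP⟩
    obtain rfl : k = 0 := hP.index.symm.trans hz
    refine ⟨?_, hP⟩
    simp at ht ⊢
    omega

/-- The grammar that remains after `prune`. -/
theorem Pruned.exists_gram {R : Rules} {H : State} (h : Pruned R 0 H) :
    ∃ g : Gram, g.n = R.n ∧ g.val (g.n - 1) = R.val (R.n - 1) ∧
      ∀ j < g.n, H.mem (1 + 3 * j) = g.kind j ∧ H.mem (2 + 3 * j) = g.l j ∧
        H.mem (3 + 3 * j) = g.r j := by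
  classical
  have hnpos := R.n_pos
  refine ⟨⟨R.n, R.n_pos, fun j => H.mem (1 + 3 * j), fun j => H.mem (2 + 3 * j),
    fun j => H.mem (3 + 3 * j),
    -- An unmarked variable has become the letter `0`.
    fun j => if H.mem (addr R.n (R.n + 2) j 1) ≠ 0 then R.val j else [0],
    fun j hj hk => ?_, fun j hj hk => ?_, fun j hj => ?_⟩, rfl, if_pos h.root,
    fun j _ => ⟨rfl, rfl, rfl⟩⟩
  · by_cases hm : H.mem (addr R.n (R.n + 2) j 1) = 0
    · exact absurd (h.cleared j hj (Nat.zero_le _) hm).1 hk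
    · have hin := h.rules j hj (Or.inr hm)
      rw [hin.kind] at hk
      obtain ⟨h1, h2, h3⟩ := R.pair j hj hk
      obtain ⟨c1, c2⟩ := h.child j hj (Nat.zero_le _) hm hk
      rw [hin.l, hin.r, if_pos hm, if_pos c1, if_pos c2]
      exact ⟨h1, h2, h3⟩
  · by_cases hm : H.mem (addr R.n (R.n + 2) j 1) = 0
    · rw [if_neg (by simpa using hm), (h.cleared j hj (Nat.zero_le _) hm).2]
    · have hin := h.rules j hj (Or.inr hm)
      rw [hin.kind] at hk
      rw [if_pos hm, hin.l]
      exact R.leaf j hj hk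
  · simp only [if_pos h.root]
    split_ifs with hm
    · exact h.short j hj hm
    · exact R.length_pos (by omega)

/-- The lengths of the variables. -/
def lengths : Program :=
  assign 5 0 ;;
  while_ (lt (var 5) (var 0))
    (ite (kindOf (var 5)) (assign 6 (lenOf (leftOf (var 5)) + lenOf (rightOf (var 5))))
      (assign 6 1) ;;
    write (cellAddr (var 0 + 2) (var 5) 0) (var 6) ;; assign 5 (var 5 + 1)) ;;
  assign 1 (lenOf (var 0 - 1) + 1)

/-- The lengths are bounded by that of the text only thanks to `prune`; this is why the sums fit
into words. -/
theorem runs_lengths {g : Gram} {w : ℕ} {H : State} (hf : Fits g w) (h0 : H.reg 0 = g.n)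
    (ho : H.output = [])
    (hin : ∀ j < g.n, H.mem (1 + 3 * j) = g.kind j ∧ H.mem (2 + 3 * j) = g.l j ∧
      H.mem (3 + 3 * j) = g.r j) :
    Runs w lengths H fun H' t => t ≤ 300 * g.n ∧ H'.output = [] ∧ Ctx g w H' := by
  have hnum := hf.num
  have hw := hf.two_mul
  have hmem := hf.mem
  have hnpos := g.n_pos
  have hN : g.inf = g.N + 1 := rfl
  refine Runs.assign_seq (by simp; omega) (Runs.seq ?_)
  refine (Runs.while_le (fun k H' => H'.reg 5 + k = g.n ∧ H'.reg 0 = g.n ∧ H'.output = [] ∧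
    (∀ a < 3 * g.n + 1, H'.mem a = H.mem a) ∧
    ∀ j < H'.reg 5, H'.mem (addr g.n (g.n + 2) j 0) = g.len j) 150 ?_ ?_ g.n ?_).mono ?_
  · rintro k H' -
    simp
    omega
  · rintro k H' ⟨hk, hn, ho', hm, hlen⟩ hne
    have hj : H'.reg 5 < g.n := by
      by_contra hcon
      refine hne (if_neg ?_)
      simpa [hn] using hcon
    obtain ⟨j, ej⟩ : ∃ j, H'.reg 5 = j := ⟨_, rfl⟩
    rw [ej] at hj hlen hk
    obtain ⟨i1, i2, i3⟩ := hin j hj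
    rw [← hm _ (by omega)] at i1 i2 i3
    have adj := hf.addr (i := g.n + 2) (j := j) (f := 0) (by omega) hj (by omega)
    refine Runs.seq (Runs.mono (Q := fun H₁ t => t ≤ 100 ∧ Keeps 6 H' H₁ ∧
      H₁.reg 6 = g.len j) ?_ ?_)
    · refine Runs.ite (by simp; omega) (fun hne => ?_) (fun hz => ?_)
      · have hkind : g.kind j ≠ 0 := by simpa [ej, i1] using hne
        obtain ⟨hl, hr, -⟩ := g.pair j hj hkind
        have hsum := g.len_pair hj hkind
        have hle := g.len_le_N hj
        have adl := hf.addr (i := g.n + 2) (j := g.l j) (f := 0) (by omega) (by omega) (by omega)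
        have adr := hf.addr (i := g.n + 2) (j := g.r j) (f := 0) (by omega) (by omega) (by omega)
        have ll := hlen _ hl
        have lr := hlen _ hr
        refine Runs.assign (by simp [hn, ej, i2, i3, ll, lr]; omega)
          ⟨by simp, (Keeps.refl _ _).set le_rfl, ?_⟩
        simp [hn, ej, i2, i3, ll, lr, hsum]
      · have hkind : g.kind j = 0 := by simpa [ej, i1] using hz
        refine Runs.assign (by simp; omega) ⟨by simp, (Keeps.refl _ _).set le_rfl, ?_⟩
        simp [g.len_leaf hj hkind]
    · rintro H₁ t₁ ⟨ht₁, hk₁, h6⟩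
      have n₁ : H₁.reg 0 = g.n := by rw [hk₁.1 0 (by omega), hn]
      have e₁ : H₁.reg 5 = j := by rw [hk₁.1 5 (by omega), ej]
      refine Runs.seq (Runs.write (by simp [n₁, e₁]; omega) (by simp) ?_)
      refine Runs.assign (by simp [e₁]; omega) ⟨by simp; linarith, k - 1, by omega, ?_, ?_, ?_,
        fun a ha => ?_, fun j' hj' => ?_⟩
      · simp [e₁]; omega
      · simpa using n₁
      · simpa [hk₁.2.2] using ho'
      · have : a ≠ addr g.n (g.n + 2) j 0 := by simp only [addr]; omega
        simp [n₁, e₁, this, hk₁.2.1, hm a ha]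
      · simp only [State.set_reg, if_true, eval_add, eval_var, eval_ofNat, State.put_reg, e₁]
          at hj'
        simp only [State.set_mem, State.put_mem, eval_cellAddr, eval_add, eval_var, eval_ofNat,
          n₁, e₁, h6, addr_inj (show j' < g.n by omega) hj (show 0 < 4 by omega)
          (show 0 < 4 by omega), true_and, and_true, hk₁.2.1]
        split_ifs with h
        · rw [h]
        · exact hlen j' (by omega)
  · refine ⟨by simp, by simpa using h0, ho, fun _ _ => rfl, fun j hj => ?_⟩
    simp at hj
  · rintro H' t ⟨ht, hz, k, hk, hn, ho', hm, hlen⟩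
    have hj : g.n ≤ H'.reg 5 := by
      by_contra hcon
      have hlt : H'.reg 5 < H'.reg 0 := by rw [hn]; omega
      exact absurd (hz.symm.trans (if_pos hlt)) zero_ne_one
    have adn := hf.addr (i := g.n + 2) (j := g.n - 1) (f := 0) (by omega) (by omega) (by omega)
    have ln := hlen (g.n - 1) (by omega)
    have hNl : g.len (g.n - 1) = g.N := rfl
    refine Runs.assign (by simp [hn, ln]; omega) ⟨?_, ho', hf, by simpa using hn, ?_,
      fun j hj => ?_, fun j hj => ?_, fun j hj => ?_, fun j hj' => ?_⟩
    · simp at ht ⊢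
      omega
    · simp [hn, ln, hNl, hN]
    · exact (hm _ (by omega)).trans (hin j hj).1
    · exact (hm _ (by omega)).trans (hin j hj).2.1
    · exact (hm _ (by omega)).trans (hin j hj).2.2
    · exact hlen j (by omega)

end WordRAM

/-! ### The input words of a straight line program -/

namespace List

theorem getElem?_flatten_of_length {α : Type*} {m : ℕ} {ls : List (List α)}
    (h : ∀ l ∈ ls, l.length = m) {j k : ℕ} (hj : j < ls.length) (hk : k < m) :
    ls.flatten[m * j + k]? = ls[j][k]? := by
  induction ls generalizing j with
  | nil => simp at hj
  | cons l ls ih =>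
    have hl : l.length = m := h l mem_cons_self
    rw [flatten_cons]
    cases j with
    | zero =>
      rw [getElem?_append_left (by omega)]
      simp
    | succ j =>
      rw [getElem?_append_right (by rw [hl, Nat.mul_succ]; omega)]
      simp only [length_cons] at hj
      rw [getElem_cons_succ, ← ih (fun l hl => h l (mem_cons_of_mem _ hl)) (by omega)]
      congr 1
      rw [hl, Nat.mul_succ]
      omega

end List

namespace SLP

variable {σ : ℕ} (G : SLP (Fin σ))

theorem length_encodeExpr {i : ℕ} (e : SLPExpr (Fin σ) i) : (encodeExpr e).length = 3 := by
  cases e <;> rfl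

theorem length_encode : G.encode.length = 3 * G.size + 1 := by
  simp [encode, List.length_flatten, List.map_ofFn, Function.comp_def, length_encodeExpr]
  omega

theorem encode_getD {j k : ℕ} (hj : j < G.size) (hk : k < 3) :
    G.encode.getD (k + 1 + 3 * j) 0 = (encodeExpr (G.rule ⟨j, hj⟩)).getD k 0 := by
  rw [List.getD_eq_getElem?_getD, List.getD_eq_getElem?_getD, encode,
    show k + 1 + 3 * j = (3 * j + k) + 1 by omega, List.getElem?_cons_succ,
    List.getElem?_flatten_of_length (m := 3) (by simp [length_encodeExpr]) (by simpa using hj) hk]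
  simp

/-- The rules as they are laid out in memory. -/
theorem exists_rules : ∃ R : Rules, R.n = G.size ∧ R.val (R.n - 1) = G.str.map Fin.val ∧
    ∀ j < R.n, R.In j (WordRAM.State.init G.encode).mem := by
  have hkind : ∀ j (hj : j < G.size),
      G.encode.getD (1 + 3 * j) 0 = (encodeExpr (G.rule ⟨j, hj⟩)).getD 0 0 :=
    fun j hj => G.encode_getD hj (by omega)
  have hl : ∀ j (hj : j < G.size),
      G.encode.getD (2 + 3 * j) 0 = (encodeExpr (G.rule ⟨j, hj⟩)).getD 1 0 :=
    fun j hj => G.encode_getD hj (by omega)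
  have hr : ∀ j (hj : j < G.size),
      G.encode.getD (3 + 3 * j) 0 = (encodeExpr (G.rule ⟨j, hj⟩)).getD 2 0 :=
    fun j hj => G.encode_getD hj (by omega)
  have hval : ∀ j (hj : j < G.size), (∀ a, G.rule ⟨j, hj⟩ = .letter a → G.val ⟨j, hj⟩ = [a]) ∧
      ∀ l r, G.rule ⟨j, hj⟩ = .pair l r →
        G.val ⟨j, hj⟩ = G.val ⟨l, l.isLt.trans hj⟩ ++ G.val ⟨r, r.isLt.trans hj⟩ := by
    intro j hj
    constructor
    · intro a h
      rw [val, h]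
    · intro l r h
      rw [val, h]
  refine ⟨⟨G.size, G.size_pos, fun j => G.encode.getD (1 + 3 * j) 0,
    fun j => G.encode.getD (2 + 3 * j) 0, fun j => G.encode.getD (3 + 3 * j) 0,
    fun j => if hj : j < G.size then (G.val ⟨j, hj⟩).map Fin.val else [], fun j hj hk => ?_,
    fun j hj hk => ?_⟩, rfl, ?_, fun j _ => ⟨rfl, rfl, rfl⟩⟩
  · rw [hkind j hj] at hk
    rw [hl j hj, hr j hj]
    cases hrule : G.rule ⟨j, hj⟩ with
    | letter a => simp [hrule, encodeExpr] at hk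
    | pair l r =>
      have h1 := l.isLt
      have h2 := r.isLt
      refine ⟨h1, h2, ?_⟩
      simp only [encodeExpr, List.getD_cons_succ, List.getD_cons_zero]
      rw [dif_pos hj, dif_pos (h1.trans hj), dif_pos (h2.trans hj), (hval j hj).2 l r hrule,
        List.map_append]
  · rw [hkind j hj] at hk
    rw [hl j hj]
    cases hrule : G.rule ⟨j, hj⟩ with
    | letter a =>
      rw [dif_pos hj, (hval j hj).1 a hrule]
      rfl
    | pair l r => simp [hrule, encodeExpr] at hk
  · exact dif_pos (Nat.sub_lt G.size_pos Nat.one_pos)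

end SLP

/-! ### The complete algorithm -/

namespace WordRAM

open Exp

/-- From the input, an SLP, to the LZ77 factorization. -/
def lz77 (sr : Bool) : Program :=
  assign 0 (ld 0) ;; prune ;; lengths ;; allRows ;; allFactors sr

/-- As `n + N ≥ 2`, five of the seven factors supply the constant `32`; the remaining square
dominates the table, which is quadratic in `n`. -/
theorem fits_of_pow_le {n N w : ℕ} (hn : 1 ≤ n) (hN : 1 ≤ N) (h : (n + N) ^ 7 ≤ 2 ^ w) :
    20 * (N + 1) ≤ cap w ∧ 3 * n + 1 + (n + 3) * n * 4 ≤ cap w := by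
  have h5 : 2 ^ 5 ≤ (n + N) ^ 5 := Nat.pow_le_pow_left (by omega) 5
  have h7 : 2 ^ 5 * (n + N) ^ 2 ≤ cap w :=
    (Nat.mul_le_mul_right _ h5).trans (by rw [← pow_add]; exact h)
  constructor <;> nlinarith

theorem runs_lz77 {σ w : ℕ} {sr : Bool} (G : SLP (Fin σ))
    (hw : (G.size + G.str.length) ^ 7 ≤ 2 ^ w) :
    Runs w (lz77 sr) (State.init G.encode) fun H t =>
      ∃ fs ts, LZ77.IsFactorization sr G.str fs ∧ LZ77.IsEncoding sr fs ts ∧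
        H.output = (ts.map LZ77.Token.encode).flatten ∧
        t ≤ 200000 * fs.length * G.size ^ 3 * (Nat.log 2 G.str.length + 1) := by
  obtain ⟨R, hRn, hRv, hRin⟩ := G.exists_rules
  have hnpos := R.n_pos
  have hNpos : 0 < G.str.length := by
    have := R.length_pos (show R.n - 1 < R.n by omega)
    rwa [hRv, List.length_map] at this
  obtain ⟨hnum, hmem⟩ := fits_of_pow_le (n := R.n) (by omega) hNpos (by rw [hRn]; exact hw)
  have hz : ∀ a, 3 * R.n + 1 ≤ a → (State.init G.encode).mem a = 0 := fun a ha =>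
    List.getD_eq_default _ _ (by rw [G.length_encode]; omega)
  have hsize : (State.init G.encode).mem 0 = R.n := hRn.symm
  refine Runs.assign_seq (by simp; omega) (Runs.seq ?_)
  refine (runs_prune (R := R) (H := (State.init G.encode).set 0 _) (by omega) hmem
    (by simpa using hsize) rfl hRin
    fun j _ => hz _ (by simp only [addr]; omega)).mono ?_
  rintro H₁ t₁ ⟨ht₁, hP⟩
  obtain ⟨g, hgn, hgv, hgin⟩ := hP.exists_gram
  have hS : g.val (g.n - 1) = G.str.map Fin.val := hgv.trans hRv
  have hN : g.N = G.str.length := by simp [Gram.N, Gram.len, hS]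
  have hf : Fits g w := ⟨by rw [Gram.inf, hN]; exact hnum, by rw [hgn]; exact hmem⟩
  refine Runs.seq ((runs_lengths hf (hP.size.trans hgn.symm) hP.output hgin).mono ?_)
  rintro H₂ t₂ ⟨ht₂, ho₂, hc₂⟩
  refine Runs.seq ((runs_allRows hc₂).mono ?_)
  rintro H₃ t₃ ⟨ht₃, -, ho₃, hc₃, hrows⟩
  refine (runs_allFactors hc₃ hrows (ho₃.trans ho₂)).mono ?_
  rintro H₄ t₄ ⟨ls, hparse, ht₄⟩
  obtain ⟨fs, ts, h1, h2, h3, h4⟩ := hparse.exists_isEncoding hS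
  refine ⟨fs, ts, h1, h2, h3, ?_⟩
  have hls := hparse.length_pos (hN ▸ hNpos)
  have hbound : 200000 * fs.length * G.size ^ 3 * (Nat.log 2 G.str.length + 1) =
      200000 * (g.n * (g.n * g.K) * ls.length) := by
    rw [Gram.K, hN, hgn, hRn, h4]
    ring
  rw [hbound]
  -- The text is nonempty, so there is at least one factor, to which all preparation can be charged;
  -- `132000` and `43000` and the small terms stay below `200000`.
  have e1 : g.n * (g.n * g.K) * 1 ≤ g.n * (g.n * g.K) * ls.length := Nat.mul_le_mul_left _ hls
  have hnK := g.n_le_K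
  have e2 : 1 ≤ g.n * g.K := Nat.mul_pos g.n_pos (by have := g.n_pos; omega)
  have e3 : g.n * 1 ≤ g.n * (g.n * g.K) := Nat.mul_le_mul_left _ e2
  have e4 : 132000 * (g.n * (g.n * g.K)) * ls.length =
    132000 * (g.n * (g.n * g.K) * ls.length) := by ring
  rw [← hgn] at ht₁ hnpos
  simp only [cost_ld, cost_ofNat]
  linarith

end WordRAM

theorem theorem17 (selfRef : Bool) :
    ∃ (P : WordRAM.Program) (c C : ℕ),
      ∀ (σ w : ℕ) (G : SLP (Fin σ)),
        σ ≤ 2 ^ w →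
        (G.size + G.str.length) ^ c ≤ 2 ^ w →
        ∃ (fs : List (List (Fin σ))) (ts : List (LZ77.Token (Fin σ)))
          (s : WordRAM.State) (t : ℕ),
          LZ77.IsFactorization selfRef G.str fs ∧
          LZ77.IsEncoding selfRef fs ts ∧
          WordRAM.Exec w P (WordRAM.State.init G.encode) s t ∧
          s.output = (ts.map LZ77.Token.encode).flatten ∧
          t ≤ C * fs.length * G.size ^ 3 * (Nat.log 2 G.str.length + 1) := by
  refine ⟨WordRAM.lz77 selfRef, 7, 200000, fun σ w G _ hw => ?_⟩
  obtain ⟨s, H, t, hexec, hsim, fs, ts, h1, h2, h3, h4⟩ :=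
    WordRAM.runs_lz77 G hw _ ⟨fun _ _ => rfl, rfl, rfl⟩
  exact ⟨fs, ts, s, t, h1, h2, hexec, hsim.2.2.trans h3, h4⟩
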